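/- Let $k\ge 2$, let $(L^k,g)$ be a compact oriented Riemannian manifold (without boundary) with volume form $\mathsf{vol}_L$, let $(M^n,h)$ be a Riemannian manifold, and let $\alpha\in\Omega^k(M)$ be a closed calibration, that is, $d\alpha=0$ and $\alpha(v_1\wedge\cdots\wedge v_k)\le |v_1\wedge\cdots\wedge v_k|$ for all $x \in M$ and $v_1,\dots,v_k\in T_xM$. For a smooth map $u\colon L\to M$ let $|du|^2=\operatorname{tr}_g(u^*h)$ and $$E_k(u)=\frac{1}{(\sqrt k)^k}\int_L |du|^k\,\mathsf{vol}_L .$$ A smooth map $u\colon L\to M$ is a Smith immersion with respect to $\alpha$ if $u^*\alpha=\frac{1}{(\sqrt k)^k}|du|^k\,\mathsf{vol}_L$ and $u^*h=\frac1k|du|^2 g$ at all points of $L$. It is $k$-harmonic if it is a critical point of $E_k$: for every smooth family $(u_s)_{s\in\mathbb R}$ of maps $L \to M$ with $u_0=u$, the derivative $\frac{d}{ds}\big|_{s=0}E_k(u_s)$ exists and equals $0$. Integration $[\theta]\mapsto\int_L\theta$ is a well-defined linear functional on the de Rham cohomology $H^k(L;\mathbb R)$, the fundamental class $[L]$. For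 a smooth map $u\colon L\to M$ let $u_*[L]$ be the functional $[\beta]\mapsto [L](u^*[\beta])=\int_L u^*\beta$ on $H^k(M;\mathbb R)$; it depends only on the homotopy class of $u$. Write $[\alpha]\cdot u_*[L]=\int_L u^*\alpha$ for its value at $[\alpha]$. Then: 1. For every smooth map $u\colon L\to M$, $E_k(u)\ge[\alpha]\cdot u_*[L]$, and equality holds if and only if $u$ is a Smith immersion with respect to $\alpha$. 2. If $u\colon L\to M$ is a Smith immersion with respect to $\alpha$, then $E_k(u)\le E_k(v)$ for every smooth map $v\colon L\to M$ homotopic to $u$, and $u$ is $k$-harmonic. -/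

import Mathlib

open scoped Manifold ContDiff Bundle Topology
open Bundle

noncomputable section

namespace SmithMaps

/-! ### Differential forms on a manifold -/

section Forms

variable {k n : ℕ}
  {L : Type*} [TopologicalSpace L] [ChartedSpace (EuclideanSpace ℝ (Fin k)) L]
  {M : Type*} [TopologicalSpace M] [ChartedSpace (EuclideanSpace ℝ (Fin n)) M]

variable (n M) in
/-- (Not necessarily smooth) differential `p`-forms on an `n`-dimensional manifold `M`. -/
def Form (p : ℕ) : Type _ := ∀ x : M, TangentSpace (𝓡 n) x [⋀^Fin p]→L[ℝ] ℝ

instance (p : ℕ) : AddCommGroup (Form n M p) :=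
  inferInstanceAs (AddCommGroup (∀ x : M, TangentSpace (𝓡 n) x [⋀^Fin p]→L[ℝ] ℝ))

instance (p : ℕ) : Module ℝ (Form n M p) :=
  inferInstanceAs (Module ℝ (∀ x : M, TangentSpace (𝓡 n) x [⋀^Fin p]→L[ℝ] ℝ))

/-- The pullback `u^* θ`. -/
def pullback {p : ℕ} (u : L → M) (θ : Form n M p) : Form k L p :=
  fun x => (θ (u x)).compContinuousLinearMap (mfderiv (𝓡 k) (𝓡 n) u x)

/-- The coordinate expression of `θ` in the chart at `x₀`: the pullback of `θ` by the inverse of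
this chart, as a form on the model space. -/
def localRep {p : ℕ} (θ : Form n M p) (x₀ : M) :
    EuclideanSpace ℝ (Fin n) → EuclideanSpace ℝ (Fin n) [⋀^Fin p]→L[ℝ] ℝ :=
  pullback (L := EuclideanSpace ℝ (Fin n)) (extChartAt (𝓡 n) x₀).symm θ

/-- A form is smooth if all its coordinate expressions are. -/
def IsSmoothForm {p : ℕ} (θ : Form n M p) : Prop :=
  ∀ x₀ : M, ContDiffOn ℝ ∞ (localRep θ x₀) (extChartAt (𝓡 n) x₀).target

/-- The exterior derivative, computed at each point `x` in the chart at `x`. -/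
def mextDeriv {p : ℕ} (θ : Form n M p) : Form n M (p + 1) :=
  fun x => (extDeriv (localRep θ x) (extChartAt (𝓡 n) x x)).compContinuousLinearMap
    (mfderiv (𝓡 n) (𝓡 n) (extChartAt (𝓡 n) x) x)

lemma form_congr {p : ℕ} (θ : Form n M p) {z z' : M} (hz : z = z')
    {v v' : Fin p → EuclideanSpace ℝ (Fin n)} (hv : v = v') :
    (θ z : (Fin p → EuclideanSpace ℝ (Fin n)) → ℝ) v
      = (θ z' : (Fin p → EuclideanSpace ℝ (Fin n)) → ℝ) v' := by
  subst hz; subst hv; rfl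

lemma pullback_congr {p : ℕ} (θ : Form n M p) {f g : L → M} {x : L} (h : f =ᶠ[𝓝 x] g) :
    pullback (k := k) f θ x = pullback g θ x := by
  ext v
  refine form_congr θ h.eq_of_nhds ?_
  funext i
  exact congrArg (fun A : EuclideanSpace ℝ (Fin k) →L[ℝ] EuclideanSpace ℝ (Fin n) => A (v i))
    h.mfderiv_eq

lemma pullback_comp {p : ℕ} {m : ℕ} {N : Type*} [TopologicalSpace N]
    [ChartedSpace (EuclideanSpace ℝ (Fin m)) N] (θ : Form n M p) {f : L → M} {g : N → L} {x : N}
    (hf : MDifferentiableAt (𝓡 k) (𝓡 n) f (g x)) (hg : MDifferentiableAt (𝓡 m) (𝓡 k) g x) :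
    pullback (k := m) (f ∘ g) θ x = pullback g (pullback (k := k) f θ) x := by
  ext v
  refine form_congr θ rfl ?_
  funext i
  rw [Function.comp_apply, mfderiv_comp x hf hg]
  rfl

lemma pullback_add {p : ℕ} (u : L → M) (θ η : Form n M p) :
    pullback (k := k) u (θ + η) = pullback u θ + pullback u η := rfl

lemma pullback_smul {p : ℕ} (u : L → M) (c : ℝ) (θ : Form n M p) :
    pullback (k := k) u (c • θ) = c • pullback u θ := rfl

lemma localRep_add {p : ℕ} (θ η : Form n M p) (x : M) :
    localRep (θ + η) x = localRep θ x + localRep η x := rfl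

lemma localRep_smul {p : ℕ} (c : ℝ) (θ : Form n M p) (x : M) :
    localRep (c • θ) x = c • localRep θ x := rfl

lemma IsSmoothForm.contDiffAt {p : ℕ} {θ : Form n M p} (h : IsSmoothForm θ) {x₀ : M}
    {y : EuclideanSpace ℝ (Fin n)} (hy : y ∈ (extChartAt (𝓡 n) x₀).target) :
    ContDiffAt ℝ ∞ (localRep θ x₀) y :=
  (h x₀).contDiffAt ((isOpen_extChartAt_target x₀).mem_nhds hy)

lemma IsSmoothForm.differentiableAt {p : ℕ} {θ : Form n M p} (h : IsSmoothForm θ) (x : M) :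
    DifferentiableAt ℝ (localRep θ x) (extChartAt (𝓡 n) x x) :=
  (h.contDiffAt (mem_extChartAt_target x)).differentiableAt (by simp)

lemma mextDeriv_add {p : ℕ} {θ η : Form n M p} (h : IsSmoothForm θ) (h' : IsSmoothForm η) :
    mextDeriv (θ + η) = mextDeriv θ + mextDeriv η := by
  funext x
  rw [mextDeriv, localRep_add, extDeriv_add (h.differentiableAt x) (h'.differentiableAt x)]
  rfl

lemma mextDeriv_smul {p : ℕ} (c : ℝ) (θ : Form n M p) :
    mextDeriv (c • θ) = c • mextDeriv θ := by
  funext x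
  rw [mextDeriv, localRep_smul, extDeriv_smul]
  rfl

variable (n M) in
/-- The space `Ω^p(M)` of smooth `p`-forms. -/
def smoothForms (p : ℕ) : Submodule ℝ (Form n M p) where
  carrier := {θ | IsSmoothForm θ}
  add_mem' h h' x := (h x).add (h' x)
  zero_mem' _ := contDiffOn_const (c := 0)
  smul_mem' c _ h x := (h x).const_smul c

lemma mextDeriv_zero {p : ℕ} : mextDeriv (0 : Form n M p) = 0 := by
  simpa using mextDeriv_smul (0 : ℝ) (0 : Form n M p)

variable (n M) in
/-- The space of closed smooth `p`-forms. -/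
def closedForms (p : ℕ) : Submodule ℝ (Form n M p) where
  carrier := {θ | θ ∈ smoothForms n M p ∧ mextDeriv θ = 0}
  add_mem' h h' := ⟨add_mem h.1 h'.1, by rw [mextDeriv_add h.1 h'.1, h.2, h'.2, add_zero]⟩
  zero_mem' := ⟨zero_mem _, mextDeriv_zero⟩
  smul_mem' c _ h := ⟨Submodule.smul_mem _ c h.1, by rw [mextDeriv_smul, h.2, smul_zero]⟩

variable (n M) in
/-- The space of exact `p`-forms: `dη` with `η` a smooth `(p-1)`-form (only `0` for `p = 0`). -/
def exactForms : ∀ p : ℕ, Submodule ℝ (Form n M p)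
  | 0 => ⊥
  | p + 1 =>
    { carrier := {θ | ∃ η ∈ smoothForms n M p, mextDeriv η = θ}
      add_mem' := by
        rintro _ _ ⟨η, h, rfl⟩ ⟨η', h', rfl⟩
        exact ⟨η + η', add_mem h h', mextDeriv_add h h'⟩
      zero_mem' := ⟨0, zero_mem _, mextDeriv_zero⟩
      smul_mem' := by
        rintro c _ ⟨η, h, rfl⟩
        exact ⟨c • η, Submodule.smul_mem _ c h, mextDeriv_smul c η⟩ }

variable (n M) in
/-- De Rham cohomology `H^p(M; ℝ)`: closed forms modulo exact forms. -/
abbrev DeRham (p : ℕ) : Type _ :=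
  closedForms n M p ⧸ (exactForms n M p).submoduleOf (closedForms n M p)

/-- The de Rham class `[θ]` of a closed form. -/
def deRhamClass {p : ℕ} (θ : closedForms n M p) : DeRham n M p := Submodule.Quotient.mk θ

/-! Functoriality of de Rham cohomology. -/

variable [IsManifold (𝓡 k) ∞ L] [IsManifold (𝓡 n) ∞ M]

variable (k n) in
/-- `u` read in the chart at `x₀` and the chart at `z`. -/
def readIn (u : L → M) (x₀ : L) (z : M) (y : EuclideanSpace ℝ (Fin k)) :
    EuclideanSpace ℝ (Fin n) :=
  extChartAt (𝓡 n) z (u ((extChartAt (𝓡 k) x₀).symm y))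

lemma contDiffAt_readIn {u : L → M} (hu : ContMDiff (𝓡 k) (𝓡 n) ∞ u) (x₀ : L) (z : M)
    {y : EuclideanSpace ℝ (Fin k)} (hy : y ∈ (extChartAt (𝓡 k) x₀).target)
    (hz : u ((extChartAt (𝓡 k) x₀).symm y) ∈ (extChartAt (𝓡 n) z).source) :
    ContDiffAt ℝ ∞ (readIn k n u x₀ z) y := by
  rw [← contMDiffAt_iff_contDiffAt]
  have h1 : ContMDiffAt (𝓡 k) (𝓡 k) ∞ (extChartAt (𝓡 k) x₀).symm y :=
    (contMDiffOn_extChartAt_symm (I := 𝓡 k) (n := ∞) x₀).contMDiffAt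
      ((isOpen_extChartAt_target x₀).mem_nhds hy)
  have h3 := contMDiffAt_extChartAt' (I := 𝓡 n) (n := ∞) (x := z) (by simpa using hz)
  exact h3.comp y ((hu _).comp y h1)

lemma localRep_pullback {p : ℕ} {u : L → M} (hu : ContMDiff (𝓡 k) (𝓡 n) ∞ u) (θ : Form n M p)
    (x₀ : L) (z : M) {y : EuclideanSpace ℝ (Fin k)} (hy : y ∈ (extChartAt (𝓡 k) x₀).target)
    (hz : u ((extChartAt (𝓡 k) x₀).symm y) ∈ (extChartAt (𝓡 n) z).source) :
    localRep (pullback u θ) x₀ =ᶠ[𝓝 y] fun y' =>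
      (localRep θ z (readIn k n u x₀ z y')).compContinuousLinearMap
        (fderiv ℝ (readIn k n u x₀ z) y') := by
  have hc : ContinuousAt (u ∘ (extChartAt (𝓡 k) x₀).symm) y :=
    (hu.continuous.continuousAt).comp
      ((continuousOn_extChartAt_symm x₀).continuousAt ((isOpen_extChartAt_target x₀).mem_nhds hy))
  have hev : ∀ᶠ y' in 𝓝 y, y' ∈ (extChartAt (𝓡 k) x₀).target ∧
      u ((extChartAt (𝓡 k) x₀).symm y') ∈ (extChartAt (𝓡 n) z).source :=
    Filter.Eventually.and ((isOpen_extChartAt_target x₀).mem_nhds hy)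
      (hc.preimage_mem_nhds ((isOpen_extChartAt_source z).mem_nhds hz))
  filter_upwards [hev.eventually_nhds] with y' hy'
  obtain ⟨h1, h2⟩ := hy'.self_of_nhds
  have d1 : MDifferentiableAt (𝓡 k) (𝓡 k) (extChartAt (𝓡 k) x₀).symm y' :=
    ((contMDiffOn_extChartAt_symm (I := 𝓡 k) (n := ∞) x₀).contMDiffAt
      ((isOpen_extChartAt_target x₀).mem_nhds h1)).mdifferentiableAt (by simp)
  have d2 : MDifferentiableAt (𝓡 k) (𝓡 n) u ((extChartAt (𝓡 k) x₀).symm y') :=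
    (hu _).mdifferentiableAt (by simp)
  have d3 : MDifferentiableAt (𝓡 k) (𝓡 n) (readIn k n u x₀ z) y' :=
    (contMDiffAt_iff_contDiffAt.2 (contDiffAt_readIn hu x₀ z h1 h2)).mdifferentiableAt (by simp)
  have d4 : MDifferentiableAt (𝓡 n) (𝓡 n) (extChartAt (𝓡 n) z).symm (readIn k n u x₀ z y') :=
    ((contMDiffOn_extChartAt_symm (I := 𝓡 n) (n := ∞) z).contMDiffAt
      ((isOpen_extChartAt_target z).mem_nhds ((extChartAt (𝓡 n) z).map_source h2))).mdifferentiableAt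
      (by simp)
  have e1 : localRep (pullback u θ) x₀ y' =
      pullback (k := k) (L := EuclideanSpace ℝ (Fin k)) (u ∘ (extChartAt (𝓡 k) x₀).symm) θ y' :=
    (pullback_comp θ d2 d1).symm
  have e2 : (u ∘ (extChartAt (𝓡 k) x₀).symm) =ᶠ[𝓝 y']
      (extChartAt (𝓡 n) z).symm ∘ readIn k n u x₀ z := by
    filter_upwards [hy'] with w hw
    exact ((extChartAt (𝓡 n) z).left_inv hw.2).symm
  have e3 := pullback_comp (k := n) (L := EuclideanSpace ℝ (Fin n)) θ d4 d3
  rw [e1, pullback_congr θ e2, e3]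
  ext v
  simp only [pullback, mfderiv_eq_fderiv]
  rfl

/-- The antisymmetrization of continuous multilinear maps, as a continuous linear map. -/
def alternatizationCLM (E : Type*) [NormedAddCommGroup E] [NormedSpace ℝ E] (p : ℕ) :
    ContinuousMultilinearMap ℝ (fun _ : Fin p => E) ℝ →L[ℝ] E [⋀^Fin p]→L[ℝ] ℝ :=
  LinearMap.mkContinuous
    { toFun := ContinuousMultilinearMap.alternatization
      map_add' := fun f g => map_add _ f g
      map_smul' := fun c f => by
        ext v
        simp [ContinuousMultilinearMap.alternatization_apply_apply, Finset.mul_sum,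
          mul_smul_comm] }
    (p.factorial : ℝ) (by
      intro f
      refine ContinuousAlternatingMap.opNorm_le_bound _ (by positivity) fun m => ?_
      simp only [LinearMap.coe_mk, AddHom.coe_mk,
        ContinuousMultilinearMap.alternatization_apply_apply]
      refine (norm_sum_le _ _).trans ?_
      have : ∀ σ ∈ (Finset.univ : Finset (Equiv.Perm (Fin p))),
          ‖Equiv.Perm.sign σ • f (m ∘ σ)‖ ≤ ‖f‖ * ∏ i, ‖m i‖ := by
        intro σ _
        have h1 : ‖Equiv.Perm.sign σ • f (m ∘ σ)‖ = ‖f (m ∘ σ)‖ := by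
          rcases Int.units_eq_one_or (Equiv.Perm.sign σ) with h | h <;> simp [h]
        rw [h1]
        refine (f.le_opNorm _).trans_eq ?_
        congr 1
        exact Equiv.prod_comp σ fun i => ‖m i‖
      refine (Finset.sum_le_sum this).trans_eq ?_
      simp [Finset.card_univ, Fintype.card_perm, mul_assoc])

lemma alternatizationCLM_coe {E : Type*} [NormedAddCommGroup E] [NormedSpace ℝ E] {p : ℕ}
    (f : E [⋀^Fin p]→L[ℝ] ℝ) :
    alternatizationCLM E p f.toContinuousMultilinearMap = (p.factorial : ℝ) • f := by
  ext v
  have h : ∀ σ : Equiv.Perm (Fin p), Equiv.Perm.sign σ • f (v ∘ σ) = f v := by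
    intro σ
    have h1 : f (v ∘ σ) = Equiv.Perm.sign σ • f v := f.toAlternatingMap.map_perm v σ
    rw [h1, smul_smul, ← sq, Int.units_sq, one_smul]
  change ContinuousMultilinearMap.alternatization f.toContinuousMultilinearMap v = _
  rw [ContinuousMultilinearMap.alternatization_apply_apply]
  refine (Finset.sum_congr rfl fun σ _ => h σ).trans ?_
  simp [Finset.card_univ, Fintype.card_perm]

lemma contDiffAt_comp_clm {D E F : Type*} [NormedAddCommGroup D] [NormedSpace ℝ D]
    [NormedAddCommGroup E] [NormedSpace ℝ E] [NormedAddCommGroup F] [NormedSpace ℝ F] {p : ℕ}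
    {f : D → F [⋀^Fin p]→L[ℝ] ℝ} {g : D → E →L[ℝ] F} {x : D}
    (hf : ContDiffAt ℝ ∞ f x) (hg : ContDiffAt ℝ ∞ g x) :
    ContDiffAt ℝ ∞ (fun y => (f y).compContinuousLinearMap (g y)) x := by
  have hp : (p.factorial : ℝ) ≠ 0 := by positivity
  have key : (fun y => (f y).compContinuousLinearMap (g y)) = fun y =>
      (p.factorial : ℝ)⁻¹ • alternatizationCLM E p
        (ContinuousMultilinearMap.compContinuousLinearMapContinuousMultilinear ℝ
          (fun _ : Fin p => E) (fun _ => F) ℝ (fun _ => g y)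
          (ContinuousAlternatingMap.toContinuousMultilinearMapCLM ℝ (f y))) := by
    funext y
    rw [eq_inv_smul_iff₀ hp, ← alternatizationCLM_coe]
    rfl
  rw [key]
  refine ContDiffAt.const_smul _ ((alternatizationCLM E p).contDiff.contDiffAt.comp x ?_)
  refine ContDiffAt.clm_apply ?_ ?_
  · exact (ContinuousMultilinearMap.contDiff _).contDiffAt.comp x (contDiffAt_pi.2 fun _ => hg)
  · exact (ContinuousLinearMap.contDiff _).contDiffAt.comp x hf

lemma IsSmoothForm.pullback {p : ℕ} {u : L → M} (hu : ContMDiff (𝓡 k) (𝓡 n) ∞ u)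
    {θ : Form n M p} (hθ : IsSmoothForm θ) : IsSmoothForm (pullback (k := k) u θ) := by
  intro x₀ y hy
  have hz := mem_extChartAt_source (I := 𝓡 n) (u ((extChartAt (𝓡 k) x₀).symm y))
  have hw := contDiffAt_readIn hu x₀ _ hy hz
  have hr : ContDiffAt ℝ ∞ (localRep θ (u ((extChartAt (𝓡 k) x₀).symm y)))
      (readIn k n u x₀ (u ((extChartAt (𝓡 k) x₀).symm y)) y) :=
    hθ.contDiffAt (mem_extChartAt_target _)
  exact ((contDiffAt_comp_clm (hr.comp y hw)
    (hw.fderiv_right (m := ∞) (by simp))).congr_of_eventuallyEq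
      (localRep_pullback hu θ x₀ _ hy hz)).contDiffWithinAt

lemma mextDeriv_pullback {p : ℕ} {u : L → M} (hu : ContMDiff (𝓡 k) (𝓡 n) ∞ u)
    {θ : Form n M p} (hθ : IsSmoothForm θ) :
    mextDeriv (pullback (k := k) u θ) = pullback u (mextDeriv θ) := by
  funext x
  have hy := mem_extChartAt_target (I := 𝓡 k) x
  have hx : (extChartAt (𝓡 k) x).symm (extChartAt (𝓡 k) x x) = x := extChartAt_to_inv x
  have hz : u ((extChartAt (𝓡 k) x).symm (extChartAt (𝓡 k) x x)) ∈
      (extChartAt (𝓡 n) (u x)).source := by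
    rw [hx]; exact mem_extChartAt_source _
  have hw := contDiffAt_readIn hu x (u x) hy hz
  have hwx : readIn k n u x (u x) (extChartAt (𝓡 k) x x) = extChartAt (𝓡 n) (u x) (u x) := by
    simp only [readIn, hx]
  have hd : DifferentiableAt ℝ (localRep θ (u x)) (readIn k n u x (u x) (extChartAt (𝓡 k) x x)) := by
    rw [hwx]; exact hθ.differentiableAt (u x)
  rw [mextDeriv, (localRep_pullback hu θ x (u x) hy hz).extDeriv_eq,
    extDeriv_pullback hd hw (r := ∞) (by
      rw [minSmoothness_of_isRCLikeNormedField]; exact WithTop.coe_le_coe.2 le_top)]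
  have dφ : MDifferentiableAt (𝓡 k) (𝓡 k) (extChartAt (𝓡 k) x) x :=
    (contMDiffAt_extChartAt (I := 𝓡 k) (n := ∞)).mdifferentiableAt (by simp)
  have dψ : MDifferentiableAt (𝓡 n) (𝓡 n) (extChartAt (𝓡 n) (u x)) (u x) :=
    (contMDiffAt_extChartAt (I := 𝓡 n) (n := ∞)).mdifferentiableAt (by simp)
  have du : MDifferentiableAt (𝓡 k) (𝓡 n) u x := (hu x).mdifferentiableAt (by simp)
  have dw : MDifferentiableAt (𝓡 k) (𝓡 n) (readIn k n u x (u x)) (extChartAt (𝓡 k) x x) :=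
    (contMDiffAt_iff_contDiffAt.2 hw).mdifferentiableAt (by simp)
  have hev : readIn k n u x (u x) ∘ extChartAt (𝓡 k) x =ᶠ[𝓝 x] extChartAt (𝓡 n) (u x) ∘ u := by
    filter_upwards [(isOpen_extChartAt_source (I := 𝓡 k) x).mem_nhds
      (mem_extChartAt_source x)] with w hw
    simp only [readIn, Function.comp_apply, (extChartAt (𝓡 k) x).left_inv hw]
  have hD := hev.mfderiv_eq (I := 𝓡 k) (I' := 𝓡 n)
  rw [mfderiv_comp x dw dφ, mfderiv_comp x dψ du, mfderiv_eq_fderiv] at hD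
  ext v
  rw [hwx]
  refine congrArg (extDeriv (localRep θ (u x)) (extChartAt (𝓡 n) (u x) (u x))) ?_
  funext i
  exact congrArg (fun A : EuclideanSpace ℝ (Fin k) →L[ℝ] EuclideanSpace ℝ (Fin n) => A (v i)) hD

lemma pullback_mem_closedForms {p : ℕ} {u : L → M} (hu : ContMDiff (𝓡 k) (𝓡 n) ∞ u)
    {θ : Form n M p} (hθ : θ ∈ closedForms n M p) : pullback u θ ∈ closedForms k L p :=
  ⟨IsSmoothForm.pullback hu hθ.1, by rw [mextDeriv_pullback hu hθ.1, hθ.2]; rfl⟩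

lemma pullback_mem_exactForms {p : ℕ} {u : L → M} (hu : ContMDiff (𝓡 k) (𝓡 n) ∞ u)
    {θ : Form n M p} (hθ : θ ∈ exactForms n M p) : pullback u θ ∈ exactForms k L p := by
  cases p with
  | zero =>
    have h0 : θ = 0 := hθ
    subst h0
    exact zero_mem _
  | succ p =>
    obtain ⟨η, h, rfl⟩ := hθ
    exact ⟨pullback u η, IsSmoothForm.pullback hu h, mextDeriv_pullback hu h⟩

/-- The pullback of closed forms by a smooth map. -/
def pullbackClosed (p : ℕ) (u : C^∞⟮𝓡 k, L; 𝓡 n, M⟯) :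
    closedForms n M p →ₗ[ℝ] closedForms k L p where
  toFun θ := ⟨pullback u θ.1, pullback_mem_closedForms u.contMDiff θ.2⟩
  map_add' _ _ := rfl
  map_smul' _ _ := rfl

/-- The map `u^* : H^p(M) → H^p(L)`, `[θ] ↦ [u^* θ]`. -/
def cohomologyPullback (p : ℕ) (u : C^∞⟮𝓡 k, L; 𝓡 n, M⟯) : DeRham n M p →ₗ[ℝ] DeRham k L p :=
  Submodule.mapQ _ _ (pullbackClosed p u) fun _ h => pullback_mem_exactForms u.contMDiff h

end Forms

/-! ### Oriented Riemannian manifolds -/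

section Riemannian

open MeasureTheory

instance {k : ℕ} {L : Type*} [TopologicalSpace L] [ChartedSpace (EuclideanSpace ℝ (Fin k)) L]
    (x : L) : FiniteDimensional ℝ (TangentSpace (𝓡 k) x) :=
  inferInstanceAs (FiniteDimensional ℝ (EuclideanSpace ℝ (Fin k)))

instance {k : ℕ} {L : Type*} [TopologicalSpace L] [ChartedSpace (EuclideanSpace ℝ (Fin k)) L]
    (x : L) : Fact (Module.finrank ℝ (TangentSpace (𝓡 k) x) = k) :=
  ⟨(finrank_euclideanSpace_fin : Module.finrank ℝ (EuclideanSpace ℝ (Fin k)) = k)⟩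

/-- An orientation of a `k`-dimensional manifold: an orientation of every tangent space which is
locally constant in the trivializations of the tangent bundle given by the charts. -/
structure ManifoldOrientation (k : ℕ) (L : Type*) [TopologicalSpace L]
    [ChartedSpace (EuclideanSpace ℝ (Fin k)) L] [IsManifold (𝓡 k) ∞ L] where
  /-- The orientation of the tangent space at `x`. -/
  at' (x : L) : Orientation ℝ (TangentSpace (𝓡 k) x) (Fin k)
  locally_const (x₀ : L) : ∃ σ : Orientation ℝ (EuclideanSpace ℝ (Fin k)) (Fin k),
    ∀ᶠ x in 𝓝 x₀, ∃ hx : x ∈ (trivializationAt (EuclideanSpace ℝ (Fin k))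
        (TangentSpace (𝓡 k) : L → Type) x₀).baseSet,
      Orientation.map (Fin k) ((trivializationAt (EuclideanSpace ℝ (Fin k))
        (TangentSpace (𝓡 k) : L → Type) x₀).continuousLinearEquivAt ℝ x hx).toLinearEquiv
          (at' x) = σ

variable {k n : ℕ}
  {L : Type*} [TopologicalSpace L] [ChartedSpace (EuclideanSpace ℝ (Fin k)) L]
  [RiemannianBundle (fun x : L => TangentSpace (𝓡 k) x)]
  {M : Type*} [TopologicalSpace M] [ChartedSpace (EuclideanSpace ℝ (Fin n)) M]
  [RiemannianBundle (fun x : M => TangentSpace (𝓡 n) x)]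

/-- The coordinate frame `∂₁, …, ∂ₖ` of the chart at `x₀`, at the point with coordinates `y`. -/
def coordFrame (x₀ : L) (y : EuclideanSpace ℝ (Fin k)) (i : Fin k) :
    TangentSpace (𝓡 k) ((extChartAt (𝓡 k) x₀).symm y) :=
  mfderiv (𝓡 k) (𝓡 k) (extChartAt (𝓡 k) x₀).symm y (EuclideanSpace.single i (1 : ℝ))

/-- The measure `√(det g(∂ᵢ, ∂ⱼ)) dy` on the domain of the chart at `x₀`, as a measure on `L`
vanishing outside of this domain. -/
def chartVolume [MeasurableSpace L] (x₀ : L) : Measure L :=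
  ((volume.restrict (extChartAt (𝓡 k) x₀).target).withDensity fun y =>
    ENNReal.ofReal √(Matrix.gram ℝ (coordFrame x₀ y)).det).map (extChartAt (𝓡 k) x₀).symm

variable (k L) in
/-- The Riemannian volume measure: the measures `chartVolume x₀` are the restrictions to the chart
domains of a single measure on `L`, which is their supremum. -/
def riemannianVolume [MeasurableSpace L] : Measure L := ⨆ x₀ : L, chartVolume (k := k) x₀

/-- The Riemannian volume form `vol_L` of an oriented Riemannian manifold, at the point `x`. -/
def volForm [IsManifold (𝓡 k) ∞ L] (o : ManifoldOrientation k L) (x : L) :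
    TangentSpace (𝓡 k) x [⋀^Fin k]→ₗ[ℝ] ℝ :=
  (o.at' x).volumeForm

/-- The function `f` with `θ = f vol_L`, for a form `θ` of top degree; it is the quotient of the
values of `θ` and `vol_L` on an arbitrary basis of the tangent space. -/
def volRatio [IsManifold (𝓡 k) ∞ L] (o : ManifoldOrientation k L) (θ : Form k L k) (x : L) : ℝ :=
  θ x (fun i => (EuclideanSpace.single i (1 : ℝ) : EuclideanSpace ℝ (Fin k))) /
    volForm o x (fun i => (EuclideanSpace.single i (1 : ℝ) : EuclideanSpace ℝ (Fin k)))

/-- The integral `∫_L θ` of a form of top degree: `∫_L f vol_L` is the integral of the function `f`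
with respect to the Riemannian volume measure. -/
def formIntegral [MeasurableSpace L] [IsManifold (𝓡 k) ∞ L] (o : ManifoldOrientation k L)
    (θ : Form k L k) : ℝ :=
  ∫ x, volRatio o θ x ∂(riemannianVolume k L)

/-- `F` is the fundamental class `[L]` as a functional on cohomology: `F [θ] = ∫_L θ`. -/
def IsFundamentalClass [MeasurableSpace L] [IsManifold (𝓡 k) ∞ L] (o : ManifoldOrientation k L)
    (F : Module.Dual ℝ (DeRham k L k)) : Prop :=
  ∀ θ : closedForms k L k, F (deRhamClass θ) = formIntegral o θ.1

/-- `|du_x|`, where `|du_x|² = ∑ᵢ |du_x(eᵢ)|²` for an orthonormal basis `eᵢ` of `T_x L`. -/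
def normDu (u : L → M) (x : L) : ℝ :=
  √(∑ i, ‖mfderiv (𝓡 k) (𝓡 n) u x (stdOrthonormalBasis ℝ (TangentSpace (𝓡 k) x) i)‖ ^ 2)

variable (k n) in
/-- The `p`-energy `E_p(u) = (√p)⁻ᵖ ∫_L |du|^p vol_L`. -/
def energy [MeasurableSpace L] (p : ℝ) (u : L → M) : ℝ :=
  1 / (√p) ^ p * ∫ x, normDu (k := k) (n := n) u x ^ p ∂(riemannianVolume k L)

/-- A smooth map is `p`-harmonic if it is a critical point of `E_p`: for all smooth families
`U s`, `s ∈ ℝ`, of maps with `U 0 = u`, the derivative of `s ↦ E_p(U s)` at `0` (exists and)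
vanishes. -/
def IsPHarmonic [MeasurableSpace L] (p : ℝ) (u : C^∞⟮𝓡 k, L; 𝓡 n, M⟯) : Prop :=
  ∀ U : ℝ → L → M,
    ContMDiff (𝓘(ℝ, ℝ).prod (𝓡 k)) (𝓡 n) ∞ (fun q : ℝ × L => U q.1 q.2) → U 0 = u →
    HasDerivAt (fun s => energy k n p (U s)) 0 0

/-- `α(v₁ ∧ ⋯ ∧ v_p) ≤ |v₁ ∧ ⋯ ∧ v_p|` for all tangent vectors at the same point, where
`|v₁ ∧ ⋯ ∧ v_p|² = det ⟨vᵢ, vⱼ⟩`. -/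
def IsCalibration {p : ℕ} (α : Form n M p) : Prop :=
  ∀ (x : M) (v : Fin p → TangentSpace (𝓡 n) x), α x v ≤ √(Matrix.gram ℝ v).det

/-- Smith immersions with respect to the `k`-form `α`, `k = dim L`:
`u^* α = (√k)⁻ᵏ |du|ᵏ vol_L` and `u^* h = k⁻¹ |du|² g`. -/
def IsSmithImmersion [IsManifold (𝓡 k) ∞ L] (o : ManifoldOrientation k L) (α : Form n M k)
    (u : C^∞⟮𝓡 k, L; 𝓡 n, M⟯) : Prop :=
  ∀ x : L,
    (∀ v : Fin k → TangentSpace (𝓡 k) x, pullback (k := k) u α x v =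
      1 / (√(k : ℝ)) ^ k * normDu (k := k) (n := n) u x ^ k * volForm o x v) ∧
    ∀ v w : TangentSpace (𝓡 k) x,
      inner ℝ (mfderiv (𝓡 k) (𝓡 n) u x v) (mfderiv (𝓡 k) (𝓡 n) u x w) =
        1 / (k : ℝ) * normDu (k := k) (n := n) u x ^ 2 * inner ℝ v w

end Riemannian

section Homology

variable {k n : ℕ}
  {L : Type*} [TopologicalSpace L] [ChartedSpace (EuclideanSpace ℝ (Fin k)) L]
  {M : Type*} [TopologicalSpace M] [ChartedSpace (EuclideanSpace ℝ (Fin n)) M]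
  [IsManifold (𝓡 k) ∞ L] [IsManifold (𝓡 n) ∞ M]

/-- The pushforward `u_*` of homology classes, regarded as functionals on de Rham cohomology: the
transpose of `u^*`. -/
def homologyPushforward {p : ℕ} (u : C^∞⟮𝓡 k, L; 𝓡 n, M⟯) (F : Module.Dual ℝ (DeRham k L p)) :
    Module.Dual ℝ (DeRham n M p) :=
  F ∘ₗ cohomologyPullback p u

end Homology

end SmithMaps

end

open SmithMaps

set_option linter.unusedSectionVars false

noncomputable section

namespace SmithMaps

/-! ### Linear algebra -/

section LinearAlgebra

open Matrix

/-! The proof is a calibration argument. At a point of `L` take a positively oriented orthonormal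
basis `e` and let `G` be the Gram matrix of the vectors `du(eᵢ)`. The coefficient of `u^*α` with
respect to the volume form is `α(du e₁, …, du eₖ)`. It is at most `√(det G)` because `α` is a
calibration, and AM-GM for the eigenvalues of `G` gives `√(det G) ≤ (√k)⁻ᵏ (√(tr G))ᵏ = (√k)⁻ᵏ
|du|ᵏ`. Equality throughout forces `G` to be scalar, which is conformality of `u`; so pointwise
equality is exactly the Smith condition (`isSmithImmersion_iff`). Integration gives the energy
inequality. Both densities are continuous and the volume charges every nonempty open set, so equal
integrals force equality at every point (`formIntegral_pullback_le_energy`).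

The right-hand side is topological. Stokes' theorem (`formIntegral_mextDeriv`: partition of unity,
then integration by parts in a chart) makes integration a functional on cohomology. Homotopy
invariance (`formIntegral_pullback_eq_of_homotopic`) has to cover homotopies that are merely
continuous. By the Poincaré lemma the closed form is exact on small chart balls, so changing a
smooth map inside such a ball does not affect the integral. Finitely many changes of this kind turn
a smooth map into any sufficiently close one, and the same interpolation approximates continuous
maps by smooth ones. Hence the integral extends to a locally constant function on `C(L, M)` with the
compact-open topology, and a homotopy is a path in that space.

A Smith immersion therefore minimizes the energy in its homotopy class. All members of a smooth
family are homotopic, so the energy along the family has a minimum at `0`; as the energy is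
differentiable there (`exists_hasDerivAt_energy`, where `k ≥ 2` enters), its derivative vanishes. -/

lemma det_rpow_inv_eq_prod {k : ℕ} {A : Matrix (Fin k) (Fin k) ℝ} (hA : A.PosSemidef) :
    A.det ^ (k : ℝ)⁻¹ = ∏ i, hA.isHermitian.eigenvalues i ^ (k : ℝ)⁻¹ := by
  rw [hA.isHermitian.det_eq_prod_eigenvalues]
  exact (Real.finsetProd_rpow _ _ (fun i _ => hA.eigenvalues_nonneg i) _).symm

lemma trace_div_eq_sum {k : ℕ} {A : Matrix (Fin k) (Fin k) ℝ} (hA : A.PosSemidef) :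
    A.trace / k = ∑ i, (k : ℝ)⁻¹ * hA.isHermitian.eigenvalues i := by
  rw [hA.isHermitian.trace_eq_sum_eigenvalues, ← Finset.mul_sum, div_eq_inv_mul]
  rfl

/-- The inequality of arithmetic and geometric means for the eigenvalues of a matrix. -/
lemma det_le_trace_div_pow {k : ℕ} (hk : k ≠ 0) {A : Matrix (Fin k) (Fin k) ℝ}
    (hA : A.PosSemidef) : A.det ≤ (A.trace / k) ^ k := by
  have h := Real.geom_mean_le_arith_mean_weighted Finset.univ (fun _ : Fin k => (k : ℝ)⁻¹)
    hA.isHermitian.eigenvalues (fun _ _ => by positivity) (by simp [hk])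
    (fun i _ => hA.eigenvalues_nonneg i)
  rw [← det_rpow_inv_eq_prod hA, ← trace_div_eq_sum hA] at h
  calc A.det = (A.det ^ (k : ℝ)⁻¹) ^ k := (Real.rpow_inv_natCast_pow hA.det_nonneg hk).symm
    _ ≤ _ := pow_le_pow_left₀ (Real.rpow_nonneg hA.det_nonneg _) h k

/-- Equality in AM-GM forces every eigenvalue to be the mean `tr A / k`, and a symmetric matrix
whose diagonal form is scalar is itself scalar. -/
lemma eq_smul_one_of_det_eq_trace_div_pow {k : ℕ} (hk : k ≠ 0) {A : Matrix (Fin k) (Fin k) ℝ}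
    (hA : A.PosSemidef) (h : A.det = (A.trace / k) ^ k) :
    A = (A.trace / k) • (1 : Matrix (Fin k) (Fin k) ℝ) := by
  have ht : 0 ≤ A.trace / k := div_nonneg hA.trace_nonneg (by positivity)
  have h1 := (Real.geom_mean_eq_arith_mean_weighted_iff_of_pos' Finset.univ
    (fun _ : Fin k => (k : ℝ)⁻¹) hA.isHermitian.eigenvalues (fun _ _ => by positivity)
    (by simp [hk]) (fun i _ => hA.eigenvalues_nonneg i)).1 (by
      rw [← det_rpow_inv_eq_prod hA, ← trace_div_eq_sum hA, h, Real.pow_rpow_inv_natCast ht hk])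
  rw [← trace_div_eq_sum hA] at h1
  have h2 : diagonal (RCLike.ofReal ∘ hA.isHermitian.eigenvalues : Fin k → ℝ)
      = (A.trace / k) • (1 : Matrix (Fin k) (Fin k) ℝ) := by
    rw [smul_one_eq_diagonal]
    congr 1
    funext i
    exact h1 i (Finset.mem_univ i)
  have h3 := hA.isHermitian.spectral_theorem
  rw [h2, map_smul, map_one] at h3
  exact h3

/-- For the Gram matrix of the vectors `du(eᵢ)` the trace is `|du|²`, so this bounds the volume they
span by the energy density. -/
lemma sqrt_det_le {k : ℕ} (hk : k ≠ 0) {A : Matrix (Fin k) (Fin k) ℝ} (hA : A.PosSemidef) :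
    √A.det ≤ 1 / (√(k : ℝ)) ^ k * (√A.trace) ^ k := by
  have ht : 0 ≤ A.trace / k := div_nonneg hA.trace_nonneg (by positivity)
  have h1 : 1 / (√(k : ℝ)) ^ k * (√A.trace) ^ k = √((A.trace / k) ^ k) := by
    have h2 : (A.trace / k) ^ k = ((√(A.trace / k)) ^ k) ^ 2 := by
      rw [← pow_mul, mul_comm k 2, pow_mul, Real.sq_sqrt ht]
    rw [h2, Real.sqrt_sq (by positivity), Real.sqrt_div' _ (by positivity), div_pow]
    ring
  rw [h1]
  exact Real.sqrt_le_sqrt (det_le_trace_div_pow hk hA)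

/-- Source of conformality: a scalar Gram matrix of `du(eᵢ)` says that `u^*h` is a multiple of `g`.
-/
lemma eq_smul_one_of_sqrt_det_eq {k : ℕ} (hk : k ≠ 0) {A : Matrix (Fin k) (Fin k) ℝ}
    (hA : A.PosSemidef) (h : √A.det = 1 / (√(k : ℝ)) ^ k * (√A.trace) ^ k) :
    A = (1 / (k : ℝ) * A.trace) • (1 : Matrix (Fin k) (Fin k) ℝ) := by
  have h2 : A.det = (A.trace / k) ^ k := by
    rw [← Real.sq_sqrt hA.det_nonneg, h, mul_pow, ← pow_mul, mul_comm k 2, pow_mul,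
      Real.sq_sqrt hA.trace_nonneg, div_pow, one_pow, ← pow_mul, mul_comm k 2, pow_mul,
      Real.sq_sqrt (by positivity), div_pow]
    ring
  rw [one_div_mul_eq_div]
  exact eq_smul_one_of_det_eq_trace_div_pow hk hA h2

variable {V : Type*} [NormedAddCommGroup V] [InnerProductSpace ℝ V] {k : ℕ}

lemma gram_eq_transpose_mul_toMatrix (b : OrthonormalBasis (Fin k) ℝ V) (v : Fin k → V) :
    gram ℝ v = (b.toBasis.toMatrix v)ᵀ * b.toBasis.toMatrix v := by
  have h := gram_eq_conjTranspose_mul b v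
  rw [h, conjTranspose_eq_transpose_of_trivial]
  rfl

/-- Up to sign the volume form is the determinant `det P` in an orthonormal basis, and the Gram
matrix is `Pᵀ P`. Squaring removes the dependence on the orientation. -/
lemma sq_volumeForm_eq_det_gram [Fact (Module.finrank ℝ V = k)] (o : Orientation ℝ V (Fin k))
    (b : OrthonormalBasis (Fin k) ℝ V) (v : Fin k → V) :
    o.volumeForm v ^ 2 = (gram ℝ v).det := by
  rw [← sq_abs, o.volumeForm_robust' b, sq_abs, gram_eq_transpose_mul_toMatrix b, det_mul,
    det_transpose, Module.Basis.det_apply, sq]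

/-- The trace of a bilinear form with respect to the inner product, in an arbitrary basis. -/
lemma trace_inv_gram_mul (e : OrthonormalBasis (Fin k) ℝ V) (b : Fin k → V)
    (hb : LinearIndependent ℝ b) (B : LinearMap.BilinForm ℝ V) :
    ((gram ℝ b)⁻¹ * of fun i j => B (b i) (b j)).trace = ∑ i, B (e i) (e i) := by
  set P := e.toBasis.toMatrix b with hP
  have hG : gram ℝ b = Pᵀ * P := gram_eq_transpose_mul_toMatrix e b
  have hdet : IsUnit P.det := by
    have h := det_gram_ne_zero_iff_linearIndependent.2 hb
    rw [hG, det_mul, det_transpose] at h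
    exact isUnit_iff_ne_zero.2 fun h0 => h (by rw [h0, zero_mul])
  have hH : (of fun i j => B (b i) (b j)) = Pᵀ * (of fun i j => B (e i) (e j)) * P := by
    have hbe : ∀ i, b i = ∑ j, P j i • e j := fun i => by
      have := e.toBasis.sum_toMatrix_smul_self b i
      simpa using this.symm
    ext i j
    simp only [of_apply, mul_apply, transpose_apply]
    conv_lhs => rw [hbe i, hbe j]
    simp only [map_sum, map_smul, LinearMap.sum_apply, LinearMap.smul_apply, smul_eq_mul,
      Finset.sum_mul, Finset.mul_sum]
    refine Finset.sum_congr rfl fun x _ => Finset.sum_congr rfl fun y _ => ?_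
    ring
  have hPt : IsUnit Pᵀ.det := by rwa [det_transpose]
  rw [hG, hH, Matrix.mul_inv_rev, Matrix.mul_assoc, Matrix.mul_assoc Pᵀ,
    nonsing_inv_mul_cancel_left _ _ hPt, trace_mul_comm, Matrix.mul_assoc, mul_nonsing_inv _ hdet, Matrix.mul_one]
  rfl

end LinearAlgebra

/-! ### Differential forms on vector spaces: Stokes' theorem and the Poincaré lemma -/

section Flat

open MeasureTheory ContinuousAlternatingMap

/-- Stokes' theorem for compactly supported forms on a vector space. -/
lemma integral_extDeriv_eq_zero {E : Type*} [NormedAddCommGroup E] [NormedSpace ℝ E]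
    [FiniteDimensional ℝ E] [MeasurableSpace E] [BorelSpace E] (μ : Measure E)
    [μ.IsAddHaarMeasure] {p : ℕ} {η : E → E [⋀^Fin p]→L[ℝ] ℝ}
    (hη : ContDiff ℝ 1 η) (hc : HasCompactSupport η) (v : Fin (p + 1) → E) :
    ∫ y, extDeriv η y v ∂μ = 0 := by
  have hd : Differentiable ℝ η := hη.differentiable (by simp)
  have hc' : ∀ w : Fin p → E, ContDiff ℝ 1 fun y => η y w := fun w =>
    ((ContinuousAlternatingMap.apply ℝ E ℝ w).contDiff.comp hη)
  have hcs : ∀ w : Fin p → E, HasCompactSupport fun y => η y w := fun w =>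
    hc.comp_left (g := fun f : E [⋀^Fin p]→L[ℝ] ℝ => f w) rfl
  have hi : ∀ (w : Fin p → E) (u : E), Integrable (fun y => fderiv ℝ (fun z => η z w) y u) μ := by
    intro w u
    refine Continuous.integrable_of_hasCompactSupport ?_ ((hcs w).fderiv_apply ℝ u)
    exact ((hc' w).continuous_fderiv (by simp)).clm_apply continuous_const
  have h0 : ∀ (w : Fin p → E) (u : E), ∫ y, fderiv ℝ (fun z => η z w) y u ∂μ = 0 := by
    intro w u
    -- Integration by parts against the constant function `1`, whose derivative is zero.
    have := integral_bilinear_hasFDerivAt_right_eq_neg_left_of_integrable (μ := μ)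
      (f := fun _ : E => (1 : ℝ)) (f' := fun _ => 0) (g := fun z => η z w)
      (g' := fderiv ℝ fun z => η z w) (v := u) (B := ContinuousLinearMap.mul ℝ ℝ)
      (by simp) (by simpa using hi w u)
      (by simpa using (hc' w).continuous.integrable_of_hasCompactSupport (hcs w))
      (fun x _ => hasFDerivAt_const _ _)
      (fun x _ => ((hc' w).differentiable (by simp) x).hasFDerivAt)
    simpa using this
  simp only [extDeriv_apply (hd _), zsmul_eq_mul]
  rw [integral_finsetSum _ fun i _ => (hi _ _).const_mul _]
  simp only [integral_const_mul, h0, mul_zero, Finset.sum_const_zero]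

/-- Differentiation of a parametric integral over `[0, 1]`. -/
lemma contDiff_intervalIntegral {E G : Type*} [NormedAddCommGroup E] [NormedSpace ℝ E]
    [FiniteDimensional ℝ E] [NormedAddCommGroup G] [NormedSpace ℝ G]
    {F : E → ℝ → G} {F' : E → ℝ → E →L[ℝ] G} (hF : Continuous F.uncurry)
    (hF' : Continuous F'.uncurry) (h : ∀ x t, HasFDerivAt (fun y => F y t) (F' x t) x) :
    (∀ x, HasFDerivAt (fun y => ∫ t in (0 : ℝ)..1, F y t) (∫ t in (0 : ℝ)..1, F' x t) x) ∧
      ContDiff ℝ 1 fun y => ∫ t in (0 : ℝ)..1, F y t := by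
  have key : ∀ x, HasFDerivAt (fun y => ∫ t in (0 : ℝ)..1, F y t)
      (∫ t in (0 : ℝ)..1, F' x t) x := by
    intro x
    have hK : IsCompact (Metric.closedBall x 1 ×ˢ Set.Icc (0 : ℝ) 1) :=
      (isCompact_closedBall x 1).prod isCompact_Icc
    obtain ⟨C, hC⟩ := hK.exists_bound_of_continuousOn hF'.continuousOn
    have hFx : ∀ y, Continuous (F y) := fun y => hF.comp (Continuous.prodMk_right y)
    have hFx' : ∀ y, Continuous (F' y) := fun y => hF'.comp (Continuous.prodMk_right y)
    refine intervalIntegral.hasFDerivAt_integral_of_dominated_of_fderiv_le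
      (bound := fun _ => C) (Metric.closedBall_mem_nhds x one_pos)
      (Filter.Eventually.of_forall fun y => (hFx y).aestronglyMeasurable)
      ((hFx x).intervalIntegrable _ _) (hFx' x).aestronglyMeasurable ?_
      (by simp) (Filter.Eventually.of_forall fun t _ y _ => h y t)
    refine Filter.Eventually.of_forall fun t ht y hy => ?_
    rw [Set.uIoc_of_le zero_le_one] at ht
    exact hC (y, t) ⟨hy, ht.1.le, ht.2⟩
  refine ⟨key, contDiff_one_iff_fderiv.2 ⟨fun x => (key x).differentiableAt, ?_⟩⟩
  have : (fderiv ℝ fun y => ∫ t in (0 : ℝ)..1, F y t) = fun x => ∫ t in (0 : ℝ)..1, F' x t :=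
    funext fun x => (key x).fderiv
  rw [this]
  exact intervalIntegral.continuous_parametric_intervalIntegral_of_continuous' hF' 0 1

/-- The fundamental theorem of calculus for the image of an integral under a linear map. -/
lemma clm_intervalIntegral_eq_sub {G W : Type*} [NormedAddCommGroup G] [NormedSpace ℝ G]
    [CompleteSpace G] [NormedAddCommGroup W] [NormedSpace ℝ W] [CompleteSpace W] (Φ : G →L[ℝ] W)
    {F : ℝ → G} (hF : Continuous F) {f : ℝ → W}
    (h : ∀ t ∈ Set.uIcc (0 : ℝ) 1, HasDerivAt f (Φ (F t)) t) :
    Φ (∫ t in (0 : ℝ)..1, F t) = f 1 - f 0 := by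
  rw [← Φ.intervalIntegral_comp_comm (hF.intervalIntegrable _ _)]
  exact intervalIntegral.integral_eq_sub_of_hasDerivAt h
    ((Φ.continuous.comp hF).intervalIntegrable _ _)

variable {E : Type*} [NormedAddCommGroup E] [NormedSpace ℝ E]

/-- Cartan's formula with a frozen vector `x`: for `A = Dβ` with `dβ = 0` it reads `d(ι_x β) = D_x
β`. Evaluate the vanishing alternation of `A` on `(x, v)`: the term of index `0` is `A x v`, and the
others, each with one additional sign, are minus the alternation of `ι_x A`. -/
lemma alternatizeUncurryFin_flip_curryLeft {p : ℕ} (A : E →L[ℝ] E [⋀^Fin (p + 1)]→L[ℝ] ℝ)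
    (hA : alternatizeUncurryFin A = 0) (x : E) (B : E →L[ℝ] E [⋀^Fin p]→L[ℝ] ℝ)
    (hB : ∀ u, B u = (A u).curryLeft x) : alternatizeUncurryFin B = A x := by
  ext v
  have h := congrArg (fun f : E [⋀^Fin (p + 2)]→L[ℝ] ℝ => f (Matrix.vecCons x v)) hA
  simp only [alternatizeUncurryFin_apply, ContinuousAlternatingMap.coe_zero, Pi.zero_apply] at h
  rw [Fin.sum_univ_succ] at h
  simp only [Fin.val_zero, pow_zero, one_smul, Matrix.cons_val_zero, Fin.val_succ,
    Matrix.cons_val_succ] at h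
  have h1 : (0 : Fin (p + 2)).removeNth (Matrix.vecCons x v) = v := by
    ext i; simp [Fin.removeNth]
  have h2 : ∀ i : Fin (p + 1), (i.succ).removeNth (Matrix.vecCons x v)
      = Matrix.vecCons x (i.removeNth v) := by
    intro i
    funext j
    refine Fin.cases ?_ (fun j => ?_) j
    · simp [Fin.removeNth]
    · simp [Fin.removeNth]
  simp only [h1, h2] at h
  rw [alternatizeUncurryFin_apply]
  simp only [hB, curryLeft_apply_apply]
  have h3 : ∑ i : Fin (p + 1), (-1 : ℤ) ^ ((i : ℕ) + 1) • (A (v i)) (Matrix.vecCons x (i.removeNth v))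
      = - ∑ i : Fin (p + 1), (-1 : ℤ) ^ (i : ℕ) • (A (v i)) (Matrix.vecCons x (i.removeNth v)) := by
    rw [← Finset.sum_neg_distrib]
    refine Finset.sum_congr rfl fun i _ => ?_
    rw [pow_succ]; simp
  rw [h3] at h
  linarith

/-- The derivative of the integrand of the homotopy operator. -/
lemma coneIntegrand_calculus {H G : Type*} [NormedAddCommGroup H] [NormedSpace ℝ H]
    [NormedAddCommGroup G] [NormedSpace ℝ G] (C : H →L[ℝ] E →L[ℝ] G) {β : E → H}
    (hβ : ContDiff ℝ 1 β) (p : ℕ) :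
    Continuous (Function.uncurry fun (x : E) (t : ℝ) => t ^ p • C (β (t • x)) x) ∧
    Continuous (Function.uncurry fun (x : E) (t : ℝ) =>
      t ^ p • (C (β (t • x)) + (C.flip x).comp (t • fderiv ℝ β (t • x)))) ∧
    (∀ (x : E) (t : ℝ), HasFDerivAt (fun y => t ^ p • C (β (t • y)) y)
      (t ^ p • (C (β (t • x)) + (C.flip x).comp (t • fderiv ℝ β (t • x)))) x) ∧
    ∀ (x : E) (t : ℝ), HasDerivAt (fun t : ℝ => t ^ (p + 1) • β (t • x))
      (t ^ p • ((p + 1) • β (t • x) + t • fderiv ℝ β (t • x) x)) t := by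
  have hd : Differentiable ℝ β := hβ.differentiable (by simp)
  have hc : Continuous β := hβ.continuous
  have hc' : Continuous (fderiv ℝ β) := hβ.continuous_fderiv (by simp)
  refine ⟨?_, ?_, fun x t => ?_, fun x t => ?_⟩
  · dsimp only [Function.uncurry_def]
    fun_prop
  · dsimp only [Function.uncurry_def]
    fun_prop
  · have h1 : HasFDerivAt (fun y : E => β (t • y)) (t • fderiv ℝ β (t • x)) x := by
      have := (hd (t • x)).hasFDerivAt.comp x ((hasFDerivAt_id x).const_smul t)
      convert! this using 1
      ext; simp
    have h1' : HasFDerivAt (fun y : E => C (β (t • y))) (C.comp (t • fderiv ℝ β (t • x))) x :=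
      C.hasFDerivAt.comp x h1
    have h2 := (h1'.clm_apply (hasFDerivAt_id x)).const_smul (t ^ p)
    refine h2.congr_fderiv ?_
    ext u
    simp
  · have h1 : HasDerivAt (fun t : ℝ => β (t • x)) (fderiv ℝ β (t • x) x) t := by
      have h := (hd (t • x)).hasFDerivAt.comp_hasDerivAt t ((hasDerivAt_id t).smul_const x)
      simpa [Function.comp_def] using h
    refine ((hasDerivAt_pow (p + 1) t).smul h1).congr_deriv ?_
    rw [add_tsub_cancel_right, smul_add, smul_smul, add_comm, ← pow_succ,
      ← Nat.cast_smul_eq_nsmul ℝ, smul_smul, mul_comm]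

/-- The Poincaré lemma for balls centered at the origin. -/
lemma exists_primitive_ball_zero [FiniteDimensional ℝ E] {p : ℕ}
    {β : E → E [⋀^Fin (p + 1)]→L[ℝ] ℝ} (hβ : ContDiff ℝ 1 β) {r : ℝ}
    (hcl : ∀ x ∈ Metric.ball (0 : E) r, extDeriv β x = 0) :
    ∃ γ : E → E [⋀^Fin p]→L[ℝ] ℝ, ContDiff ℝ 1 γ ∧
      ∀ x ∈ Metric.ball (0 : E) r, extDeriv γ x = β x := by
  let C : E [⋀^Fin (p + 1)]→L[ℝ] ℝ →L[ℝ] E →L[ℝ] E [⋀^Fin p]→L[ℝ] ℝ :=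
    (curryLeftLI (𝕜 := ℝ) (E := E) (F := ℝ) (n := p)).toContinuousLinearMap
  have hCa : ∀ f, C f = curryLeft f := fun f => rfl
  -- The primitive is the cone operator `γ(x) = ∫₀¹ tᵖ ι_x β(tx) dt`; `C` is the contraction.
  obtain ⟨hF, hF', hFd, hFt⟩ := coneIntegrand_calculus C hβ p
  set F' : E → ℝ → E →L[ℝ] E [⋀^Fin p]→L[ℝ] ℝ := fun x t =>
    t ^ p • (C (β (t • x)) + (C.flip x).comp (t • fderiv ℝ β (t • x))) with hF'def
  have hdβ : Differentiable ℝ β := hβ.differentiable (by simp)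
  obtain ⟨hγ, hγ1⟩ := contDiff_intervalIntegral hF hF' hFd
  refine ⟨_, hγ1, fun x hx => ?_⟩
  have hF'x : Continuous (F' x) := hF'.comp (Continuous.prodMk_right x)
  rw [extDeriv, (hγ x).fderiv, ← alternatizeUncurryFinCLM_apply (𝕜 := ℝ)]
  -- The alternation of the integrand of `Dγ(x)` is `d/dt (tᵖ⁺¹ β(tx))`. The factor `p + 1` comes
  -- from alternating `w ↦ ι_w β`, the other summand from closedness at `tx`, which stays in the
  -- ball. Integration leaves `β(x)`, since `tᵖ⁺¹` vanishes at `0`.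
  have hderiv : ∀ t ∈ Set.uIcc (0 : ℝ) 1, HasDerivAt (fun t : ℝ => t ^ (p + 1) • β (t • x))
      (alternatizeUncurryFinCLM ℝ E ℝ (F' x t)) t := by
    intro t ht
    rw [Set.uIcc_of_le zero_le_one] at ht
    have htx : t • x ∈ Metric.ball (0 : E) r := by
      rw [mem_ball_zero_iff, norm_smul, Real.norm_of_nonneg ht.1] at *
      exact (mul_le_of_le_one_left (norm_nonneg _) ht.2).trans_lt hx
    have h3 : alternatizeUncurryFin ((C.flip x).comp (t • fderiv ℝ β (t • x)))
        = t • fderiv ℝ β (t • x) x := by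
      have h0 : alternatizeUncurryFin (t • fderiv ℝ β (t • x)) = 0 := by
        rw [alternatizeUncurryFin_smul]
        have := hcl _ htx
        rw [extDeriv] at this
        rw [this, smul_zero]
      rw [alternatizeUncurryFin_flip_curryLeft _ h0 x _ fun u => rfl]
      rfl
    have h4 : alternatizeUncurryFinCLM ℝ E ℝ (F' x t)
        = t ^ p • ((p + 1) • β (t • x) + t • fderiv ℝ β (t • x) x) := by
      simp only [F', map_smul, map_add, alternatizeUncurryFinCLM_apply, h3, hCa,
        alternatizeUncurryFin_curryLeft]
    rw [h4]
    exact hFt x t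
  refine (clm_intervalIntegral_eq_sub (F := F' x) (f := fun t : ℝ => t ^ (p + 1) • β (t • x))
    (alternatizeUncurryFinCLM ℝ E ℝ) hF'x hderiv).trans ?_
  simp

/-- The Poincaré lemma: a form that is closed near a point has a primitive near this point. -/
lemma exists_local_primitive [FiniteDimensional ℝ E] {p : ℕ}
    {β : E → E [⋀^Fin (p + 1)]→L[ℝ] ℝ} {s : Set E} (hs : IsOpen s) (hβ : ContDiffOn ℝ ∞ β s)
    (hcl : ∀ x ∈ s, extDeriv β x = 0) {z : E} (hz : z ∈ s) :
    ∃ r > 0, Metric.ball z r ⊆ s ∧ ∃ γ : E → E [⋀^Fin p]→L[ℝ] ℝ, ContDiff ℝ 1 γ ∧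
      ∀ x ∈ Metric.ball z r, extDeriv γ x = β x := by
  obtain ⟨χ, hχs⟩ : ∃ χ : ContDiffBump z, tsupport χ ⊆ s := by
    obtain ⟨R, hR, hRs⟩ := Metric.nhds_basis_closedBall.mem_iff.1 (hs.mem_nhds hz)
    exact ⟨⟨R / 2, R, by linarith, by linarith⟩, by rwa [ContDiffBump.tsupport_eq]⟩
  have hball : Metric.ball z χ.rIn ⊆ s := fun y hy => hχs (subset_tsupport _ (by
    rw [χ.support_eq]; exact Metric.ball_subset_ball χ.rIn_lt_rOut.le hy))
  -- Cut off and translated to the origin, the form becomes `C¹` on the whole space; it agrees with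
  -- `β` on the inner ball, where the bump is `1`.
  let β' : E → E [⋀^Fin (p + 1)]→L[ℝ] ℝ := fun y => χ (y + z) • β (y + z)
  have hprod : ContDiff ℝ 1 fun y => χ y • β y := by
    rw [contDiff_iff_contDiffAt]
    intro y
    by_cases hy : y ∈ s
    · exact χ.contDiff.contDiffAt.smul
        (((hβ.contDiffAt (hs.mem_nhds hy))).of_le (by exact_mod_cast le_top))
    · have : (fun y => χ y • β y) =ᶠ[𝓝 y] fun _ => 0 := by
        have hy' : y ∉ tsupport χ := fun h => hy (hχs h)
        filter_upwards [notMem_tsupport_iff_eventuallyEq.1 hy'] with w hw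
        simp [hw]
      exact contDiffAt_const.congr_of_eventuallyEq this
  have hβ' : ContDiff ℝ 1 β' := hprod.comp (contDiff_id.add contDiff_const)
  have htr : ∀ (f : E → E [⋀^Fin p]→L[ℝ] ℝ) (c x : E),
      extDeriv (fun y => f (y + c)) x = extDeriv f (x + c) := fun f c x => by
    rw [extDeriv, extDeriv, fderiv_comp_add_right]
  have hcl' : ∀ x ∈ Metric.ball (0 : E) χ.rIn, extDeriv β' x = 0 := by
    intro x hx
    have hx' : x + z ∈ Metric.ball z χ.rIn := by simpa using hx
    have : β' =ᶠ[𝓝 x] fun y => β (y + z) := by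
      filter_upwards [Metric.isOpen_ball.mem_nhds hx] with y hy
      have : y + z ∈ Metric.closedBall z χ.rIn := by simpa using (mem_ball_zero_iff.1 hy).le
      simp [β', χ.one_of_mem_closedBall this]
    rw [this.extDeriv_eq, extDeriv, fderiv_comp_add_right]
    exact hcl _ (hball hx')
  obtain ⟨γ, hγ, hγβ⟩ := exists_primitive_ball_zero hβ' hcl'
  refine ⟨χ.rIn, χ.rIn_pos, hball, fun y => γ (y + -z), hγ.comp (contDiff_id.add contDiff_const),
    fun x hx => ?_⟩
  rw [htr, hγβ _ (by simpa [← sub_eq_add_neg, ← dist_eq_norm] using hx)]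
  simp [β', χ.one_of_mem_closedBall (Metric.ball_subset_closedBall hx)]

end Flat

/-! ### The Riemannian metric in coordinates -/

section Metric

variable {k n : ℕ}
  {L : Type*} [TopologicalSpace L] [ChartedSpace (EuclideanSpace ℝ (Fin k)) L]
  [IsManifold (𝓡 k) ∞ L]
  {M : Type*} [TopologicalSpace M] [ChartedSpace (EuclideanSpace ℝ (Fin n)) M]
  [IsManifold (𝓡 n) ∞ M]
  [RiemannianBundle (fun x : M => TangentSpace (𝓡 n) x)]
  [IsContMDiffRiemannianBundle (𝓡 n) ∞ (EuclideanSpace ℝ (Fin n))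
      (fun x : M => TangentSpace (𝓡 n) x)]

/-- The tangent map of `W`, applied to a constant vector field, is a smooth section along `W`, and
the metric is smooth on such sections. This serves both the metric of `L` in a chart and the
pullback of the metric of `M` by a family. -/
lemma contDiffOn_inner_mfderiv {D : Type*} [NormedAddCommGroup D] [NormedSpace ℝ D]
    {W : D → M} {s : Set D} (hs : IsOpen s) (hW : ContMDiffOn 𝓘(ℝ, D) (𝓡 n) ∞ W s) (v w : D) :
    ContDiffOn ℝ ∞ (fun y => inner ℝ (mfderiv 𝓘(ℝ, D) (𝓡 n) W y v)
      (mfderiv 𝓘(ℝ, D) (𝓡 n) W y w)) s := by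
  have hsec : ∀ v : D, ContMDiffOn 𝓘(ℝ, D) ((𝓡 n).prod 𝓘(ℝ, EuclideanSpace ℝ (Fin n))) ∞
      (fun y => (⟨W y, mfderiv 𝓘(ℝ, D) (𝓡 n) W y v⟩ : TotalSpace (EuclideanSpace ℝ (Fin n))
        (fun x : M => TangentSpace (𝓡 n) x))) s := by
    intro v
    have h1 : ContMDiffOn 𝓘(ℝ, D).tangent (𝓡 n).tangent ∞ (tangentMapWithin 𝓘(ℝ, D) (𝓡 n) W s)
        (TotalSpace.proj ⁻¹' s) :=
      hW.contMDiffOn_tangentMapWithin (by simp) hs.uniqueMDiffOn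
    have h2 : ContMDiff 𝓘(ℝ, D) 𝓘(ℝ, D).tangent ∞
        (fun y : D => (⟨y, v⟩ : TangentBundle 𝓘(ℝ, D) D)) := by
      intro y
      rw [contMDiffAt_totalSpace]
      refine ⟨contMDiffAt_id, ?_⟩
      simp only [trivializationAt_model_space_apply]
      exact contMDiffAt_const
    have h3 := h1.comp h2.contMDiffOn (s := s) (fun y hy => hy)
    refine h3.congr fun y hy => ?_
    simp only [Function.comp_apply, tangentMapWithin, mfderivWithin_of_isOpen hs hy]
  exact contMDiffOn_iff_contDiffOn.1 ((hsec v).inner_bundle (hsec w))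

/-- The pullback of the Riemannian metric by a map defined on a vector space. -/
def metricPull {D : Type*} [NormedAddCommGroup D] [NormedSpace ℝ D] (W : D → M) (y v w : D) : ℝ :=
  inner ℝ (mfderiv 𝓘(ℝ, D) (𝓡 n) W y v) (mfderiv 𝓘(ℝ, D) (𝓡 n) W y w)

/-- Inner products in different fibres can be compared because all tangent spaces are the same model
space; only the base point selects the metric. -/
lemma inner_congr {z z' : M} (hz : z = z') {v v' w w' : EuclideanSpace ℝ (Fin n)} (hv : v = v')
    (hw : w = w') : @inner ℝ (TangentSpace (𝓡 n) z) _ v w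
      = @inner ℝ (TangentSpace (𝓡 n) z') _ v' w' := by
  subst hz hv hw; rfl

lemma metricPull_congr {D : Type*} [NormedAddCommGroup D] [NormedSpace ℝ D] {W W' : D → M} {y : D}
    (h : W =ᶠ[𝓝 y] W') (v w : D) : metricPull (n := n) W y v w = metricPull (n := n) W' y v w :=
  inner_congr h.eq_of_nhds
    (congrArg (fun A : D →L[ℝ] EuclideanSpace ℝ (Fin n) => A v) h.mfderiv_eq)
    (congrArg (fun A : D →L[ℝ] EuclideanSpace ℝ (Fin n) => A w) h.mfderiv_eq)

lemma metricPull_comp {D D' : Type*} [NormedAddCommGroup D] [NormedSpace ℝ D]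
    [NormedAddCommGroup D'] [NormedSpace ℝ D'] {W : D → M} {τ : D' → D} {y : D'}
    (hW : MDifferentiableAt 𝓘(ℝ, D) (𝓡 n) W (τ y)) (hτ : DifferentiableAt ℝ τ y) (v w : D') :
    metricPull (n := n) (W ∘ τ) y v w
      = metricPull (n := n) W (τ y) (fderiv ℝ τ y v) (fderiv ℝ τ y w) := by
  have h := mfderiv_comp y hW hτ.mdifferentiableAt
  rw [mfderiv_eq_fderiv] at h
  exact inner_congr rfl (congrArg (fun A : D' →L[ℝ] EuclideanSpace ℝ (Fin n) => A v) h)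
    (congrArg (fun A : D' →L[ℝ] EuclideanSpace ℝ (Fin n) => A w) h)

lemma mdifferentiableAt_extChartAt_symm (x₀ : L) {y : EuclideanSpace ℝ (Fin k)}
    (hy : y ∈ (extChartAt (𝓡 k) x₀).target) :
    MDifferentiableAt (𝓡 k) (𝓡 k) (extChartAt (𝓡 k) x₀).symm y :=
  ((contMDiffOn_extChartAt_symm (I := 𝓡 k) (n := ∞) x₀).contMDiffAt
    ((isOpen_extChartAt_target x₀).mem_nhds hy)).mdifferentiableAt (by simp)

lemma mfderiv_extChartAt_coordFrame (x₀ : L) {y : EuclideanSpace ℝ (Fin k)}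
    (hy : y ∈ (extChartAt (𝓡 k) x₀).target) (i : Fin k) :
    mfderiv (𝓡 k) (𝓡 k) (extChartAt (𝓡 k) x₀) ((extChartAt (𝓡 k) x₀).symm y)
      (coordFrame x₀ y i) = EuclideanSpace.single i (1 : ℝ) := by
  have : IsManifold (𝓡 k) 1 L := IsManifold.of_le (n := ∞) (by simp)
  have h := mfderiv_extChartAt_comp_mfderivWithin_extChartAt_symm (I := 𝓡 k) hy
  rw [ModelWithCorners.range_eq_univ, mfderivWithin_univ] at h
  exact congrArg (fun A : EuclideanSpace ℝ (Fin k) →L[ℝ] EuclideanSpace ℝ (Fin k) =>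
    A (EuclideanSpace.single i (1 : ℝ))) h

lemma linearIndependent_coordFrame (x₀ : L) {y : EuclideanSpace ℝ (Fin k)}
    (hy : y ∈ (extChartAt (𝓡 k) x₀).target) : LinearIndependent ℝ (coordFrame x₀ y) := by
  refine LinearIndependent.of_comp (mfderiv (𝓡 k) (𝓡 k) (extChartAt (𝓡 k) x₀)
    ((extChartAt (𝓡 k) x₀).symm y)).toLinearMap ?_
  have h := (EuclideanSpace.basisFun (Fin k) ℝ).toBasis.linearIndependent
  convert! h using 1
  funext i
  simp only [OrthonormalBasis.coe_toBasis, EuclideanSpace.basisFun_apply]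
  exact mfderiv_extChartAt_coordFrame x₀ hy i

/-! ### Smoothness of the metric and of `|du|²` in coordinates, jointly with a parameter. -/

section Domain

variable [RiemannianBundle (fun x : L => TangentSpace (𝓡 k) x)]
  [IsContMDiffRiemannianBundle (𝓡 k) ∞ (EuclideanSpace ℝ (Fin k))
      (fun x : L => TangentSpace (𝓡 k) x)]

lemma det_gram_coordFrame_pos (x₀ : L) {y : EuclideanSpace ℝ (Fin k)}
    (hy : y ∈ (extChartAt (𝓡 k) x₀).target) : 0 < (Matrix.gram ℝ (coordFrame x₀ y)).det :=
  Matrix.PosDef.det_pos (Matrix.posDef_gram_of_linearIndependent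
    (E := TangentSpace (𝓡 k) ((extChartAt (𝓡 k) x₀).symm y)) (linearIndependent_coordFrame x₀ hy))

lemma contDiffOn_gram_coordFrame (x₀ : L) (i j : Fin k) :
    ContDiffOn ℝ ∞ (fun y => Matrix.gram ℝ (coordFrame x₀ y) i j)
      (extChartAt (𝓡 k) x₀).target :=
  contDiffOn_inner_mfderiv (isOpen_extChartAt_target x₀)
    (contMDiffOn_extChartAt_symm (I := 𝓡 k) (n := ∞) x₀) _ _

lemma contDiffOn_det {D : Type*} [NormedAddCommGroup D] [NormedSpace ℝ D] {s : Set D}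
    {A : D → Matrix (Fin k) (Fin k) ℝ} (hA : ∀ i j, ContDiffOn ℝ ∞ (fun y => A y i j) s) :
    ContDiffOn ℝ ∞ (fun y => (A y).det) s := by
  simp only [Matrix.det_apply]
  refine ContDiffOn.sum fun σ _ => ContDiffOn.const_smul _ ?_
  exact contDiffOn_prod fun i _ => hA _ _

/-- Cramer's rule: an entry of the adjugate is the determinant of the matrix with one row replaced
by a constant row. -/
lemma contDiffOn_inv {D : Type*} [NormedAddCommGroup D] [NormedSpace ℝ D] {s : Set D}
    {A : D → Matrix (Fin k) (Fin k) ℝ} (hA : ∀ i j, ContDiffOn ℝ ∞ (fun y => A y i j) s)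
    (h0 : ∀ y ∈ s, (A y).det ≠ 0) (i j : Fin k) :
    ContDiffOn ℝ ∞ (fun y => (A y)⁻¹ i j) s := by
  simp only [Matrix.inv_def, Matrix.smul_apply, Ring.inverse_eq_inv', smul_eq_mul,
    Matrix.adjugate_apply]
  refine ((contDiffOn_det hA).inv h0).mul (contDiffOn_det fun a b => ?_)
  by_cases h : a = j
  · subst h
    simp only [Matrix.updateRow_self]
    exact contDiffOn_const
  · simp only [Matrix.updateRow_ne h]
    exact hA a b

lemma contDiffOn_det_gram_coordFrame (x₀ : L) :
    ContDiffOn ℝ ∞ (fun y => (Matrix.gram ℝ (coordFrame x₀ y)).det)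
      (extChartAt (𝓡 k) x₀).target :=
  contDiffOn_det (contDiffOn_gram_coordFrame x₀)

/-- `|du|²` in terms of a coordinate frame. -/
lemma sq_normDu_eq_trace (u : L → M) (x₀ : L) {y : EuclideanSpace ℝ (Fin k)}
    (hy : y ∈ (extChartAt (𝓡 k) x₀).target) :
    normDu (k := k) (n := n) u ((extChartAt (𝓡 k) x₀).symm y) ^ 2
      = ((Matrix.gram ℝ (coordFrame x₀ y))⁻¹ * Matrix.of fun i j =>
        inner ℝ (mfderiv (𝓡 k) (𝓡 n) u _ (coordFrame x₀ y i))
          (mfderiv (𝓡 k) (𝓡 n) u _ (coordFrame x₀ y j))).trace := by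
  set x := (extChartAt (𝓡 k) x₀).symm y
  have hf : Module.finrank ℝ (TangentSpace (𝓡 k) x) = k := Fact.out
  let B : LinearMap.BilinForm ℝ (TangentSpace (𝓡 k) x) :=
    LinearMap.BilinForm.comp (innerₗ (TangentSpace (𝓡 n) (u x)))
      (mfderiv (𝓡 k) (𝓡 n) u x).toLinearMap (mfderiv (𝓡 k) (𝓡 n) u x).toLinearMap
  let e := (stdOrthonormalBasis ℝ (TangentSpace (𝓡 k) x)).reindex (finCongr hf)
  have h := trace_inv_gram_mul e (coordFrame x₀ y) (linearIndependent_coordFrame x₀ hy) B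
  rw [normDu, Real.sq_sqrt (by positivity)]
  refine Eq.trans ?_ h.symm
  refine Fintype.sum_equiv (finCongr hf) _ _ fun i => ?_
  simp only [e, B, OrthonormalBasis.reindex_apply, LinearMap.BilinForm.comp_apply]
  exact (real_inner_self_eq_norm_sq _).symm

/-- The coordinate expression of the function `(s, x) ↦ |d(U s)|² (x)`. -/
def energyCoord (U : ℝ → L → M) (x₀ : L) (q : ℝ × EuclideanSpace ℝ (Fin k)) : ℝ :=
  ((Matrix.gram ℝ (coordFrame x₀ q.2))⁻¹ * Matrix.of fun i j =>
    metricPull (n := n) (fun p : ℝ × EuclideanSpace ℝ (Fin k) =>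
        U p.1 ((extChartAt (𝓡 k) x₀).symm p.2)) q
      (0, EuclideanSpace.single i (1 : ℝ)) (0, EuclideanSpace.single j (1 : ℝ))).trace

variable {U : ℝ → L → M}
  (hU : ContMDiff (𝓘(ℝ, ℝ).prod (𝓡 k)) (𝓡 n) ∞ (fun q : ℝ × L => U q.1 q.2))

include hU

lemma contMDiffOn_family_symm (x₀ : L) :
    ContMDiffOn 𝓘(ℝ, ℝ × EuclideanSpace ℝ (Fin k)) (𝓡 n) ∞
      (fun p : ℝ × EuclideanSpace ℝ (Fin k) => U p.1 ((extChartAt (𝓡 k) x₀).symm p.2))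
      (Set.univ ×ˢ (extChartAt (𝓡 k) x₀).target) := by
  have h2 : ContMDiffOn 𝓘(ℝ, ℝ × EuclideanSpace ℝ (Fin k)) (𝓡 k) ∞
      (fun p : ℝ × EuclideanSpace ℝ (Fin k) => (extChartAt (𝓡 k) x₀).symm p.2)
      (Set.univ ×ˢ (extChartAt (𝓡 k) x₀).target) :=
    (contMDiffOn_extChartAt_symm (I := 𝓡 k) (n := ∞) x₀).comp
      contDiff_snd.contMDiff.contMDiffOn fun p hp => hp.2
  exact hU.comp_contMDiffOn (contDiff_fst.contMDiff.contMDiffOn.prodMk h2)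

/-- `normDu` uses an orthonormal basis chosen separately at each point, with no continuity. The
expression `tr(G⁻¹ H)` in the coordinate frame avoids that choice and is visibly smooth. -/
lemma contDiffOn_energyCoord (x₀ : L) : ContDiffOn ℝ ∞ (energyCoord (n := n) U x₀)
    (Set.univ ×ˢ (extChartAt (𝓡 k) x₀).target) := by
  have hopen : IsOpen ((Set.univ : Set ℝ) ×ˢ (extChartAt (𝓡 k) x₀).target) :=
    isOpen_univ.prod (isOpen_extChartAt_target x₀)
  unfold energyCoord
  simp only [Matrix.trace, Matrix.diag_apply, Matrix.mul_apply, Matrix.of_apply]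
  refine ContDiffOn.sum fun i _ => ContDiffOn.sum fun j _ => ContDiffOn.mul ?_ ?_
  · exact (contDiffOn_inv (contDiffOn_gram_coordFrame x₀)
      (fun y hy => (det_gram_coordFrame_pos x₀ hy).ne') i j).comp contDiffOn_snd fun p hp => hp.2
  · exact contDiffOn_inner_mfderiv hopen (contMDiffOn_family_symm hU x₀) _ _

/-- The spatial derivative of `U s` is the derivative of the whole family in the directions `(0,
v)`, by the chain rule with `y ↦ (s, y)`. -/
lemma sq_normDu_family (x₀ : L) (s : ℝ) {y : EuclideanSpace ℝ (Fin k)}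
    (hy : y ∈ (extChartAt (𝓡 k) x₀).target) :
    normDu (k := k) (n := n) (U s) ((extChartAt (𝓡 k) x₀).symm y) ^ 2
      = energyCoord (n := n) U x₀ (s, y) := by
  rw [sq_normDu_eq_trace _ _ hy, energyCoord]
  congr 2
  have hopen : IsOpen ((Set.univ : Set ℝ) ×ˢ (extChartAt (𝓡 k) x₀).target) :=
    isOpen_univ.prod (isOpen_extChartAt_target x₀)
  have hUs : ContMDiff (𝓡 k) (𝓡 n) ∞ (U s) :=
    hU.comp (contMDiff_const.prodMk contMDiff_id : ContMDiff (𝓡 k) (𝓘(ℝ, ℝ).prod (𝓡 k)) ∞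
      fun x : L => (s, x))
  have h1 := mfderiv_comp y ((hUs _).mdifferentiableAt (by simp))
    (mdifferentiableAt_extChartAt_symm x₀ hy)
  have h2 : MDifferentiableAt 𝓘(ℝ, ℝ × EuclideanSpace ℝ (Fin k)) (𝓡 n)
      (fun p : ℝ × EuclideanSpace ℝ (Fin k) => U p.1 ((extChartAt (𝓡 k) x₀).symm p.2)) (s, y) :=
    ((contMDiffOn_family_symm hU x₀).contMDiffAt (hopen.mem_nhds ⟨trivial, hy⟩)).mdifferentiableAt
      (by simp)
  have h3 := metricPull_comp (τ := fun y' => ((s, y') : ℝ × EuclideanSpace ℝ (Fin k))) (y := y) h2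
    ((differentiableAt_const s).prodMk differentiableAt_id)
  have hfd : ∀ v : EuclideanSpace ℝ (Fin k),
      fderiv ℝ (fun y' => ((s, y') : ℝ × EuclideanSpace ℝ (Fin k))) y v = (0, v) := by
    intro v
    have h : HasFDerivAt (𝕜 := ℝ) (fun y' => ((s, y') : ℝ × EuclideanSpace ℝ (Fin k)))
        ((0 : EuclideanSpace ℝ (Fin k) →L[ℝ] ℝ).prod (ContinuousLinearMap.id ℝ _)) y :=
      (hasFDerivAt_const s y).prodMk (hasFDerivAt_id y)
    rw [h.fderiv]
    rfl
  ext i j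
  simp only [Matrix.of_apply]
  rw [← hfd, ← hfd, ← h3]
  exact inner_congr rfl
    (congrArg (fun A : EuclideanSpace ℝ (Fin k) →L[ℝ] EuclideanSpace ℝ (Fin n) =>
      A (EuclideanSpace.single i 1)) h1.symm)
    (congrArg (fun A : EuclideanSpace ℝ (Fin k) →L[ℝ] EuclideanSpace ℝ (Fin n) =>
      A (EuclideanSpace.single j 1)) h1.symm)

/-- The neighbourhood of `x₀` does not depend on `s`; this is what yields joint continuity below and
allows differentiation in `s`. -/
lemma sq_normDu_family_eventuallyEq (x₀ : L) : ∀ᶠ x in 𝓝 x₀, ∀ s : ℝ,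
    normDu (k := k) (n := n) (U s) x ^ 2
      = energyCoord (n := n) U x₀ (s, extChartAt (𝓡 k) x₀ x) := by
  filter_upwards [extChartAt_source_mem_nhds (I := 𝓡 k) x₀] with x hx s
  rw [← sq_normDu_family hU x₀ s ((extChartAt (𝓡 k) x₀).map_source hx),
    (extChartAt (𝓡 k) x₀).left_inv hx]

lemma continuous_sq_normDu_family :
    Continuous fun q : ℝ × L => normDu (k := k) (n := n) (U q.1) q.2 ^ 2 := by
  rw [continuous_iff_continuousAt]
  rintro ⟨s₀, x₀⟩
  have h1 : ContinuousAt (energyCoord (n := n) U x₀) (s₀, extChartAt (𝓡 k) x₀ x₀) :=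
    ((contDiffOn_energyCoord hU x₀).continuousOn).continuousAt
      ((isOpen_univ.prod (isOpen_extChartAt_target x₀)).mem_nhds
        ⟨trivial, mem_extChartAt_target x₀⟩)
  have h2 : ContinuousAt (fun q : ℝ × L => (q.1, extChartAt (𝓡 k) x₀ q.2)) (s₀, x₀) :=
    continuousAt_fst.prodMk
      ((continuousAt_extChartAt (I := 𝓡 k) x₀).comp (continuousAt_snd (p := (s₀, x₀))))
  refine (h1.comp (f := fun q : ℝ × L => (q.1, extChartAt (𝓡 k) x₀ q.2)) h2).congr ?_
  filter_upwards [continuousAt_snd.eventually (sq_normDu_family_eventuallyEq hU x₀)] with q hq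
  exact (hq q.1).symm

lemma differentiable_sq_normDu_family (x : L) :
    Differentiable ℝ fun s => normDu (k := k) (n := n) (U s) x ^ 2 := by
  have h := (sq_normDu_family_eventuallyEq hU x).self_of_nhds
  simp only [h]
  intro s
  have h1 : DifferentiableAt ℝ (energyCoord (n := n) U x) (s, extChartAt (𝓡 k) x x) :=
    ((contDiffOn_energyCoord hU x).contDiffAt
      ((isOpen_univ.prod (isOpen_extChartAt_target x)).mem_nhds
        ⟨trivial, mem_extChartAt_target x⟩)).differentiableAt (by simp)
  exact DifferentiableAt.comp (g := energyCoord (n := n) U x) s h1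
    (differentiableAt_id.prodMk (differentiableAt_const _))

lemma continuous_deriv_sq_normDu_family :
    Continuous fun q : ℝ × L => deriv (fun s => normDu (k := k) (n := n) (U s) q.2 ^ 2) q.1 := by
  rw [continuous_iff_continuousAt]
  rintro ⟨s₀, x₀⟩
  have hopen := (isOpen_univ (X := ℝ)).prod (isOpen_extChartAt_target (I := 𝓡 k) x₀)
  have h1 : ContinuousAt (fun q => fderiv ℝ (energyCoord (n := n) U x₀) q (1, 0))
      (s₀, extChartAt (𝓡 k) x₀ x₀) :=
    ((((contDiffOn_energyCoord hU x₀).continuousOn_fderiv_of_isOpen hopen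
      (by simp)).clm_apply continuousOn_const).continuousAt
      (hopen.mem_nhds ⟨trivial, mem_extChartAt_target x₀⟩))
  have h2 : ContinuousAt (fun q : ℝ × L => (q.1, extChartAt (𝓡 k) x₀ q.2)) (s₀, x₀) :=
    continuousAt_fst.prodMk
      ((continuousAt_extChartAt (I := 𝓡 k) x₀).comp (continuousAt_snd (p := (s₀, x₀))))
  refine (h1.comp (f := fun q : ℝ × L => (q.1, extChartAt (𝓡 k) x₀ q.2)) h2).congr ?_
  filter_upwards [continuousAt_snd.eventually ((sq_normDu_family_eventuallyEq hU x₀).and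
    (extChartAt_source_mem_nhds (I := 𝓡 k) x₀))] with q hq
  simp only [hq.1, Function.comp_apply]
  have h3 : DifferentiableAt ℝ (energyCoord (n := n) U x₀) (q.1, extChartAt (𝓡 k) x₀ q.2) :=
    ((contDiffOn_energyCoord hU x₀).contDiffAt (hopen.mem_nhds
        ⟨trivial, (extChartAt (𝓡 k) x₀).map_source hq.2⟩)).differentiableAt (by simp)
  have h4 : HasDerivAt (fun s : ℝ => (s, extChartAt (𝓡 k) x₀ q.2)) (1, 0) q.1 :=
    (hasDerivAt_id q.1).prodMk (hasDerivAt_const _ _)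
  exact (h3.hasFDerivAt.comp_hasDerivAt q.1 h4).deriv.symm

omit hU

/-- The constant family gives continuity of the square; the root is then only continuous, not
smooth, where `du = 0`. -/
lemma continuous_normDu {u : L → M} (hu : ContMDiff (𝓡 k) (𝓡 n) ∞ u) :
    Continuous (normDu (k := k) (n := n) u) := by
  have h := (continuous_sq_normDu_family (U := fun _ => u) (hu.comp contMDiff_snd)).sqrt.comp
    (Continuous.prodMk_right (0 : ℝ))
  refine h.congr fun x => ?_
  simp only [Function.comp_apply]
  exact Real.sqrt_sq (Real.sqrt_nonneg _)

end Domain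

end Metric

/-! ### The Riemannian volume measure -/

section Volume

open MeasureTheory

variable {k : ℕ}
  {L : Type*} [TopologicalSpace L] [ChartedSpace (EuclideanSpace ℝ (Fin k)) L]
  [IsManifold (𝓡 k) ∞ L] [MeasurableSpace L] [BorelSpace L]
  [RiemannianBundle (fun x : L => TangentSpace (𝓡 k) x)]
  [IsContMDiffRiemannianBundle (𝓡 k) ∞ (EuclideanSpace ℝ (Fin k))
      (fun x : L => TangentSpace (𝓡 k) x)]

/-- The density of the Riemannian volume in the chart at `x₀`. -/
def volDensity (x₀ : L) (y : EuclideanSpace ℝ (Fin k)) : ℝ :=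
  √(Matrix.gram ℝ (coordFrame x₀ y)).det

omit [MeasurableSpace L] [BorelSpace L] in
lemma continuousOn_volDensity (x₀ : L) :
    ContinuousOn (volDensity x₀) (extChartAt (𝓡 k) x₀).target :=
  (contDiffOn_det_gram_coordFrame x₀).continuousOn.sqrt

omit [MeasurableSpace L] [BorelSpace L] in
lemma volDensity_pos (x₀ : L) {y : EuclideanSpace ℝ (Fin k)}
    (hy : y ∈ (extChartAt (𝓡 k) x₀).target) : 0 < volDensity x₀ y :=
  Real.sqrt_pos.2 (det_gram_coordFrame_pos x₀ hy)

lemma aemeasurable_extChartAt_symm (x₀ : L) : AEMeasurable (extChartAt (𝓡 k) x₀).symm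
    ((volume : Measure (EuclideanSpace ℝ (Fin k))).restrict (extChartAt (𝓡 k) x₀).target) :=
  (continuousOn_extChartAt_symm x₀).aemeasurable (isOpen_extChartAt_target x₀).measurableSet

lemma measurableSet_target_inter_preimage (x₀ : L) {A : Set L} (hA : MeasurableSet A) :
    MeasurableSet ((extChartAt (𝓡 k) x₀).target ∩ (extChartAt (𝓡 k) x₀).symm ⁻¹' A) := by
  have h : Measurable ((extChartAt (𝓡 k) x₀).target.domRestrict (extChartAt (𝓡 k) x₀).symm) :=
    (continuousOn_extChartAt_symm x₀).domRestrict.measurable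
  have h2 := (isOpen_extChartAt_target (I := 𝓡 k) x₀).measurableSet.subtype_image (h hA)
  convert h2 using 1
  ext y
  constructor
  · rintro ⟨hy, hyA⟩
    exact ⟨⟨y, hy⟩, hyA, rfl⟩
  · rintro ⟨⟨y, hy⟩, hyA, rfl⟩
    exact ⟨hy, hyA⟩

lemma chartVolume_apply (x₀ : L) {A : Set L} (hA : MeasurableSet A) :
    chartVolume (k := k) x₀ A
      = ∫⁻ y in (extChartAt (𝓡 k) x₀).target ∩ (extChartAt (𝓡 k) x₀).symm ⁻¹' A,
        ENNReal.ofReal (volDensity x₀ y) := by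
  rw [chartVolume, Measure.map_apply_of_aemeasurable ((aemeasurable_extChartAt_symm x₀).mono_ac
    (withDensity_absolutelyContinuous _ _)) hA, withDensity_apply',
    Measure.restrict_restrict' (isOpen_extChartAt_target x₀).measurableSet, Set.inter_comm]
  rfl

lemma chartVolume_inter_source (x₀ : L) {A : Set L} (hA : MeasurableSet A) :
    chartVolume (k := k) x₀ (A ∩ (extChartAt (𝓡 k) x₀).source) = chartVolume (k := k) x₀ A := by
  rw [chartVolume_apply x₀ hA,
    chartVolume_apply x₀ (hA.inter (isOpen_extChartAt_source x₀).measurableSet)]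
  congr 2
  ext y
  simp only [Set.mem_inter_iff, Set.mem_preimage]
  exact ⟨fun h => ⟨h.1, h.2.1⟩, fun h => ⟨h.1, h.2, (extChartAt (𝓡 k) x₀).map_target h.1⟩⟩

omit [MeasurableSpace L] [BorelSpace L] [RiemannianBundle (fun x : L => TangentSpace (𝓡 k) x)]
  [IsContMDiffRiemannianBundle (𝓡 k) ∞ (EuclideanSpace ℝ (Fin k))
      (fun x : L => TangentSpace (𝓡 k) x)] in
lemma contDiffAt_transition (x₀ x₁ : L) {y : EuclideanSpace ℝ (Fin k)}
    (hy : y ∈ (extChartAt (𝓡 k) x₀).target)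
    (hy' : (extChartAt (𝓡 k) x₀).symm y ∈ (extChartAt (𝓡 k) x₁).source) :
    ContDiffAt ℝ ∞ (readIn k k (id : L → L) x₀ x₁) y :=
  contDiffAt_readIn contMDiff_id x₀ x₁ hy hy'

omit [MeasurableSpace L] [BorelSpace L] [RiemannianBundle (fun x : L => TangentSpace (𝓡 k) x)]
  [IsContMDiffRiemannianBundle (𝓡 k) ∞ (EuclideanSpace ℝ (Fin k))
      (fun x : L => TangentSpace (𝓡 k) x)] in
lemma symm_eventuallyEq_symm_comp_transition (x₀ x₁ : L) {y : EuclideanSpace ℝ (Fin k)}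
    (hy : y ∈ (extChartAt (𝓡 k) x₀).target)
    (hy' : (extChartAt (𝓡 k) x₀).symm y ∈ (extChartAt (𝓡 k) x₁).source) :
    (extChartAt (𝓡 k) x₀).symm =ᶠ[𝓝 y]
      (extChartAt (𝓡 k) x₁).symm ∘ readIn k k (id : L → L) x₀ x₁ := by
  have hc : ContinuousAt (extChartAt (𝓡 k) x₀).symm y :=
    (continuousOn_extChartAt_symm x₀).continuousAt ((isOpen_extChartAt_target x₀).mem_nhds hy)
  filter_upwards [hc.preimage_mem_nhds ((isOpen_extChartAt_source x₁).mem_nhds hy')] with z hz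
  exact ((extChartAt (𝓡 k) x₁).left_inv hz).symm

/-- In matrix form `A = Dᵀ B D`. -/
lemma det_gram_basis_change {A B : Matrix (Fin k) (Fin k) ℝ}
    {D : EuclideanSpace ℝ (Fin k) →L[ℝ] EuclideanSpace ℝ (Fin k)}
    {g : EuclideanSpace ℝ (Fin k) →ₗ[ℝ] EuclideanSpace ℝ (Fin k) →ₗ[ℝ] ℝ}
    (hA : ∀ i j, A i j = g (D (EuclideanSpace.single i 1)) (D (EuclideanSpace.single j 1)))
    (hB : ∀ i j, B i j = g (EuclideanSpace.single i 1) (EuclideanSpace.single j 1)) :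
    A.det = D.det ^ 2 * B.det := by
  let b := (EuclideanSpace.basisFun (Fin k) ℝ).toBasis
  have hb : ∀ i, b i = EuclideanSpace.single i (1 : ℝ) := fun i => by simp [b]
  have hA' : A = (LinearMap.toMatrix b b D.toLinearMap).transpose * B
      * LinearMap.toMatrix b b D.toLinearMap := by
    have hD : ∀ i, D (EuclideanSpace.single i 1)
        = ∑ j, LinearMap.toMatrix b b D.toLinearMap j i • EuclideanSpace.single j (1 : ℝ) := by
      intro i
      rw [← hb]
      conv_lhs => rw [← b.sum_repr (D (b i))]
      simp [LinearMap.toMatrix_apply, hb]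
    ext i j
    rw [hA, hD i, hD j]
    simp only [map_sum, map_smul, LinearMap.sum_apply, LinearMap.smul_apply, smul_eq_mul,
      Matrix.mul_apply, Matrix.transpose_apply, hB, Finset.sum_mul, Finset.mul_sum]
    refine Finset.sum_congr rfl fun x _ => Finset.sum_congr rfl fun y _ => ?_
    ring
  rw [hA', Matrix.det_mul, Matrix.det_mul, Matrix.det_transpose, LinearMap.det_toMatrix]
  change D.toLinearMap.det * B.det * D.toLinearMap.det = D.toLinearMap.det ^ 2 * B.det
  ring

omit [MeasurableSpace L] [BorelSpace L] in
lemma volDensity_eq_transition (x₀ x₁ : L) {y : EuclideanSpace ℝ (Fin k)}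
    (hy : y ∈ (extChartAt (𝓡 k) x₀).target)
    (hy' : (extChartAt (𝓡 k) x₀).symm y ∈ (extChartAt (𝓡 k) x₁).source) :
    volDensity x₀ y = |(fderiv ℝ (readIn k k (id : L → L) x₀ x₁) y).det|
      * volDensity x₁ (readIn k k (id : L → L) x₀ x₁ y) := by
  set τ := readIn k k (id : L → L) x₀ x₁ with hτ
  have hτy : τ y ∈ (extChartAt (𝓡 k) x₁).target := (extChartAt (𝓡 k) x₁).map_source hy'
  have hτd : DifferentiableAt ℝ τ y := (contDiffAt_transition x₀ x₁ hy hy').differentiableAt (by simp)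
  have hm : ∀ v w, metricPull (n := k) (extChartAt (𝓡 k) x₀).symm y v w
      = metricPull (n := k) (extChartAt (𝓡 k) x₁).symm (τ y) (fderiv ℝ τ y v) (fderiv ℝ τ y w) :=
    fun v w => (metricPull_congr (symm_eventuallyEq_symm_comp_transition x₀ x₁ hy hy') v w).trans
      (metricPull_comp (mdifferentiableAt_extChartAt_symm x₁ hτy) hτd v w)
  let A := mfderiv (𝓡 k) (𝓡 k) (extChartAt (𝓡 k) x₁).symm (τ y)
  let g : EuclideanSpace ℝ (Fin k) →ₗ[ℝ] EuclideanSpace ℝ (Fin k) →ₗ[ℝ] ℝ :=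
    LinearMap.BilinForm.comp
      (innerₗ (TangentSpace (𝓡 k) ((extChartAt (𝓡 k) x₁).symm (τ y)))) A.toLinearMap A.toLinearMap
  have hdet := det_gram_basis_change (A := Matrix.gram ℝ (coordFrame x₀ y))
    (B := Matrix.gram ℝ (coordFrame x₁ (τ y))) (D := fderiv ℝ τ y) (g := g)
    (fun i j => hm _ _) (fun i j => rfl)
  rw [volDensity, volDensity, hdet, Real.sqrt_mul (sq_nonneg _), Real.sqrt_sq_eq_abs]

/-- Change of variables along the transition map `τ`: its Jacobian `|det Dτ|` is exactly the factor
by which the two densities differ. -/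
lemma chartVolume_eq_of_subset (x₀ x₁ : L) {A : Set L} (hA : MeasurableSet A)
    (h₀ : A ⊆ (extChartAt (𝓡 k) x₀).source) (h₁ : A ⊆ (extChartAt (𝓡 k) x₁).source) :
    chartVolume (k := k) x₀ A = chartVolume (k := k) x₁ A := by
  set τ := readIn k k (id : L → L) x₀ x₁ with hτ
  set B := (extChartAt (𝓡 k) x₀).target ∩ (extChartAt (𝓡 k) x₀).symm ⁻¹' A with hB
  have himg : (extChartAt (𝓡 k) x₁).target ∩ (extChartAt (𝓡 k) x₁).symm ⁻¹' A = τ '' B := by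
    ext z
    constructor
    · rintro ⟨hz, hzA⟩
      refine ⟨extChartAt (𝓡 k) x₀ ((extChartAt (𝓡 k) x₁).symm z),
        ⟨(extChartAt (𝓡 k) x₀).map_source (h₀ hzA), ?_⟩, ?_⟩
      · rw [Set.mem_preimage, (extChartAt (𝓡 k) x₀).left_inv (h₀ hzA)]
        exact hzA
      · simp only [hτ, readIn, id]
        rw [(extChartAt (𝓡 k) x₀).left_inv (h₀ hzA), (extChartAt (𝓡 k) x₁).right_inv hz]
    · rintro ⟨y, ⟨hy, hyA⟩, rfl⟩
      refine ⟨(extChartAt (𝓡 k) x₁).map_source (h₁ hyA), ?_⟩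
      simp only [hτ, readIn, id, Set.mem_preimage]
      rw [(extChartAt (𝓡 k) x₁).left_inv (h₁ hyA)]
      exact hyA
  have hinj : Set.InjOn τ B := by
    intro y hy z hz hyz
    have h1 := (extChartAt (𝓡 k) x₁).injOn (h₁ hy.2) (h₁ hz.2) hyz
    exact (extChartAt (𝓡 k) x₀).symm.injOn hy.1 hz.1 h1
  rw [chartVolume_apply x₀ hA, chartVolume_apply x₁ hA, himg,
    lintegral_image_eq_lintegral_abs_det_fderiv_mul volume
      (measurableSet_target_inter_preimage x₀ hA)
      (fun y hy => ((contDiffAt_transition x₀ x₁ hy.1 (h₁ hy.2)).differentiableAt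
        (by simp)).hasFDerivAt.hasFDerivWithinAt) hinj]
  refine setLIntegral_congr_fun (measurableSet_target_inter_preimage x₀ hA) fun y hy => ?_
  rw [volDensity_eq_transition x₀ x₁ hy.1 (h₁ hy.2), ENNReal.ofReal_mul (abs_nonneg _)]

lemma chartVolume_le_riemannianVolume (x₀ : L) :
    chartVolume (k := k) x₀ ≤ riemannianVolume k L :=
  le_iSup (fun x₀ : L => chartVolume (k := k) x₀) x₀

/-- The volume is defined as a supremum of measures; this identifies it inside a chart, so that
integrals can be computed there. -/
lemma riemannianVolume_restrict_source (x₀ : L) :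
    (riemannianVolume k L).restrict (extChartAt (𝓡 k) x₀).source = chartVolume (k := k) x₀ := by
  set S := (extChartAt (𝓡 k) x₀).source with hS
  have hSm : MeasurableSet S := (isOpen_extChartAt_source x₀).measurableSet
  -- A supremum of measures is bounded by any common upper bound. Every chart measure lies below
  -- this sum: on `S` it agrees with the measure of the chart at `x₀` wherever it is nonzero, and
  -- off `S` the second summand dominates it.
  have hle : riemannianVolume k L ≤ chartVolume (k := k) x₀ + (riemannianVolume k L).restrict Sᶜ := by
    refine iSup_le fun x₁ => Measure.le_iff.2 fun A hA => ?_
    rw [Measure.add_apply, Measure.restrict_apply hA, ← measure_inter_add_sdiff A hSm]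
    refine add_le_add ?_ (chartVolume_le_riemannianVolume x₁ _)
    rw [← chartVolume_inter_source x₁ (hA.inter hSm), ← chartVolume_eq_of_subset x₀ x₁
      ((hA.inter hSm).inter (isOpen_extChartAt_source x₁).measurableSet)
      (fun x hx => hx.1.2) (fun x hx => hx.2)]
    exact measure_mono fun x hx => hx.1.1
  refine Measure.ext fun A hA => ?_
  rw [Measure.restrict_apply hA]
  refine le_antisymm ?_ ?_
  · refine (Measure.le_iff'.1 hle _).trans ?_
    rw [Measure.add_apply, Measure.restrict_apply (hA.inter hSm), Set.inter_assoc,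
      Set.inter_compl_self, Set.inter_empty, measure_empty, add_zero]
    exact measure_mono Set.inter_subset_left
  · rw [← chartVolume_inter_source x₀ hA]
    exact chartVolume_le_riemannianVolume x₀ _

lemma integral_riemannianVolume_eq (x₀ : L) {f : L → ℝ}
    (hf : ContinuousOn f (extChartAt (𝓡 k) x₀).source)
    (h0 : ∀ x ∉ (extChartAt (𝓡 k) x₀).source, f x = 0) :
    ∫ x, f x ∂(riemannianVolume k L) = ∫ y in (extChartAt (𝓡 k) x₀).target,
      volDensity x₀ y * f ((extChartAt (𝓡 k) x₀).symm y) := by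
  have hfm : AEStronglyMeasurable f (chartVolume (k := k) x₀) := by
    rw [← riemannianVolume_restrict_source]
    exact hf.aestronglyMeasurable (isOpen_extChartAt_source x₀).measurableSet
  have hdm : AEMeasurable (fun y => ENNReal.ofReal (volDensity x₀ y))
      ((volume : Measure (EuclideanSpace ℝ (Fin k))).restrict (extChartAt (𝓡 k) x₀).target) :=
    ((continuousOn_volDensity x₀).aemeasurable
      (isOpen_extChartAt_target x₀).measurableSet).ennreal_ofReal
  rw [← setIntegral_eq_integral_of_forall_compl_eq_zero h0, riemannianVolume_restrict_source]
  rw [chartVolume] at hfm ⊢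
  rw [integral_map ((aemeasurable_extChartAt_symm x₀).mono_ac
    (withDensity_absolutelyContinuous _ _)) hfm]
  refine (integral_withDensity_eq_integral_toReal_smul₀ hdm
    (Filter.Eventually.of_forall fun _ => ENNReal.ofReal_lt_top) _).trans ?_
  refine setIntegral_congr_fun (isOpen_extChartAt_target x₀).measurableSet fun y hy => ?_
  simp only [ENNReal.toReal_ofReal (volDensity_pos x₀ hy).le, smul_eq_mul]

/-- Makes continuous functions on the compact manifold integrable. -/
instance : IsLocallyFiniteMeasure (riemannianVolume k L) := by
  refine ⟨fun x₀ => ?_⟩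
  obtain ⟨K, hK, hKc, hKT⟩ := exists_mem_nhds_isCompact_mapsTo (X := EuclideanSpace ℝ (Fin k))
    (f := id) continuous_id ((isOpen_extChartAt_target x₀).mem_nhds
      (mem_extChartAt_target (I := 𝓡 k) x₀))
  refine ⟨(extChartAt (𝓡 k) x₀).source ∩ extChartAt (𝓡 k) x₀ ⁻¹' interior K, ?_, ?_⟩
  · exact Filter.inter_mem (extChartAt_source_mem_nhds x₀)
      ((continuousAt_extChartAt x₀).preimage_mem_nhds (interior_mem_nhds.2 hK))
  · have hAo : IsOpen ((extChartAt (𝓡 k) x₀).source ∩ extChartAt (𝓡 k) x₀ ⁻¹' interior K) :=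
      (continuousOn_extChartAt x₀).isOpen_inter_preimage (isOpen_extChartAt_source x₀)
        isOpen_interior
    obtain ⟨C, hC⟩ := hKc.exists_bound_of_continuousOn ((continuousOn_volDensity x₀).mono hKT)
    rw [← Set.inter_eq_left.2 (Set.inter_subset_left :
        (extChartAt (𝓡 k) x₀).source ∩ extChartAt (𝓡 k) x₀ ⁻¹' interior K ⊆
          (extChartAt (𝓡 k) x₀).source), ← Measure.restrict_apply hAo.measurableSet,
      riemannianVolume_restrict_source, chartVolume_apply x₀ hAo.measurableSet]
    have hsub : (extChartAt (𝓡 k) x₀).target ∩ (extChartAt (𝓡 k) x₀).symm ⁻¹'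
        ((extChartAt (𝓡 k) x₀).source ∩ extChartAt (𝓡 k) x₀ ⁻¹' interior K) ⊆ K := by
      rintro y ⟨hy, -, hyK⟩
      rw [Set.mem_preimage, (extChartAt (𝓡 k) x₀).right_inv hy] at hyK
      exact interior_subset hyK
    refine (lintegral_mono_set hsub).trans_lt ((setLIntegral_mono' hKc.measurableSet
      (g := fun _ => ENNReal.ofReal C) fun y hy => ENNReal.ofReal_le_ofReal
        ((le_abs_self _).trans (hC y hy))).trans_lt ?_)
    rw [setLIntegral_const]
    exact ENNReal.mul_lt_top ENNReal.ofReal_lt_top hKc.measure_lt_top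

/-- Needed in the equality case: continuous functions that agree almost everywhere agree everywhere.
-/
instance : (riemannianVolume k L).IsOpenPosMeasure := by
  refine ⟨fun A hA ⟨x, hx⟩ h0 => ?_⟩
  have h1 : chartVolume (k := k) x A = 0 :=
    le_antisymm ((chartVolume_le_riemannianVolume x A).trans h0.le) bot_le
  have hopen : IsOpen ((extChartAt (𝓡 k) x).target ∩ (extChartAt (𝓡 k) x).symm ⁻¹' A) :=
    (continuousOn_extChartAt_symm x).isOpen_inter_preimage (isOpen_extChartAt_target x) hA
  have hdm : AEMeasurable (fun y => ENNReal.ofReal (volDensity x y))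
      ((volume : Measure (EuclideanSpace ℝ (Fin k))).restrict
        ((extChartAt (𝓡 k) x).target ∩ (extChartAt (𝓡 k) x).symm ⁻¹' A)) :=
    (((continuousOn_volDensity x).mono Set.inter_subset_left).aemeasurable
      hopen.measurableSet).ennreal_ofReal
  rw [chartVolume_apply x hA.measurableSet, lintegral_eq_zero_iff' hdm,
    Filter.EventuallyEq, ae_restrict_iff' hopen.measurableSet] at h1
  refine hopen.measure_ne_zero volume ⟨extChartAt (𝓡 k) x x, mem_extChartAt_target x, ?_⟩ ?_
  · rw [Set.mem_preimage, extChartAt_to_inv x]; exact hx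
  · refine measure_mono_null ?_ (ae_iff.1 h1)
    intro y hy hy0
    have := hy0 hy
    simp only [Pi.zero_apply, ENNReal.ofReal_eq_zero] at this
    exact absurd (volDensity_pos x hy.1) (not_lt.2 this)

end Volume

/-! ### Integration of forms of top degree -/

section Integration

open MeasureTheory

variable {k : ℕ}
  {L : Type*} [TopologicalSpace L] [ChartedSpace (EuclideanSpace ℝ (Fin k)) L]
  [IsManifold (𝓡 k) ∞ L]
  [RiemannianBundle (fun x : L => TangentSpace (𝓡 k) x)]
  [IsContMDiffRiemannianBundle (𝓡 k) ∞ (EuclideanSpace ℝ (Fin k))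
      (fun x : L => TangentSpace (𝓡 k) x)]

/-- An orthonormal basis of the tangent space. -/
def tangentONB (x : L) : OrthonormalBasis (Fin k) ℝ (TangentSpace (𝓡 k) x) :=
  (stdOrthonormalBasis ℝ (TangentSpace (𝓡 k) x)).reindex (finCongr Fact.out)

lemma sq_volForm (o : ManifoldOrientation k L) (x : L) (v : Fin k → TangentSpace (𝓡 k) x) :
    volForm o x v ^ 2 = (Matrix.gram ℝ v).det :=
  sq_volumeForm_eq_det_gram (V := TangentSpace (𝓡 k) x) (o.at' x) (tangentONB x) v

lemma volForm_ne_zero (o : ManifoldOrientation k L) {x : L} {v : Fin k → TangentSpace (𝓡 k) x}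
    (hv : LinearIndependent ℝ v) : volForm o x v ≠ 0 := by
  intro h0
  have h1 : (Matrix.gram ℝ v).det ≠ 0 :=
    (Matrix.det_gram_ne_zero_iff_linearIndependent (E := TangentSpace (𝓡 k) x)).2 hv
  rw [← sq_volForm o, h0] at h1
  simp at h1

/-- A form of top degree is the multiple `volRatio` of the volume form. -/
lemma apply_eq_volRatio_mul (o : ManifoldOrientation k L) (θ : Form k L k) (x : L)
    (v : Fin k → TangentSpace (𝓡 k) x) : θ x v = volRatio o θ x * volForm o x v := by
  let e : Module.Basis (Fin k) ℝ (TangentSpace (𝓡 k) x) :=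
    (EuclideanSpace.basisFun (Fin k) ℝ).toBasis
  have he : (e : Fin k → TangentSpace (𝓡 k) x)
      = fun i => (EuclideanSpace.single i (1 : ℝ) : EuclideanSpace ℝ (Fin k)) := by
    funext i
    exact (EuclideanSpace.basisFun (Fin k) ℝ).coe_toBasis ▸ EuclideanSpace.basisFun_apply _ _ i
  have h1 : θ x v = θ x e * e.det v :=
    congrArg (fun f : TangentSpace (𝓡 k) x [⋀^Fin k]→ₗ[ℝ] ℝ => f v)
      ((θ x).toAlternatingMap.eq_smul_basis_det e)
  have h2 : volForm o x v = volForm o x e * e.det v :=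
    congrArg (fun f : TangentSpace (𝓡 k) x [⋀^Fin k]→ₗ[ℝ] ℝ => f v)
      ((volForm o x).eq_smul_basis_det e)
  have h3 : volForm o x e ≠ 0 := volForm_ne_zero o e.linearIndependent
  rw [volRatio, ← he, h1, h2, div_mul_eq_mul_div, mul_comm (volForm o x e), ← mul_assoc,
    mul_div_cancel_right₀ _ h3]

/-- `W` is an open neighbourhood of `x₀` in the domain of the chart at `x₀` on which the volume
form has the coordinate expression `ε √(det g)`. -/
structure IsOrientedNhd (o : ManifoldOrientation k L) (x₀ : L) (W : Set L) (ε : ℝ) : Prop where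
  isOpen : IsOpen W
  mem : x₀ ∈ W
  subset : W ⊆ (extChartAt (𝓡 k) x₀).source
  sq : ε * ε = 1
  volForm_eq : ∀ y ∈ (extChartAt (𝓡 k) x₀).target, (extChartAt (𝓡 k) x₀).symm y ∈ W →
    volForm o _ (coordFrame x₀ y) = ε * volDensity x₀ y

variable [NeZero k]

/-- The trivialization at `x₀` is the differential of the chart, so it carries the coordinate frame
to the standard basis. This turns local constancy of the orientation into a statement about the sign
of the volume form. -/
lemma volForm_coordFrame_pos_iff (o : ManifoldOrientation k L) (x₀ : L)
    {y : EuclideanSpace ℝ (Fin k)} (hy : y ∈ (extChartAt (𝓡 k) x₀).target)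
    (hx : (extChartAt (𝓡 k) x₀).symm y ∈ (trivializationAt (EuclideanSpace ℝ (Fin k))
        (TangentSpace (𝓡 k) : L → Type) x₀).baseSet) :
    0 < volForm o _ (coordFrame x₀ y) ↔
      Orientation.map (Fin k) ((trivializationAt (EuclideanSpace ℝ (Fin k))
        (TangentSpace (𝓡 k) : L → Type) x₀).continuousLinearEquivAt ℝ _ hx).toLinearEquiv
          (o.at' _) = (EuclideanSpace.basisFun (Fin k) ℝ).toBasis.orientation := by
  set x := (extChartAt (𝓡 k) x₀).symm y
  set A := ((trivializationAt (EuclideanSpace ℝ (Fin k))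
        (TangentSpace (𝓡 k) : L → Type) x₀).continuousLinearEquivAt ℝ _ hx).toLinearEquiv with hA
  let b : Module.Basis (Fin k) ℝ (TangentSpace (𝓡 k) x) :=
    (EuclideanSpace.basisFun (Fin k) ℝ).toBasis.map A.symm
  have hb : (b : Fin k → TangentSpace (𝓡 k) x) = coordFrame x₀ y := by
    funext i
    have hx' : x ∈ (chartAt (EuclideanSpace ℝ (Fin k)) x₀).source := by
      simpa using hx
    have h1 : A (coordFrame x₀ y i) = EuclideanSpace.single i (1 : ℝ) := by
      have : IsManifold (𝓡 k) 1 L := IsManifold.of_le (n := ∞) (by simp)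
      rw [← mfderiv_extChartAt_coordFrame x₀ hy i,
        ← TangentBundle.continuousLinearMapAt_trivializationAt hx']
      exact congrFun (Trivialization.coe_continuousLinearEquivAt_eq (R := ℝ)
        (trivializationAt (EuclideanSpace ℝ (Fin k)) (TangentSpace (𝓡 k) : L → Type) x₀) hx) _
    simp only [b, Module.Basis.map_apply, OrthonormalBasis.coe_toBasis,
      EuclideanSpace.basisFun_apply]
    rw [← h1, LinearEquiv.symm_apply_apply]
  have hmap : (EuclideanSpace.basisFun (Fin k) ℝ).toBasis.orientation
      = Orientation.map (Fin k) A b.orientation := by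
    rw [← Module.Basis.orientation_map]
    congr 1
    ext1 i
    simp [b]
  rw [hmap, (Orientation.map (Fin k) A).injective.eq_iff, ← hb]
  let e := (o.at' x).finOrthonormalBasis (Nat.pos_of_neZero k) Fact.out
  have he : e.toBasis.orientation = o.at' x := (o.at' x).finOrthonormalBasis_orientation _ _
  rw [volForm, (o.at' x).volumeForm_robust e he, ← he, Module.Basis.orientation_eq_iff_det_pos]

/-- The absolute value of the volume form on the frame is the root of the Gram determinant; its sign
is constant where the orientation, read in the trivialization, is a fixed `σ`. -/
lemma exists_isOrientedNhd (o : ManifoldOrientation k L) (x₀ : L) :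
    ∃ (W : Set L) (ε : ℝ), IsOrientedNhd o x₀ W ε := by
  classical
  obtain ⟨σ, hσ⟩ := o.locally_const x₀
  obtain ⟨V, hV, hVo, hxV⟩ := eventually_nhds_iff.1 hσ
  refine ⟨V ∩ (extChartAt (𝓡 k) x₀).source,
    if σ = (EuclideanSpace.basisFun (Fin k) ℝ).toBasis.orientation then 1 else -1,
    hVo.inter (isOpen_extChartAt_source x₀), ⟨hxV, mem_extChartAt_source x₀⟩,
    Set.inter_subset_right, by split_ifs <;> norm_num, fun y hy hyW => ?_⟩
  obtain ⟨hx, hxσ⟩ := hV _ hyW.1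
  have h1 := volForm_coordFrame_pos_iff o x₀ hy hx
  rw [hxσ] at h1
  have h2 : |volForm o _ (coordFrame x₀ y)| = volDensity x₀ y := by
    rw [volDensity, ← sq_volForm o, Real.sqrt_sq_eq_abs]
  split_ifs with h
  · rw [← h2, one_mul, abs_of_pos (h1.2 h)]
  · have h3 : volForm o _ (coordFrame x₀ y) ≤ 0 := not_lt.1 fun h' => h (h1.1 h')
    rw [← h2, abs_of_nonpos h3]
    ring

variable {o : ManifoldOrientation k L} {x₀ : L} {W : Set L} {ε : ℝ}

lemma IsOrientedNhd.volRatio_mul_volDensity (hW : IsOrientedNhd o x₀ W ε) (θ : Form k L k)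
    {y : EuclideanSpace ℝ (Fin k)} (hy : y ∈ (extChartAt (𝓡 k) x₀).target)
    (hyW : (extChartAt (𝓡 k) x₀).symm y ∈ W) :
    volDensity x₀ y * volRatio o θ ((extChartAt (𝓡 k) x₀).symm y)
      = ε * localRep θ x₀ y fun i => EuclideanSpace.single i (1 : ℝ) := by
  have h1 : localRep θ x₀ y (fun i => EuclideanSpace.single i (1 : ℝ))
      = θ ((extChartAt (𝓡 k) x₀).symm y) (coordFrame x₀ y) := rfl
  rw [h1, apply_eq_volRatio_mul o, hW.volForm_eq y hy hyW]
  linear_combination (-(volDensity x₀ y * volRatio o θ ((extChartAt (𝓡 k) x₀).symm y))) * hW.sq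

/-- The model basis defining `volRatio` need not be a continuous frame of the tangent bundle. Near
`x₀` the ratio is instead computed on the coordinate frame, where numerator and denominator are both
continuous. -/
lemma continuous_volRatio (o : ManifoldOrientation k L) {θ : Form k L k} (hθ : IsSmoothForm θ) :
    Continuous (volRatio o θ) := by
  rw [continuous_iff_continuousAt]
  intro x₀
  obtain ⟨W, ε, hW⟩ := exists_isOrientedNhd o x₀
  have h1 : ContinuousAt (fun y => (ε * localRep θ x₀ y fun i => EuclideanSpace.single i (1 : ℝ))
      / volDensity x₀ y) (extChartAt (𝓡 k) x₀ x₀) := by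
    have hT := mem_extChartAt_target (I := 𝓡 k) x₀
    refine ContinuousAt.div (continuousAt_const.mul ?_)
      ((continuousOn_volDensity x₀).continuousAt ((isOpen_extChartAt_target x₀).mem_nhds hT))
      (volDensity_pos x₀ hT).ne'
    exact (ContinuousAlternatingMap.apply ℝ (EuclideanSpace ℝ (Fin k)) ℝ _).continuous.continuousAt.comp
      (hθ.contDiffAt hT).continuousAt
  refine (h1.comp (f := extChartAt (𝓡 k) x₀) (continuousAt_extChartAt x₀)).congr ?_
  filter_upwards [hW.isOpen.mem_nhds hW.mem] with x hx
  have hy := (extChartAt (𝓡 k) x₀).map_source (hW.subset hx)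
  have hinv := (extChartAt (𝓡 k) x₀).left_inv (hW.subset hx)
  simp only [Function.comp_apply]
  rw [← hW.volRatio_mul_volDensity θ hy (by rwa [hinv]), hinv,
    mul_div_cancel_left₀ _ (volDensity_pos x₀ hy).ne']

variable [MeasurableSpace L] [BorelSpace L]

lemma IsOrientedNhd.formIntegral_eq (hW : IsOrientedNhd o x₀ W ε) {θ : Form k L k}
    (hθ : IsSmoothForm θ) (h0 : ∀ x ∉ W, θ x = 0) :
    formIntegral o θ = ε * ∫ y in (extChartAt (𝓡 k) x₀).target,
      localRep θ x₀ y fun i => EuclideanSpace.single i (1 : ℝ) := by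
  have hr0 : ∀ x ∉ W, volRatio o θ x = 0 := by
    intro x hx
    rw [volRatio, h0 x hx]
    exact zero_div _
  rw [formIntegral, integral_riemannianVolume_eq x₀ (continuous_volRatio o hθ).continuousOn
    fun x hx => hr0 x fun h => hx (hW.subset h), ← integral_const_mul]
  refine setIntegral_congr_fun (isOpen_extChartAt_target x₀).measurableSet fun y hy => ?_
  by_cases hyW : (extChartAt (𝓡 k) x₀).symm y ∈ W
  · exact hW.volRatio_mul_volDensity θ hy hyW
  · have h1 : localRep θ x₀ y (fun i => EuclideanSpace.single i (1 : ℝ)) = 0 := by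
      change θ ((extChartAt (𝓡 k) x₀).symm y) (coordFrame x₀ y) = 0
      rw [h0 _ hyW]; rfl
    simp only [h1, hr0 _ hyW, mul_zero]

variable [CompactSpace L]

lemma integrable_volRatio (o : ManifoldOrientation k L) {θ : Form k L k} (hθ : IsSmoothForm θ) :
    Integrable (volRatio o θ) (riemannianVolume k L) :=
  (continuous_volRatio o hθ).integrable_of_hasCompactSupport (HasCompactSupport.of_compactSpace _)

/-- Integration of smooth forms of top degree. -/
def smoothFormIntegral (o : ManifoldOrientation k L) : smoothForms k L k →ₗ[ℝ] ℝ where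
  toFun θ := formIntegral o θ.1
  map_add' θ η := by
    rw [formIntegral, formIntegral, formIntegral,
      ← integral_add (integrable_volRatio o θ.2) (integrable_volRatio o η.2)]
    refine integral_congr_ae (Filter.Eventually.of_forall fun x => ?_)
    exact add_div _ _ _
  map_smul' c θ := by
    rw [formIntegral, formIntegral, RingHom.id_apply, smul_eq_mul, ← integral_const_mul]
    refine integral_congr_ae (Filter.Eventually.of_forall fun x => ?_)
    exact mul_div_assoc _ _ _

end Integration

/-! ### Stokes' theorem and the fundamental class -/

/-! ### The exterior derivative in a fixed chart. -/

section ExtDeriv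

variable {n : ℕ}
  {M : Type*} [TopologicalSpace M] [ChartedSpace (EuclideanSpace ℝ (Fin n)) M]
  [IsManifold (𝓡 n) ∞ M]

lemma pullback_id {p : ℕ} (θ : Form n M p) : pullback (k := n) (id : M → M) θ = θ := by
  funext x
  ext v
  refine form_congr θ rfl ?_
  funext i
  rw [mfderiv_id]
  rfl

/-- The exterior derivative may be computed in any chart. -/
lemma localRep_mextDeriv {p : ℕ} {θ : Form n M p} (hθ : IsSmoothForm θ) (x₀ : M)
    {y : EuclideanSpace ℝ (Fin n)} (hy : y ∈ (extChartAt (𝓡 n) x₀).target) :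
    localRep (mextDeriv θ) x₀ y = extDeriv (localRep θ x₀) y := by
  set x := (extChartAt (𝓡 n) x₀).symm y with hx
  have hz : (id : M → M) ((extChartAt (𝓡 n) x₀).symm y) ∈ (extChartAt (𝓡 n) x).source :=
    mem_extChartAt_source x
  have hτ := contDiffAt_readIn contMDiff_id x₀ x hy hz
  have hloc := localRep_pullback contMDiff_id θ x₀ x hy hz
  rw [pullback_id] at hloc
  rw [hloc.extDeriv_eq, extDeriv_pullback (f := readIn n n (id : M → M) x₀ x)
    (hθ.differentiableAt x) hτ (r := ∞) (by
    rw [minSmoothness_of_isRCLikeNormedField]; exact WithTop.coe_le_coe.2 le_top)]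
  have h1 := mfderiv_comp y ((contMDiffAt_extChartAt (I := 𝓡 n) (n := ∞)
    (x := x)).mdifferentiableAt (by simp)) (mdifferentiableAt_extChartAt_symm x₀ hy)
  have h2 : mfderiv (𝓡 n) (𝓡 n) (extChartAt (𝓡 n) x ∘ (extChartAt (𝓡 n) x₀).symm) y
      = fderiv ℝ (readIn n n (id : M → M) x₀ x) y := mfderiv_eq_fderiv
  have h3 := h2.symm.trans h1
  ext v
  refine congrArg (extDeriv (localRep θ x) (extChartAt (𝓡 n) x x)) ?_
  funext i
  exact congrArg (fun A : EuclideanSpace ℝ (Fin n) →L[ℝ] EuclideanSpace ℝ (Fin n) => A (v i))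
    h3.symm

/-- The definition of `mextDeriv` changes the chart from point to point; smoothness becomes visible
only after passing to one fixed chart. -/
lemma IsSmoothForm.mextDeriv {p : ℕ} {θ : Form n M p} (hθ : IsSmoothForm θ) :
    IsSmoothForm (mextDeriv θ) := by
  intro x₀
  have h : ContDiffOn ℝ ∞ (extDeriv (localRep θ x₀)) (extChartAt (𝓡 n) x₀).target := by
    intro y hy
    have h1 : ContDiffAt ℝ ∞ (fderiv ℝ (localRep θ x₀)) y :=
      (hθ.contDiffAt hy).fderiv_right (m := ∞) (by simp)
    exact ((ContinuousAlternatingMap.alternatizeUncurryFinCLM ℝ _ ℝ).contDiff.contDiffAt.comp y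
      h1).contDiffWithinAt
  exact h.congr fun y hy => localRep_mextDeriv hθ x₀ hy

variable (n M) in
/-- The exterior derivative on smooth forms as a linear map. -/
def smoothExtDeriv (p : ℕ) : smoothForms n M p →ₗ[ℝ] smoothForms n M (p + 1) where
  toFun η := ⟨mextDeriv η.1, IsSmoothForm.mextDeriv η.2⟩
  map_add' η η' := Subtype.ext (mextDeriv_add η.2 η'.2)
  map_smul' c η := Subtype.ext (mextDeriv_smul c η.1)

/-- The product of a function and a form. -/
def functionSMul {p : ℕ} (f : M → ℝ) (θ : Form n M p) : Form n M p := fun x => f x • θ x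

lemma IsSmoothForm.functionSMul {p : ℕ} {f : M → ℝ} (hf : ContMDiff (𝓡 n) 𝓘(ℝ, ℝ) ∞ f)
    {θ : Form n M p} (hθ : IsSmoothForm θ) : IsSmoothForm (functionSMul f θ) := by
  intro x₀
  have h1 : ContDiffOn ℝ ∞ (f ∘ (extChartAt (𝓡 n) x₀).symm) (extChartAt (𝓡 n) x₀).target :=
    contMDiffOn_iff_contDiffOn.1 (hf.comp_contMDiffOn (contMDiffOn_extChartAt_symm x₀))
  exact h1.smul (hθ x₀)

end ExtDeriv

lemma extDeriv_eq_zero_of_eventuallyEq {E : Type*} [NormedAddCommGroup E] [NormedSpace ℝ E] {p : ℕ}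
    {f : E → E [⋀^Fin p]→L[ℝ] ℝ} {x : E} (h : f =ᶠ[𝓝 x] fun _ => 0) : extDeriv f x = 0 := by
  rw [h.extDeriv_eq, extDeriv, fderiv_const_apply]
  ext v
  simp [ContinuousAlternatingMap.alternatizeUncurryFin_apply]

/-- Extension by zero of a function with compact support. -/
lemma contDiff_indicator {E F : Type*} [NormedAddCommGroup E] [NormedSpace ℝ E]
    [NormedAddCommGroup F] [NormedSpace ℝ F] {m : WithTop ℕ∞} {f : E → F} {s C : Set E}
    (hs : IsOpen s) (hf : ContDiffOn ℝ m f s) (hC : IsCompact C) (hCs : C ⊆ s)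
    (h0 : ∀ y ∈ s, y ∉ C → f y = 0) :
    ContDiff ℝ m (s.indicator f) ∧ tsupport (s.indicator f) ⊆ C ∧
      HasCompactSupport (s.indicator f) := by
  have h0' : ∀ y ∉ C, s.indicator f y = 0 := by
    intro y hy
    by_cases hys : y ∈ s
    · rw [Set.indicator_of_mem hys, h0 y hys hy]
    · exact Set.indicator_of_notMem hys f
  have hsub : tsupport (s.indicator f) ⊆ C :=
    closure_minimal (fun y hy => by_contra fun h => hy (h0' y h)) hC.isClosed
  refine ⟨contDiff_iff_contDiffAt.2 fun y => ?_, hsub, hC.of_isClosed_subset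
    (isClosed_tsupport _) hsub⟩
  by_cases hy : y ∈ s
  · refine (hf.contDiffAt (hs.mem_nhds hy)).congr_of_eventuallyEq ?_
    filter_upwards [hs.mem_nhds hy] with z hz using Set.indicator_of_mem hz f
  · refine contDiffAt_const (c := (0 : F)) |>.congr_of_eventuallyEq ?_
    filter_upwards [hC.isClosed.isOpen_compl.mem_nhds fun h => hy (hCs h)] with z hz
    exact h0' z hz

/-! ### Stokes' theorem on a closed manifold. -/

section Stokes

open MeasureTheory

variable {p : ℕ}
  {L : Type*} [TopologicalSpace L] [ChartedSpace (EuclideanSpace ℝ (Fin (p + 1))) L]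
  [IsManifold (𝓡 (p + 1)) ∞ L] [T2Space L] [CompactSpace L] [MeasurableSpace L] [BorelSpace L]
  [RiemannianBundle (fun x : L => TangentSpace (𝓡 (p + 1)) x)]
  [IsContMDiffRiemannianBundle (𝓡 (p + 1)) ∞ (EuclideanSpace ℝ (Fin (p + 1)))
      (fun x : L => TangentSpace (𝓡 (p + 1)) x)]
  {o : ManifoldOrientation (p + 1) L} {x₀ : L} {W : Set L} {ε : ℝ}

/-- Stokes' theorem for a form supported in a chart and with a primitive in this chart. -/
lemma IsOrientedNhd.formIntegral_eq_zero (hW : IsOrientedNhd o x₀ W ε)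
    {θ : Form (p + 1) L (p + 1)} (hθ : IsSmoothForm θ) {K : Set L} (hK : IsClosed K) (hKW : K ⊆ W)
    (h0 : ∀ x ∉ K, θ x = 0)
    {η : EuclideanSpace ℝ (Fin (p + 1)) → EuclideanSpace ℝ (Fin (p + 1)) [⋀^Fin p]→L[ℝ] ℝ}
    (hη : ContDiffOn ℝ 1 η ((extChartAt (𝓡 (p + 1)) x₀).target ∩
      (extChartAt (𝓡 (p + 1)) x₀).symm ⁻¹' W))
    (hη0 : ∀ y ∈ (extChartAt (𝓡 (p + 1)) x₀).target, (extChartAt (𝓡 (p + 1)) x₀).symm y ∉ K →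
      η y = 0)
    (hd : ∀ y ∈ (extChartAt (𝓡 (p + 1)) x₀).target, (extChartAt (𝓡 (p + 1)) x₀).symm y ∈ W →
      localRep θ x₀ y = extDeriv η y) :
    formIntegral o θ = 0 := by
  set T := (extChartAt (𝓡 (p + 1)) x₀).target with hT
  set s := T ∩ (extChartAt (𝓡 (p + 1)) x₀).symm ⁻¹' W with hs
  have hso : IsOpen s := (continuousOn_extChartAt_symm x₀).isOpen_inter_preimage
    (isOpen_extChartAt_target x₀) hW.isOpen
  have hKc : IsCompact (extChartAt (𝓡 (p + 1)) x₀ '' K) :=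
    hK.isCompact.image_of_continuousOn
      ((continuousOn_extChartAt x₀).mono (hKW.trans hW.subset))
  have hmem : ∀ y ∈ T, y ∉ extChartAt (𝓡 (p + 1)) x₀ '' K →
      (extChartAt (𝓡 (p + 1)) x₀).symm y ∉ K := fun y hy h h' =>
    h ⟨_, h', (extChartAt (𝓡 (p + 1)) x₀).right_inv hy⟩
  have hKs : extChartAt (𝓡 (p + 1)) x₀ '' K ⊆ s := by
    rintro _ ⟨x, hx, rfl⟩
    refine ⟨(extChartAt (𝓡 (p + 1)) x₀).map_source (hW.subset (hKW hx)), ?_⟩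
    rw [Set.mem_preimage, (extChartAt (𝓡 (p + 1)) x₀).left_inv (hW.subset (hKW hx))]
    exact hKW hx
  -- Extended by zero, the primitive is a compactly supported `C¹` form on the whole model space, to
  -- which the flat Stokes theorem applies.
  obtain ⟨h1, h2, h3⟩ := contDiff_indicator hso hη hKc hKs
    fun y hy hyK => hη0 y hy.1 (hmem y hy.1 hyK)
  rw [hW.formIntegral_eq hθ fun x hx => h0 x fun h => hx (hKW h)]
  have hz : ∀ y ∉ extChartAt (𝓡 (p + 1)) x₀ '' K, extDeriv (s.indicator η) y = 0 := by
    intro y hy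
    exact extDeriv_eq_zero_of_eventuallyEq
      (notMem_tsupport_iff_eventuallyEq.1 fun h => hy (h2 h))
  have hstokes := integral_extDeriv_eq_zero volume h1 h3
    fun i => (EuclideanSpace.single i (1 : ℝ) : EuclideanSpace ℝ (Fin (p + 1)))
  rw [← setIntegral_eq_integral_of_forall_compl_eq_zero (s := T) fun y hy => by
    rw [hz y fun h => hy (hKs h).1]; rfl] at hstokes
  have hfin : ∀ y ∈ T, (localRep θ x₀ y fun i => EuclideanSpace.single i (1 : ℝ))
      = extDeriv (s.indicator η) y fun i => EuclideanSpace.single i (1 : ℝ) := by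
    intro y hy
    by_cases hyW : (extChartAt (𝓡 (p + 1)) x₀).symm y ∈ W
    · have : s.indicator η =ᶠ[𝓝 y] η := by
        filter_upwards [hso.mem_nhds ⟨hy, hyW⟩] with z hz' using Set.indicator_of_mem hz' η
      rw [hd y hy hyW, this.extDeriv_eq]
    · rw [hz y fun h => hyW (hKs h).2]
      change θ _ (coordFrame x₀ y) = 0
      rw [h0 _ fun h => hyW (hKW h)]
      rfl
  rw [setIntegral_congr_fun (isOpen_extChartAt_target x₀).measurableSet hfin, hstokes, mul_zero]

lemma formIntegral_mextDeriv_functionSMul (hW : IsOrientedNhd o x₀ W ε)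
    {η : Form (p + 1) L p} (hη : IsSmoothForm η) {f : L → ℝ}
    (hf : ContMDiff (𝓡 (p + 1)) 𝓘(ℝ, ℝ) ∞ f) (hfW : tsupport f ⊆ W) :
    formIntegral o (mextDeriv (functionSMul f η)) = 0 := by
  have hs : IsSmoothForm (functionSMul f η) := hη.functionSMul hf
  have h0 : ∀ x ∉ tsupport f, functionSMul f η x = 0 := fun x hx => by
    rw [functionSMul, image_eq_zero_of_notMem_tsupport hx, zero_smul]
  have hl0 : ∀ y ∈ (extChartAt (𝓡 (p + 1)) x₀).target,
      (extChartAt (𝓡 (p + 1)) x₀).symm y ∉ tsupport f → localRep (functionSMul f η) x₀ y = 0 := by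
    intro y hy hyf
    ext v
    change functionSMul f η _ _ = 0
    rw [h0 _ hyf]; rfl
  refine hW.formIntegral_eq_zero hs.mextDeriv (isClosed_tsupport f) hfW ?_
    (((hs x₀).of_le (by exact_mod_cast le_top)).mono Set.inter_subset_left) hl0
    fun y hy _ => localRep_mextDeriv hs x₀ hy
  intro x hx
  have hev : localRep (functionSMul f η) x =ᶠ[𝓝 (extChartAt (𝓡 (p + 1)) x x)] fun _ => 0 := by
    have hc := (continuousOn_extChartAt_symm (I := 𝓡 (p + 1)) x).continuousAt
      ((isOpen_extChartAt_target x).mem_nhds (mem_extChartAt_target x))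
    have hx' : (extChartAt (𝓡 (p + 1)) x).symm (extChartAt (𝓡 (p + 1)) x x) ∈ (tsupport f)ᶜ := by
      rwa [extChartAt_to_inv x]
    filter_upwards [hc.preimage_mem_nhds ((isClosed_tsupport f).isOpen_compl.mem_nhds hx')]
      with y hy
    ext v
    change functionSMul f η _ _ = 0
    rw [h0 _ hy]; rfl
  rw [mextDeriv, extDeriv_eq_zero_of_eventuallyEq hev]
  ext v
  rfl

/-- Stokes' theorem: the integral of an exact form over a closed manifold vanishes. -/
lemma formIntegral_mextDeriv (o : ManifoldOrientation (p + 1) L) {η : Form (p + 1) L p}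
    (hη : IsSmoothForm η) : formIntegral o (mextDeriv η) = 0 := by
  choose W ε hW using exists_isOrientedNhd o
  obtain ⟨t, ht⟩ := CompactSpace.elim_nhds_subcover W fun x => (hW x).isOpen.mem_nhds (hW x).mem
  obtain ⟨χ, hχ⟩ := SmoothPartitionOfUnity.exists_isSubordinate (𝓡 (p + 1)) isClosed_univ
    (fun i : t => W i) (fun i => (hW i).isOpen) (by
      intro x _
      have hx : x ∈ ⋃ y ∈ t, W y := by rw [ht]; trivial
      simp only [Set.mem_iUnion] at hx ⊢
      obtain ⟨y, hy, hxy⟩ := hx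
      exact ⟨⟨y, hy⟩, hxy⟩)
  -- The cover is finite, so `η` is a finite sum of smooth forms supported in single charts and
  -- linearity suffices.
  have hsum : (⟨η, hη⟩ : smoothForms (p + 1) L p)
      = ∑ i, ⟨functionSMul (χ i) η, hη.functionSMul (χ i).contMDiff⟩ := by
    refine Subtype.ext (funext fun x => ?_)
    rw [AddSubmonoidClass.coe_finsetSum]
    have h1 : ∑ i, χ i x = 1 := by
      rw [← finsum_eq_sum_of_fintype]; exact χ.sum_eq_one trivial
    have h2 : (∑ i, functionSMul (χ i) η) x = ∑ i, χ i x • η x :=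
      Finset.sum_apply (M := fun x : L => TangentSpace (𝓡 (p + 1)) x [⋀^Fin p]→L[ℝ] ℝ) x _
        fun i => functionSMul (χ i) η
    change η x = (∑ i, functionSMul (χ i) η) x
    rw [h2, ← Finset.sum_smul, h1, one_smul]
  have h := congrArg (smoothFormIntegral o ∘ₗ smoothExtDeriv (p + 1) L p) hsum
  rw [map_sum] at h
  refine h.trans (Finset.sum_eq_zero fun i _ => ?_)
  exact formIntegral_mextDeriv_functionSMul (hW i) hη (χ i).contMDiff (hχ i)

/-- The fundamental class of an oriented closed manifold. -/
lemma exists_isFundamentalClass (o : ManifoldOrientation (p + 1) L) :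
    ∃ F : Module.Dual ℝ (DeRham (p + 1) L (p + 1)), IsFundamentalClass o F := by
  refine ⟨Submodule.liftQ _ (smoothFormIntegral o ∘ₗ Submodule.inclusion fun θ hθ => hθ.1) ?_,
    fun θ => rfl⟩
  rintro ⟨θ, hθ⟩ ⟨η, hη, hηθ⟩
  change formIntegral o θ = 0
  have hηθ' : mextDeriv η = θ := hηθ
  rw [← hηθ']
  exact formIntegral_mextDeriv o hη

end Stokes

/-! ### Homotopy invariance of the integral of a closed form -/

section Interpolation

variable {k n : ℕ} {L : Type*} [TopologicalSpace L]
  {M : Type*} [TopologicalSpace M] [ChartedSpace (EuclideanSpace ℝ (Fin n)) M]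

open Classical in
variable (n) in
/-- Interpolation, in the chart at `z`, between the map `f` (where `ρ = 0`) and the map with
coordinate expression `h` (where `ρ = 1`). -/
def interp (z : M) (ρ : L → ℝ) (f : L → M) (h : L → EuclideanSpace ℝ (Fin n)) (x : L) : M :=
  if x ∈ tsupport ρ then
    (extChartAt (𝓡 n) z).symm ((1 - ρ x) • extChartAt (𝓡 n) z (f x) + ρ x • h x)
  else f x

/-- The image of `K` under `f` is contained in the part of the chart at `z` given by `B`. -/
def MapsInto (n : ℕ) {M : Type*} [TopologicalSpace M] [ChartedSpace (EuclideanSpace ℝ (Fin n)) M]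
    (z : M) (B : Set (EuclideanSpace ℝ (Fin n))) (K : Set L) (f : L → M) : Prop :=
  ∀ x ∈ K, f x ∈ (extChartAt (𝓡 n) z).source ∧ extChartAt (𝓡 n) z (f x) ∈ B

variable {z : M} {ρ : L → ℝ} {f : L → M} {h : L → EuclideanSpace ℝ (Fin n)}
  {B : Set (EuclideanSpace ℝ (Fin n))}

lemma interp_of_notMem {x : L} (hx : x ∉ tsupport ρ) : interp n z ρ f h x = f x := if_neg hx

lemma interp_eventuallyEq_of_notMem {x : L} (hx : x ∉ tsupport ρ) :
    interp n z ρ f h =ᶠ[𝓝 x] f := by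
  filter_upwards [(isClosed_tsupport ρ).isOpen_compl.mem_nhds hx] with y hy
  exact interp_of_notMem hy

/-- Where `ρ = 0` the chart formula returns `f x`, so both branches of the definition agree on an
open set around the support of `ρ`. Continuity and smoothness are checked with this formula there
and with `f` elsewhere. -/
lemma interp_of_mem_source {x : L} (hx : f x ∈ (extChartAt (𝓡 n) z).source) :
    interp n z ρ f h x
      = (extChartAt (𝓡 n) z).symm ((1 - ρ x) • extChartAt (𝓡 n) z (f x) + ρ x • h x) := by
  by_cases hxρ : x ∈ tsupport ρ
  · exact if_pos hxρ
  · rw [interp_of_notMem hxρ, image_eq_zero_of_notMem_tsupport hxρ]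
    simp only [sub_zero, one_smul, zero_smul, add_zero]
    exact ((extChartAt (𝓡 n) z).left_inv hx).symm

lemma interp_eventuallyEq {x : L} (hf : ContinuousAt f x)
    (hx : f x ∈ (extChartAt (𝓡 n) z).source) : interp n z ρ f h =ᶠ[𝓝 x] fun x =>
      (extChartAt (𝓡 n) z).symm ((1 - ρ x) • extChartAt (𝓡 n) z (f x) + ρ x • h x) := by
  filter_upwards [hf.preimage_mem_nhds ((isOpen_extChartAt_source z).mem_nhds hx)] with y hy
  exact interp_of_mem_source hy

lemma interp_of_eq_one {x : L} (hx : ρ x = 1) :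
    interp n z ρ f h x = (extChartAt (𝓡 n) z).symm (h x) := by
  have hxs : x ∈ tsupport ρ := subset_tsupport ρ (by simp [hx])
  rw [interp, if_pos hxs, hx]
  simp

/-- Interpolation does not move points where the target already agrees with `f`, so agreement
achieved by earlier interpolations is never lost. -/
lemma interp_of_chart_eq {x : L} (hx : x ∈ tsupport ρ → f x ∈ (extChartAt (𝓡 n) z).source ∧
    h x = extChartAt (𝓡 n) z (f x)) : interp n z ρ f h x = f x := by
  by_cases hxρ : x ∈ tsupport ρ
  · obtain ⟨h1, h2⟩ := hx hxρ
    rw [interp_of_mem_source h1, h2, ← add_smul, sub_add_cancel, one_smul,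
      (extChartAt (𝓡 n) z).left_inv h1]
  · exact interp_of_notMem hxρ

lemma interp_coord_mem (hB : Convex ℝ B) (hρ : ∀ x, ρ x ∈ Set.Icc (0 : ℝ) 1)
    (hf : MapsInto n z B (tsupport ρ) f) (hh : ∀ x ∈ tsupport ρ, h x ∈ B) {x : L}
    (hx : x ∈ tsupport ρ) : (1 - ρ x) • extChartAt (𝓡 n) z (f x) + ρ x • h x ∈ B :=
  hB (hf x hx).2 (hh x hx) (by linarith [(hρ x).2]) (hρ x).1 (by ring)

lemma mapsInto_interp (hB : Convex ℝ B) (hBT : B ⊆ (extChartAt (𝓡 n) z).target)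
    (hρ : ∀ x, ρ x ∈ Set.Icc (0 : ℝ) 1)
    (hf : MapsInto n z B (tsupport ρ) f) (hh : ∀ x ∈ tsupport ρ, h x ∈ B) :
    MapsInto n z B (tsupport ρ) (interp n z ρ f h) := by
  intro x hx
  have h1 := interp_coord_mem hB hρ hf hh hx
  rw [interp_of_mem_source (hf x hx).1, (extChartAt (𝓡 n) z).right_inv (hBT h1)]
  exact ⟨(extChartAt (𝓡 n) z).map_target (hBT h1), h1⟩

lemma continuous_interp (hB : Convex ℝ B) (hBT : B ⊆ (extChartAt (𝓡 n) z).target)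
    (hρ : ∀ x, ρ x ∈ Set.Icc (0 : ℝ) 1) (hρc : Continuous ρ) (hfc : Continuous f)
    (hhc : ∀ x ∈ tsupport ρ, ContinuousAt h x)
    (hf : MapsInto n z B (tsupport ρ) f) (hh : ∀ x ∈ tsupport ρ, h x ∈ B) :
    Continuous (interp n z ρ f h) := by
  rw [continuous_iff_continuousAt]
  intro x
  by_cases hx : x ∈ tsupport ρ
  · refine ContinuousAt.congr ?_ (interp_eventuallyEq hfc.continuousAt (hf x hx).1).symm
    have h1 := interp_coord_mem hB hρ hf hh hx
    refine ContinuousAt.comp (f := fun x => (1 - ρ x) • extChartAt (𝓡 n) z (f x) + ρ x • h x)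
      ((continuousOn_extChartAt_symm z).continuousAt ((isOpen_extChartAt_target z).mem_nhds
        (hBT h1))) ?_
    exact ((continuousAt_const.sub hρc.continuousAt).smul
      ((continuousAt_extChartAt' (hf x hx).1).comp hfc.continuousAt)).add
        (hρc.continuousAt.smul (hhc x hx))
  · exact hfc.continuousAt.congr (interp_eventuallyEq_of_notMem hx).symm

/-- This is `continuous_interp` on `X × L` with cutoff `ρ ∘ snd`, whose closed support is a preimage
because the projection is open. Currying then gives continuity into the mapping space. -/
lemma continuous_interp_param {X : Type*} [TopologicalSpace X] (hB : Convex ℝ B)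
    (hBT : B ⊆ (extChartAt (𝓡 n) z).target) (hρ : ∀ x, ρ x ∈ Set.Icc (0 : ℝ) 1)
    (hρc : Continuous ρ) {F : X → L → M} {H : X → L → EuclideanSpace ℝ (Fin n)}
    (hF : Continuous fun q : X × L => F q.1 q.2)
    (hH : ∀ a, ∀ x ∈ tsupport ρ, ContinuousAt (fun q : X × L => H q.1 q.2) (a, x))
    (hFB : ∀ a, MapsInto n z B (tsupport ρ) (F a)) (hHB : ∀ a, ∀ x ∈ tsupport ρ, H a x ∈ B) :
    Continuous fun q : X × L => interp n z ρ (F q.1) (H q.1) q.2 := by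
  have hts : tsupport (fun q : X × L => ρ q.2) = Prod.snd ⁻¹' tsupport ρ :=
    (isOpenMap_snd.preimage_closure_eq_closure_preimage continuous_snd
      (Function.support ρ)).symm
  have hmem : ∀ q : X × L, q ∈ tsupport (fun q : X × L => ρ q.2) ↔ q.2 ∈ tsupport ρ := by
    intro q
    rw [hts, Set.mem_preimage]
  have key := continuous_interp (ρ := fun q : X × L => ρ q.2) (f := fun q => F q.1 q.2)
    (h := fun q => H q.1 q.2) hB hBT (fun q => hρ q.2) (hρc.comp continuous_snd) hF
    (fun q hq => hH q.1 q.2 ((hmem q).1 hq)) (fun q hq => hFB q.1 q.2 ((hmem q).1 hq))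
    (fun q hq => hHB q.1 q.2 ((hmem q).1 hq))
  refine key.congr fun q => ?_
  by_cases hq : q.2 ∈ tsupport ρ
  · rw [interp, interp, if_pos hq, if_pos ((hmem q).2 hq)]
  · rw [interp, interp, if_neg hq, if_neg fun h => hq ((hmem q).1 h)]

lemma contMDiffAt_interp [ChartedSpace (EuclideanSpace ℝ (Fin k)) L] [IsManifold (𝓡 n) ∞ M]
    (hB : Convex ℝ B) (hBT : B ⊆ (extChartAt (𝓡 n) z).target)
    (hρ : ∀ x, ρ x ∈ Set.Icc (0 : ℝ) 1) (hρc : ContMDiff (𝓡 k) 𝓘(ℝ, ℝ) ∞ ρ)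
    {x : L} (hfc : ContMDiffAt (𝓡 k) (𝓡 n) ∞ f x)
    (hhc : x ∈ tsupport ρ → ContMDiffAt (𝓡 k) (𝓡 n) ∞ h x)
    (hf : MapsInto n z B (tsupport ρ) f) (hh : ∀ x ∈ tsupport ρ, h x ∈ B) :
    ContMDiffAt (𝓡 k) (𝓡 n) ∞ (interp n z ρ f h) x := by
  by_cases hx : x ∈ tsupport ρ
  · refine ContMDiffAt.congr_of_eventuallyEq ?_
      (interp_eventuallyEq hfc.continuousAt (hf x hx).1)
    have h1 := interp_coord_mem hB hρ hf hh hx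
    have h2 : ContMDiffAt (𝓡 n) (𝓡 n) ∞ (extChartAt (𝓡 n) z).symm
        ((1 - ρ x) • extChartAt (𝓡 n) z (f x) + ρ x • h x) :=
      (contMDiffOn_extChartAt_symm (I := 𝓡 n) (n := ∞) z).contMDiffAt
        ((isOpen_extChartAt_target z).mem_nhds (hBT h1))
    have h3 : ContMDiffAt (𝓡 k) (𝓡 n) ∞ (fun x => extChartAt (𝓡 n) z (f x)) x :=
      ContMDiffAt.comp x (contMDiffAt_extChartAt' (by simpa using (hf x hx).1)) hfc
    exact ContMDiffAt.comp x h2 (((contMDiffAt_const.sub hρc.contMDiffAt).smul h3).add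
      (hρc.contMDiffAt.smul (hhc hx)))
  · exact hfc.congr_of_eventuallyEq (interp_eventuallyEq_of_notMem hx)

end Interpolation

/-- Valid in every regularity class, since primitives from the Poincaré lemma are only `C¹`. Smooth
composition is available for multilinear maps; antisymmetrizing and dividing by `p!` recovers the
alternating map. -/
lemma contDiffAt_pullback_flat {D E F : Type*} [NormedAddCommGroup D] [NormedSpace ℝ D]
    [NormedAddCommGroup E] [NormedSpace ℝ E] [NormedAddCommGroup F] [NormedSpace ℝ F] {p : ℕ}
    {m : WithTop ℕ∞} {f : D → F [⋀^Fin p]→L[ℝ] ℝ} {g : D → E →L[ℝ] F} {x : D}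
    (hf : ContDiffAt ℝ m f x) (hg : ContDiffAt ℝ m g x) :
    ContDiffAt ℝ m (fun y => (f y).compContinuousLinearMap (g y)) x := by
  have hp : (p.factorial : ℝ) ≠ 0 := by positivity
  have key : (fun y => (f y).compContinuousLinearMap (g y)) = fun y =>
      (p.factorial : ℝ)⁻¹ • alternatizationCLM E p
        (ContinuousMultilinearMap.compContinuousLinearMapContinuousMultilinear ℝ
          (fun _ : Fin p => E) (fun _ => F) ℝ (fun _ => g y)
          (ContinuousAlternatingMap.toContinuousMultilinearMapCLM ℝ (f y))) := by
    funext y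
    rw [eq_inv_smul_iff₀ hp, ← alternatizationCLM_coe]
    rfl
  rw [key]
  refine ContDiffAt.const_smul _ ((alternatizationCLM E p).contDiff.contDiffAt.comp x ?_)
  refine ContDiffAt.clm_apply ?_ ?_
  · exact (ContinuousMultilinearMap.contDiff _).contDiffAt.comp x (contDiffAt_pi.2 fun _ => hg)
  · exact (ContinuousLinearMap.contDiff _).contDiffAt.comp x hf

lemma extDeriv_sub {E : Type*} [NormedAddCommGroup E] [NormedSpace ℝ E] {p : ℕ}
    {f g : E → E [⋀^Fin p]→L[ℝ] ℝ} {x : E} (hf : DifferentiableAt ℝ f x)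
    (hg : DifferentiableAt ℝ g x) :
    extDeriv (fun y => f y - g y) x = extDeriv f x - extDeriv g x := by
  rw [extDeriv, extDeriv, extDeriv, fderiv_fun_sub hf hg]
  exact map_sub (ContinuousAlternatingMap.alternatizeUncurryFinCLM ℝ E ℝ) _ _

/-! ### Changing a map inside a chart ball where the form is exact. -/

section LocalStep

variable {p n : ℕ}
  {L : Type*} [TopologicalSpace L] [ChartedSpace (EuclideanSpace ℝ (Fin (p + 1))) L]
  [IsManifold (𝓡 (p + 1)) ∞ L] [T2Space L] [CompactSpace L] [MeasurableSpace L] [BorelSpace L]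
  [RiemannianBundle (fun x : L => TangentSpace (𝓡 (p + 1)) x)]
  [IsContMDiffRiemannianBundle (𝓡 (p + 1)) ∞ (EuclideanSpace ℝ (Fin (p + 1)))
      (fun x : L => TangentSpace (𝓡 (p + 1)) x)]
  {M : Type*} [TopologicalSpace M] [ChartedSpace (EuclideanSpace ℝ (Fin n)) M]
  [IsManifold (𝓡 n) ∞ M]
  {o : ManifoldOrientation (p + 1) L} {x₀ : L} {W : Set L} {ε : ℝ}

/-- The integral of `u^* β` does not change if `u` is modified in a compact part of an open set
mapped into a set on which `β` is exact. -/
lemma IsOrientedNhd.formIntegral_pullback_eq (hW : IsOrientedNhd o x₀ W ε) {β : Form n M (p + 1)}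
    (hβ : IsSmoothForm β) {z : M} {B : Set (EuclideanSpace ℝ (Fin n))}
    {γ : EuclideanSpace ℝ (Fin n) → EuclideanSpace ℝ (Fin n) [⋀^Fin p]→L[ℝ] ℝ}
    (hγ : ContDiff ℝ 1 γ) (hB : ∀ b ∈ B, extDeriv γ b = localRep β z b)
    {K : Set L} (hK : IsClosed K) (hKW : K ⊆ W) {f f' : L → M}
    (hf : ContMDiff (𝓡 (p + 1)) (𝓡 n) ∞ f) (hf' : ContMDiff (𝓡 (p + 1)) (𝓡 n) ∞ f')
    (hff' : ∀ x ∉ K, f' x = f x) (hfW : MapsInto n z B W f) (hfW' : MapsInto n z B W f') :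
    formIntegral o (pullback (k := p + 1) f' β) = formIntegral o (pullback (k := p + 1) f β) := by
  have hsf := IsSmoothForm.pullback hf hβ
  have hsf' := IsSmoothForm.pullback hf' hβ
  set a := readIn (p + 1) n f x₀ z with ha
  set a' := readIn (p + 1) n f' x₀ z with ha'
  -- A coordinate primitive of the pulled-back form: the pullback of `γ`.
  let q : (EuclideanSpace ℝ (Fin (p + 1)) → EuclideanSpace ℝ (Fin n)) →
      EuclideanSpace ℝ (Fin (p + 1)) → EuclideanSpace ℝ (Fin (p + 1)) [⋀^Fin p]→L[ℝ] ℝ :=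
    fun a y => (γ (a y)).compContinuousLinearMap (fderiv ℝ a y)
  have hq : ∀ {g : L → M}, ContMDiff (𝓡 (p + 1)) (𝓡 n) ∞ g → MapsInto n z B W g →
      ∀ y ∈ (extChartAt (𝓡 (p + 1)) x₀).target, (extChartAt (𝓡 (p + 1)) x₀).symm y ∈ W →
      ContDiffAt ℝ 1 (q (readIn (p + 1) n g x₀ z)) y ∧
      localRep (pullback g β) x₀ y = extDeriv (q (readIn (p + 1) n g x₀ z)) y := by
    intro g hg hgW y hy hyW
    obtain ⟨h1, h2⟩ := hgW _ hyW
    have h3 := contDiffAt_readIn hg x₀ z hy h1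
    refine ⟨contDiffAt_pullback_flat (hγ.contDiffAt.comp y (h3.of_le (by exact_mod_cast le_top)))
      (h3.fderiv_right (m := 1) (WithTop.coe_le_coe.2 le_top)), ?_⟩
    rw [extDeriv_pullback (hγ.differentiable (by simp)).differentiableAt h3 (r := ∞) (by
      rw [minSmoothness_of_isRCLikeNormedField]; exact WithTop.coe_le_coe.2 le_top),
      (localRep_pullback hg β x₀ z hy h1).eq_of_nhds]
    exact congrArg (fun A : EuclideanSpace ℝ (Fin n) [⋀^Fin (p + 1)]→L[ℝ] ℝ =>
      A.compContinuousLinearMap (fderiv ℝ (readIn (p + 1) n g x₀ z) y)) (hB _ h2).symm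
  have key : formIntegral o (pullback (k := p + 1) f' β - pullback (k := p + 1) f β) = 0 := by
    refine hW.formIntegral_eq_zero (sub_mem (H := smoothForms (p + 1) L (p + 1)) hsf' hsf) hK hKW ?_
      (η := fun y => q a' y - q a y) ?_ ?_ ?_
    · intro x hx
      have : f' =ᶠ[𝓝 x] f := by
        filter_upwards [hK.isOpen_compl.mem_nhds hx] with y hy using hff' y hy
      exact sub_eq_zero.2 (pullback_congr β this)
    · rintro y ⟨hy, hyW⟩
      exact ((hq hf' hfW' y hy hyW).1.sub (hq hf hfW y hy hyW).1).contDiffWithinAt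
    · intro y hy hyK
      have hc := (continuousOn_extChartAt_symm (I := 𝓡 (p + 1)) x₀).continuousAt
        ((isOpen_extChartAt_target x₀).mem_nhds hy)
      -- The pulled-back primitive involves the derivative of the map, so equality of germs is
      -- needed; it holds because `K` is closed.
      have : a' =ᶠ[𝓝 y] a := by
        filter_upwards [hc.preimage_mem_nhds (hK.isOpen_compl.mem_nhds hyK)] with y' hy'
        rw [ha, ha', readIn, readIn, hff' _ hy']
      simp only [q, this.fderiv_eq, this.eq_of_nhds, sub_self]
    · intro y hy hyW
      obtain ⟨h1, h2⟩ := hq hf hfW y hy hyW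
      obtain ⟨h1', h2'⟩ := hq hf' hfW' y hy hyW
      rw [extDeriv_sub (h1'.differentiableAt (by simp)) (h1.differentiableAt (by simp)), ← h2, ← h2']
      rfl
  have := map_sub (smoothFormIntegral o) ⟨_, hsf'⟩ ⟨_, hsf⟩
  exact sub_eq_zero.1 (this.symm.trans key)

lemma IsOrientedNhd.inter (hW : IsOrientedNhd o x₀ W ε) {V : Set L} (hV : IsOpen V) (hx : x₀ ∈ V) :
    IsOrientedNhd o x₀ (W ∩ V) ε where
  isOpen := hW.isOpen.inter hV
  mem := ⟨hW.mem, hx⟩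
  subset := Set.inter_subset_left.trans hW.subset
  sq := hW.sq
  volForm_eq y hy hyW := hW.volForm_eq y hy hyW.1

end LocalStep

/-! ### Continuity of interpolation in the compact-open topology. -/

section Perturbation

variable {k n : ℕ} {L : Type*} [TopologicalSpace L] [CompactSpace L] [T2Space L]
  {M : Type*} [TopologicalSpace M] [ChartedSpace (EuclideanSpace ℝ (Fin n)) M]
  {z : M} {ρ : L → ℝ} {B : Set (EuclideanSpace ℝ (Fin n))}

lemma isOpen_mapsInto (z : M) (hB : IsOpen B) {K : Set L} (hK : IsCompact K) :
    IsOpen {f : C(L, M) | MapsInto n z B K f} :=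
  ContinuousMap.isOpen_setOfPred_mapsTo hK
    ((continuousOn_extChartAt z).isOpen_inter_preimage (isOpen_extChartAt_source z) hB)

/-- Interpolating `f` towards `g` is a continuous operation on pairs that fixes `(f₀, f₀)`; hence
pairs close to `f₀` are sent into the prescribed neighbourhood. -/
lemma eventually_interp_comp (hBo : IsOpen B) (hB : Convex ℝ B)
    (hBT : B ⊆ (extChartAt (𝓡 n) z).target) (hρ : ∀ x, ρ x ∈ Set.Icc (0 : ℝ) 1)
    (hρc : Continuous ρ) {f₀ : C(L, M)} (hf₀ : MapsInto n z B (tsupport ρ) f₀)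
    {N' : Set C(L, M)} (hN' : N' ∈ 𝓝 f₀) :
    ∃ N ∈ 𝓝 f₀, ∀ f ∈ N, ∀ g ∈ N, MapsInto n z B (tsupport ρ) f ∧ MapsInto n z B (tsupport ρ) g ∧
      ∃ f' ∈ N', (f' : L → M) = interp n z ρ f fun x => extChartAt (𝓡 n) z (g x) := by
  let O : Set C(L, M) := {f | MapsInto n z B (tsupport ρ) f}
  have hO : IsOpen O := isOpen_mapsInto z hBo (isClosed_tsupport ρ).isCompact
  have hcont : Continuous fun q : (O × O) × L =>
      interp n z ρ q.1.1.1 (fun x => extChartAt (𝓡 n) z (q.1.2.1 x)) q.2 := by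
    refine continuous_interp_param (F := fun a : O × O => (a.1.1 : L → M))
      (H := fun a x => extChartAt (𝓡 n) z (a.2.1 x)) hB hBT hρ hρc (by fun_prop) ?_
      (fun a => a.1.2) (fun a x hx => (a.2.2 x hx).2)
    intro a x hx
    refine ContinuousAt.comp (f := fun q : (O × O) × L => q.1.2.1 q.2)
      (continuousAt_extChartAt' (a.2.2 x hx).1) ?_
    fun_prop
  let T : C(O × O, C(L, M)) := ContinuousMap.curry ⟨_, hcont⟩
  have hT : ∀ a x, T a x = interp n z ρ a.1.1 (fun x => extChartAt (𝓡 n) z (a.2.1 x)) x :=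
    fun _ _ => rfl
  clear_value T
  have hT0 : T (⟨f₀, hf₀⟩, ⟨f₀, hf₀⟩) = f₀ := by
    ext x
    rw [hT]
    exact interp_of_chart_eq fun hx => ⟨(hf₀ x hx).1, rfl⟩
  have hpre : T ⁻¹' N' ∈ 𝓝 ((⟨f₀, hf₀⟩, ⟨f₀, hf₀⟩) : O × O) :=
    T.continuous.continuousAt.preimage_mem_nhds (by rwa [hT0])
  rw [nhds_prod_eq, Filter.mem_prod_iff] at hpre
  obtain ⟨N₁, h₁, N₂, h₂, hN⟩ := hpre
  refine ⟨_, Filter.inter_mem (hO.isOpenEmbedding_subtypeVal.image_mem_nhds.2 h₁)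
    (hO.isOpenEmbedding_subtypeVal.image_mem_nhds.2 h₂), ?_⟩
  rintro _ ⟨⟨f, hf, rfl⟩, -⟩ _ ⟨-, ⟨g, hg, rfl⟩⟩
  exact ⟨f.2, g.2, T (f, g), hN ⟨hf, hg⟩, funext (hT _)⟩

/-- Here the target is a single smooth coordinate map `h` working for all `f` near `f₀`, which
serves to smooth `f`. -/
lemma eventually_interp [ChartedSpace (EuclideanSpace ℝ (Fin k)) L] [IsManifold (𝓡 k) ∞ L]
    (hBo : IsOpen B) (hB : Convex ℝ B)
    (hBT : B ⊆ (extChartAt (𝓡 n) z).target) (hρ : ∀ x, ρ x ∈ Set.Icc (0 : ℝ) 1)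
    (hρc : Continuous ρ) {f₀ : C(L, M)} (hf₀ : MapsInto n z B (tsupport ρ) f₀)
    {N' : Set C(L, M)} (hN' : N' ∈ 𝓝 f₀) :
    ∃ N ∈ 𝓝 f₀, ∃ h : L → EuclideanSpace ℝ (Fin n), ContMDiff (𝓡 k) (𝓡 n) ∞ h ∧
      (∀ x ∈ tsupport ρ, h x ∈ B) ∧ ∀ f ∈ N, MapsInto n z B (tsupport ρ) f ∧
      ∃ f' ∈ N', (f' : L → M) = interp n z ρ f h := by
  let O : Set C(L, M) := {f | MapsInto n z B (tsupport ρ) f}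
  have hO : IsOpen O := isOpen_mapsInto z hBo (isClosed_tsupport ρ).isCompact
  let P : Set C(L, EuclideanSpace ℝ (Fin n)) := {h | Set.MapsTo h (tsupport ρ) B}
  have hP : IsOpen P := ContinuousMap.isOpen_setOfPred_mapsTo (isClosed_tsupport ρ).isCompact hBo
  have hcont : Continuous fun q : (O × P) × L => interp n z ρ q.1.1.1 q.1.2.1 q.2 :=
    continuous_interp_param (F := fun a : O × P => (a.1.1 : L → M))
      (H := fun a x => a.2.1 x) hB hBT hρ hρc (by fun_prop)
      (fun a x _ => by fun_prop) (fun a => a.1.2) (fun a x hx => a.2.2 hx)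
  let T : C(O × P, C(L, M)) := ContinuousMap.curry ⟨_, hcont⟩
  have hφc : Continuous ((tsupport ρ).domRestrict fun x => extChartAt (𝓡 n) z (f₀ x)) :=
    continuousOn_iff_continuous_domRestrict.1 fun x hx => (ContinuousAt.comp (f := f₀)
      (continuousAt_extChartAt' (hf₀ x hx).1) f₀.continuous.continuousAt).continuousWithinAt
  -- Tietze: the coordinates of `f₀` exist only near the support of `ρ`, and are extended to a
  -- continuous map on all of `L`.
  obtain ⟨h₀, hh₀⟩ := ContinuousMap.exists_restrict_eq (isClosed_tsupport ρ) ⟨_, hφc⟩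
  have hh₀' : ∀ x ∈ tsupport ρ, h₀ x = extChartAt (𝓡 n) z (f₀ x) := fun x hx =>
    DFunLike.congr_fun hh₀ ⟨x, hx⟩
  have hh₀P : h₀ ∈ P := fun x hx => by rw [hh₀' x hx]; exact (hf₀ x hx).2
  have hT0 : T (⟨f₀, hf₀⟩, ⟨h₀, hh₀P⟩) = f₀ := by
    ext x
    exact interp_of_chart_eq fun hx => ⟨(hf₀ x hx).1, hh₀' x hx⟩
  have hpre : T ⁻¹' N' ∈ 𝓝 ((⟨f₀, hf₀⟩, ⟨h₀, hh₀P⟩) : O × P) :=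
    T.continuous.continuousAt.preimage_mem_nhds (by rwa [hT0])
  rw [nhds_prod_eq, Filter.mem_prod_iff] at hpre
  obtain ⟨N₁, h₁, N₂, h₂, hN⟩ := hpre
  obtain ⟨ε, hε, hball⟩ := Metric.mem_nhds_iff.1
    (hP.isOpenEmbedding_subtypeVal.image_mem_nhds.2 h₂)
  -- A partition of unity gives a smooth map uniformly within `ε` of `h₀`.
  obtain ⟨h, hh⟩ := exists_contMDiffMap_forall_mem_convex_of_local_const (n := (⊤ : ℕ∞)) (𝓡 k)
    (t := fun x => Metric.ball (h₀ x) ε) (fun x => convex_ball _ _) fun x => ⟨h₀ x, by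
      filter_upwards [h₀.continuous.continuousAt.preimage_mem_nhds (Metric.ball_mem_nhds _ hε)]
        with y hy
      rwa [Metric.mem_ball, dist_comm]⟩
  obtain ⟨h', hh'N, hh'⟩ := hball (a := (h : C(L, EuclideanSpace ℝ (Fin n)))) (by
    rw [Metric.mem_ball, ContinuousMap.dist_lt_iff hε]; exact hh)
  have hh'' : (h'.1 : L → EuclideanSpace ℝ (Fin n)) = h := by rw [hh']; rfl
  refine ⟨_, hO.isOpenEmbedding_subtypeVal.image_mem_nhds.2 h₁, h, h.contMDiff, fun x hx => ?_, ?_⟩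
  · rw [← hh'']; exact h'.2 hx
  rintro _ ⟨f, hf, rfl⟩
  refine ⟨f.2, T (f, h'), hN ⟨hf, hh'N⟩, ?_⟩
  rw [← hh'']; rfl

end Perturbation

/-! ### From finitely many patches to homotopy invariance. -/

section HomotopyInvariance

variable {p n : ℕ}
  {L : Type*} [TopologicalSpace L] [ChartedSpace (EuclideanSpace ℝ (Fin (p + 1))) L]
  [IsManifold (𝓡 (p + 1)) ∞ L] [T2Space L] [CompactSpace L] [MeasurableSpace L] [BorelSpace L]
  [RiemannianBundle (fun x : L => TangentSpace (𝓡 (p + 1)) x)]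
  [IsContMDiffRiemannianBundle (𝓡 (p + 1)) ∞ (EuclideanSpace ℝ (Fin (p + 1)))
      (fun x : L => TangentSpace (𝓡 (p + 1)) x)]
  {M : Type*} [TopologicalSpace M] [ChartedSpace (EuclideanSpace ℝ (Fin n)) M]
  [IsManifold (𝓡 n) ∞ M]

/-- A cutoff function `ρ` and a convex part `B` of the chart at `z` containing the image of the
support of `ρ` under `f₀`, such that `∫ u^* β` does not change if `u` is changed, within `B`, on the
support of `ρ`. -/
structure IsPatch (o : ManifoldOrientation (p + 1) L) (β : Form n M (p + 1)) (f₀ : C(L, M))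
    (z : M) (B : Set (EuclideanSpace ℝ (Fin n))) (ρ : L → ℝ) : Prop where
  isOpen : IsOpen B
  convex : Convex ℝ B
  subset : B ⊆ (extChartAt (𝓡 n) z).target
  mem_Icc : ∀ x, ρ x ∈ Set.Icc (0 : ℝ) 1
  contMDiff : ContMDiff (𝓡 (p + 1)) 𝓘(ℝ, ℝ) ∞ ρ
  mapsInto : MapsInto n z B (tsupport ρ) f₀
  formIntegral_eq : ∀ {f f' : L → M}, ContMDiff (𝓡 (p + 1)) (𝓡 n) ∞ f →
    ContMDiff (𝓡 (p + 1)) (𝓡 n) ∞ f' → (∀ x ∉ tsupport ρ, f' x = f x) →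
    MapsInto n z B (tsupport ρ) f → MapsInto n z B (tsupport ρ) f' →
    formIntegral o (pullback (k := p + 1) f' β) = formIntegral o (pullback (k := p + 1) f β)

/-- Take a chart ball around `f₀ x` on which the Poincaré lemma provides a primitive, and a bump
function at `x` supported in an oriented neighbourhood that `f₀` maps into this ball. -/
lemma exists_isPatch (o : ManifoldOrientation (p + 1) L) {β : Form n M (p + 1)}
    (hβ : β ∈ closedForms n M (p + 1)) (f₀ : C(L, M)) (x : L) :
    ∃ z B ρ, IsPatch o β f₀ z B ρ ∧ ρ =ᶠ[𝓝 x] fun _ => 1 := by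
  obtain ⟨W, ε, hW⟩ := exists_isOrientedNhd o x
  set z := f₀ x with hz
  obtain ⟨r, hr, hrT, γ, hγ, hγβ⟩ := exists_local_primitive
    (isOpen_extChartAt_target (I := 𝓡 n) z) (hβ.1 z) (fun y hy => by
      rw [← localRep_mextDeriv hβ.1 z hy, hβ.2]; rfl) (mem_extChartAt_target z)
  set B := Metric.ball (extChartAt (𝓡 n) z z) r
  have hG : IsOpen ((extChartAt (𝓡 n) z).source ∩ extChartAt (𝓡 n) z ⁻¹' B) :=
    (continuousOn_extChartAt z).isOpen_inter_preimage (isOpen_extChartAt_source z)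
      Metric.isOpen_ball
  have hV : W ∩ f₀ ⁻¹' ((extChartAt (𝓡 n) z).source ∩ extChartAt (𝓡 n) z ⁻¹' B) ∈ 𝓝 x :=
    (hW.isOpen.inter (hG.preimage f₀.continuous)).mem_nhds
      ⟨hW.mem, mem_extChartAt_source z, Metric.mem_ball_self hr⟩
  obtain ⟨ρ, -, hρ⟩ := (SmoothBumpFunction.nhds_basis_tsupport (I := 𝓡 (p + 1)) x).mem_iff.1 hV
  refine ⟨z, B, ρ, ⟨Metric.isOpen_ball, convex_ball _ _, hrT, fun _ => ρ.mem_Icc, ρ.contMDiff,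
    fun y hy => (hρ hy).2, ?_⟩, ρ.eventuallyEq_one⟩
  intro f f' hf hf' hff' hfB hfB'
  have hx : x ∈ tsupport ρ := subset_tsupport _ ρ.c_mem_support
  -- `f` and `f'` are controlled only on the support of `ρ`, so the oriented neighbourhood is shrunk
  -- to the open set that both map into the ball.
  refine (hW.inter ((hG.preimage hf.continuous).inter (hG.preimage hf'.continuous))
    ⟨hfB x hx, hfB' x hx⟩).formIntegral_pullback_eq hβ.1 hγ hγβ (isClosed_tsupport ρ)
    (fun y hy => ⟨(hρ hy).1, hfB y hy, hfB' y hy⟩) hf hf' hff' (fun y hy => hy.2.1)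
    fun y hy => hy.2.2

variable {o : ManifoldOrientation (p + 1) L} {β : Form n M (p + 1)} {f₀ : C(L, M)}
  {ι : Type*} {z : ι → M} {B : ι → Set (EuclideanSpace ℝ (Fin n))} {ρ : ι → L → ℝ}

/-- Patch by patch, `f` is replaced by `g` where the cutoffs are `1`; each replacement preserves the
integral. -/
lemma exists_replace (hP : ∀ i, IsPatch o β f₀ (z i) (B i) (ρ i)) (t : Finset ι) :
    ∀ N' ∈ 𝓝 f₀, ∃ N ∈ 𝓝 f₀, ∀ f ∈ N, ∀ g ∈ N, ContMDiff (𝓡 (p + 1)) (𝓡 n) ∞ f →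
      ContMDiff (𝓡 (p + 1)) (𝓡 n) ∞ g → ∃ f' ∈ N', ContMDiff (𝓡 (p + 1)) (𝓡 n) ∞ f' ∧
      formIntegral o (pullback (k := p + 1) f' β) = formIntegral o (pullback (k := p + 1) f β) ∧
      ∀ x, (f x = g x ∨ ∃ i ∈ t, ρ i x = 1) → f' x = g x := by
  classical
  induction t using Finset.induction_on with
  | empty =>
    exact fun N' hN' => ⟨N', hN', fun f hf g _ hfs _ => ⟨f, hf, hfs, rfl, by simp⟩⟩
  | insert i t _ ih =>
    intro N' hN'
    obtain ⟨N₁, hN₁, h₁⟩ := eventually_interp_comp (hP i).isOpen (hP i).convex (hP i).subset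
      (hP i).mem_Icc (hP i).contMDiff.continuous (hP i).mapsInto hN'
    -- Neighbourhoods are chosen backwards: the result of the earlier replacements must still be
    -- close enough to `f₀` for the patch `i`.
    obtain ⟨N, hN, h⟩ := ih N₁ hN₁
    refine ⟨N ∩ N₁, Filter.inter_mem hN hN₁, fun f hf g hg hfs hgs => ?_⟩
    obtain ⟨f₁, hf₁, hf₁s, hI, heq⟩ := h f hf.1 g hg.1 hfs hgs
    obtain ⟨hfB, hgB, f', hf', hf'e⟩ := h₁ f₁ hf₁ g hg.2
    have hhB : ∀ x ∈ tsupport (ρ i), extChartAt (𝓡 n) (z i) (g x) ∈ B i := fun x hx => (hgB x hx).2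
    have hf's : ContMDiff (𝓡 (p + 1)) (𝓡 n) ∞ f' := by
      rw [hf'e]
      exact fun x => contMDiffAt_interp (hP i).convex (hP i).subset (hP i).mem_Icc
        (hP i).contMDiff (hf₁s x) (fun hx => ContMDiffAt.comp x
          (contMDiffAt_extChartAt' (by simpa using (hgB x hx).1)) (hgs x)) hfB hhB
    refine ⟨f', hf', hf's, ?_, fun x hx => ?_⟩
    · rw [← hI]
      refine (hP i).formIntegral_eq hf₁s hf's (fun x hx => ?_) hfB ?_
      · rw [hf'e, interp_of_notMem hx]
      · rw [hf'e]
        exact mapsInto_interp (hP i).convex (hP i).subset (hP i).mem_Icc hfB hhB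
    · rw [hf'e]
      have h2 : f₁ x = g x → interp n (z i) (ρ i) f₁
          (fun x => extChartAt (𝓡 n) (z i) (g x)) x = g x := fun h3 => by
        rw [interp_of_chart_eq fun hx => ⟨(hfB x hx).1, by rw [h3]⟩, h3]
      rcases hx with hx | ⟨j, hj, hjx⟩
      · exact h2 (heq x (Or.inl hx))
      · rcases Finset.mem_insert.1 hj with rfl | hj
        · rw [interp_of_eq_one hjx]
          exact (extChartAt (𝓡 n) (z j)).left_inv
            (hgB x (subset_tsupport _ (by simp [hjx]))).1
        · exact h2 (heq x (Or.inr ⟨j, hj, hjx⟩))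

/-- Interpolation produces smoothness where the cutoff is `1` near the point, and preserves it
wherever earlier patches have achieved it. -/
lemma exists_smoothing (hP : ∀ i, IsPatch o β f₀ (z i) (B i) (ρ i)) (t : Finset ι) :
    ∀ N' ∈ 𝓝 f₀, ∃ f' ∈ N', ∀ x, (∃ i ∈ t, ρ i =ᶠ[𝓝 x] fun _ => 1) →
      ContMDiffAt (𝓡 (p + 1)) (𝓡 n) ∞ f' x := by
  classical
  induction t using Finset.induction_on with
  | empty => exact fun N' hN' => ⟨f₀, mem_of_mem_nhds hN', by simp⟩
  | insert i t _ ih =>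
    intro N' hN'
    obtain ⟨N, hN, h, hhs, hhB, hint⟩ := eventually_interp (k := p + 1) (hP i).isOpen (hP i).convex
      (hP i).subset (hP i).mem_Icc (hP i).contMDiff.continuous (hP i).mapsInto hN'
    obtain ⟨f, hf, hfs⟩ := ih N hN
    obtain ⟨hfB, f', hf', hf'e⟩ := hint f hf
    refine ⟨f', hf', fun x hx => ?_⟩
    rw [hf'e]
    obtain ⟨j, hj, hjx⟩ := hx
    rcases Finset.mem_insert.1 hj with rfl | hj
    · have hB := hhB x (subset_tsupport _ (by simp [hjx.eq_of_nhds]))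
      have h2 : ContMDiffAt (𝓡 n) (𝓡 n) ∞ (extChartAt (𝓡 n) (z j)).symm (h x) :=
        (contMDiffOn_extChartAt_symm (I := 𝓡 n) (n := ∞) (z j)).contMDiffAt
          ((isOpen_extChartAt_target (z j)).mem_nhds ((hP j).subset hB))
      refine (ContMDiffAt.comp x h2 (hhs x)).congr_of_eventuallyEq ?_
      filter_upwards [hjx] with y hy using interp_of_eq_one hy
    · exact contMDiffAt_interp (hP i).convex (hP i).subset (hP i).mem_Icc (hP i).contMDiff
        (hfs x ⟨j, hj, hjx⟩) (fun _ => hhs x) hfB hhB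

/-- By compactness finitely many patches have cutoffs equal to `1` near every point. Smoothing over
all of them yields a smooth map; replacing over all of them turns `f` into `g`. -/
lemma exists_contMDiff_mem_and_formIntegral_eq (o : ManifoldOrientation (p + 1) L)
    (hβ : β ∈ closedForms n M (p + 1)) (f₀ : C(L, M)) :
    (∀ N' ∈ 𝓝 f₀, ∃ f ∈ N', ContMDiff (𝓡 (p + 1)) (𝓡 n) ∞ f) ∧
    ∃ N ∈ 𝓝 f₀, ∀ f ∈ N, ∀ g ∈ N, ContMDiff (𝓡 (p + 1)) (𝓡 n) ∞ f →
      ContMDiff (𝓡 (p + 1)) (𝓡 n) ∞ g →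
      formIntegral o (pullback (k := p + 1) f β) = formIntegral o (pullback (k := p + 1) g β) := by
  choose z B ρ hP hρ using exists_isPatch o hβ f₀
  obtain ⟨t, ht⟩ := CompactSpace.elim_nhds_subcover (fun x => {y | ρ x =ᶠ[𝓝 y] fun _ => 1})
    fun x => (hρ x).eventuallyEq_nhds
  have hcov : ∀ y, ∃ x ∈ t, ρ x =ᶠ[𝓝 y] fun _ => 1 := fun y => by
    have hy : y ∈ ⋃ x ∈ t, {y | ρ x =ᶠ[𝓝 y] fun _ => 1} := by rw [ht]; trivial
    simpa using hy
  constructor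
  · intro N' hN'
    obtain ⟨f, hf, hfs⟩ := exists_smoothing hP t N' hN'
    exact ⟨f, hf, fun x => hfs x (hcov x)⟩
  · obtain ⟨N, hN, h⟩ := exists_replace hP t Set.univ Filter.univ_mem
    refine ⟨N, hN, fun f hf g hg hfs hgs => ?_⟩
    obtain ⟨f', -, -, hI, heq⟩ := h f hf g hg hfs hgs
    rw [← hI]
    have : (f' : L → M) = g := funext fun x => heq x (Or.inr <| by
      obtain ⟨i, hi, hix⟩ := hcov x
      exact ⟨i, hi, hix.eq_of_nhds⟩)
    rw [this]

/-- The integral of the pullback of a closed form is invariant under homotopy. -/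
lemma formIntegral_pullback_eq_of_homotopic (o : ManifoldOrientation (p + 1) L)
    (hβ : β ∈ closedForms n M (p + 1)) {u v : C(L, M)} (hu : ContMDiff (𝓡 (p + 1)) (𝓡 n) ∞ u)
    (hv : ContMDiff (𝓡 (p + 1)) (𝓡 n) ∞ v) (huv : u.Homotopic v) :
    formIntegral o (pullback (k := p + 1) u β) = formIntegral o (pullback (k := p + 1) v β) := by
  have hdense := fun f₀ : C(L, M) => (exists_contMDiff_mem_and_formIntegral_eq o hβ f₀).1
  choose N hN hNI using fun f₀ : C(L, M) => (exists_contMDiff_mem_and_formIntegral_eq o hβ f₀).2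
  choose s hsN hs using fun f₀ : C(L, M) => hdense f₀ (N f₀) (hN f₀)
  -- Extension of the integral to continuous maps: evaluate it on a nearby smooth map `s f₀`.
  let J : C(L, M) → ℝ := fun f₀ => formIntegral o (pullback (k := p + 1) (s f₀) β)
  have hJ : ∀ f : C(L, M), ContMDiff (𝓡 (p + 1)) (𝓡 n) ∞ f →
      J f = formIntegral o (pullback (k := p + 1) f β) := fun f hf =>
    hNI f _ (hsN f) _ (mem_of_mem_nhds (hN f)) (hs f) hf
  have hloc : IsLocallyConstant J := by
    rw [IsLocallyConstant.iff_eventually_eq]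
    intro f₀
    filter_upwards [eventually_mem_nhds_iff.2 (hN f₀)] with f₁ hf₁
    -- A smooth map in both neighbourhoods links the two values of `J`.
    obtain ⟨w, ⟨hw₀, hw₁⟩, hws⟩ := hdense f₁ _ (Filter.inter_mem hf₁ (hN f₁))
    exact (hNI f₁ _ (hsN f₁) w hw₁ (hs f₁) hws).trans (hNI f₀ w hw₀ _ (hsN f₀) hws (hs f₀))
  obtain ⟨H⟩ := huv
  have h := (hloc.comp_continuous H.curry.continuous).apply_eq_of_preconnectedSpace 0 1
  rwa [Function.comp_apply, Function.comp_apply, H.curry_zero, H.curry_one, hJ u hu, hJ v hv] at h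

end HomotopyInvariance

/-! ### The calibration inequality -/

section Calibration

open MeasureTheory

variable {k n : ℕ} [NeZero k]
  {L : Type*} [TopologicalSpace L] [ChartedSpace (EuclideanSpace ℝ (Fin k)) L]
  [IsManifold (𝓡 k) ∞ L]
  [RiemannianBundle (fun x : L => TangentSpace (𝓡 k) x)]
  [IsContMDiffRiemannianBundle (𝓡 k) ∞ (EuclideanSpace ℝ (Fin k))
      (fun x : L => TangentSpace (𝓡 k) x)]
  {M : Type*} [TopologicalSpace M] [ChartedSpace (EuclideanSpace ℝ (Fin n)) M]
  [RiemannianBundle (fun x : M => TangentSpace (𝓡 n) x)]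

/-- The trace of `u^*h` is independent of the orthonormal basis: both bases compute the same trace
formed with the Gram matrix of `e`. -/
lemma sq_normDu_eq_trace_gram (u : L → M) (x : L)
    (e : OrthonormalBasis (Fin k) ℝ (TangentSpace (𝓡 k) x)) :
    normDu (k := k) (n := n) u x ^ 2
      = (Matrix.gram ℝ fun i => mfderiv (𝓡 k) (𝓡 n) u x (e i)).trace := by
  let B : LinearMap.BilinForm ℝ (TangentSpace (𝓡 k) x) :=
    LinearMap.BilinForm.comp (innerₗ (TangentSpace (𝓡 n) (u x)))
      (mfderiv (𝓡 k) (𝓡 n) u x).toLinearMap (mfderiv (𝓡 k) (𝓡 n) u x).toLinearMap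
  have h1 := trace_inv_gram_mul e e e.toBasis.linearIndependent B
  have h2 := trace_inv_gram_mul (tangentONB x) e e.toBasis.linearIndependent B
  rw [normDu, Real.sq_sqrt (by positivity)]
  refine Eq.trans ?_ (h2.symm.trans h1)
  refine Fintype.sum_equiv (finCongr Fact.out) _ _ fun i => ?_
  simp only [tangentONB, B, OrthonormalBasis.reindex_apply, LinearMap.BilinForm.comp_apply]
  exact (real_inner_self_eq_norm_sq _).symm

lemma normDu_nonneg (u : L → M) (x : L) : 0 ≤ normDu (k := k) (n := n) u x := Real.sqrt_nonneg _

variable (o : ManifoldOrientation k L)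

/-- A positively oriented orthonormal basis of the tangent space. -/
def orientedONB (x : L) : OrthonormalBasis (Fin k) ℝ (TangentSpace (𝓡 k) x) :=
  (o.at' x).finOrthonormalBasis (Nat.pos_of_neZero k) Fact.out

lemma volForm_orientedONB (x : L) : volForm o x (orientedONB o x) = 1 := by
  rw [volForm, (o.at' x).volumeForm_robust (orientedONB o x)
    ((o.at' x).finOrthonormalBasis_orientation _ _), ← OrthonormalBasis.coe_toBasis,
    Module.Basis.det_self]

lemma volRatio_eq_apply_orientedONB (θ : Form k L k) (x : L) :
    volRatio o θ x = θ x (orientedONB o x) := by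
  rw [apply_eq_volRatio_mul o, volForm_orientedONB, mul_one]

variable {α : Form n M k}

lemma volRatio_pullback_le_sqrt_det (hα : IsCalibration α) (u : L → M) (x : L) :
    volRatio o (pullback u α) x
      ≤ √(Matrix.gram ℝ fun i => mfderiv (𝓡 k) (𝓡 n) u x (orientedONB o x i)).det := by
  rw [volRatio_eq_apply_orientedONB]
  exact hα (u x) fun i => mfderiv (𝓡 k) (𝓡 n) u x (orientedONB o x i)

lemma sqrt_det_gram_mfderiv_le (u : L → M) (x : L) :
    √(Matrix.gram ℝ fun i => mfderiv (𝓡 k) (𝓡 n) u x (orientedONB o x i)).det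
      ≤ 1 / (√(k : ℝ)) ^ k * normDu (k := k) (n := n) u x ^ k := by
  have h := sqrt_det_le (NeZero.ne k) (Matrix.posSemidef_gram ℝ
    fun i => mfderiv (𝓡 k) (𝓡 n) u x (orientedONB o x i))
  rwa [← sq_normDu_eq_trace_gram, Real.sqrt_sq (normDu_nonneg u x)] at h

lemma volRatio_pullback_le (hα : IsCalibration α) (u : L → M) (x : L) :
    volRatio o (pullback u α) x ≤ 1 / (√(k : ℝ)) ^ k * normDu (k := k) (n := n) u x ^ k :=
  (volRatio_pullback_le_sqrt_det o hα u x).trans (sqrt_det_gram_mfderiv_le o u x)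

variable [IsManifold (𝓡 n) ∞ M]

/-- Conformality follows from the first Smith condition: equality of the outer terms of `u^*α ≤
√(det G) ≤ (√k)⁻ᵏ|du|ᵏ` forces equality in AM-GM, so the Gram matrix `G` is scalar. -/
lemma isSmithImmersion_iff (hα : IsCalibration α) (u : C^∞⟮𝓡 k, L; 𝓡 n, M⟯) :
    IsSmithImmersion o α u ↔ ∀ x, volRatio o (pullback u α) x
      = 1 / (√(k : ℝ)) ^ k * normDu (k := k) (n := n) u x ^ k := by
  refine ⟨fun h x => ?_, fun h x => ⟨fun v => ?_, fun v w => ?_⟩⟩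
  · rw [volRatio_eq_apply_orientedONB, (h x).1, volForm_orientedONB, mul_one]
  · rw [apply_eq_volRatio_mul o, h x]
  · set e := orientedONB o x
    set G := Matrix.gram ℝ fun i => mfderiv (𝓡 k) (𝓡 n) u x (e i) with hG
    have htr : normDu (k := k) (n := n) u x ^ 2 = G.trace := sq_normDu_eq_trace_gram u x e
    have hdet : √G.det = 1 / (√(k : ℝ)) ^ k * (√G.trace) ^ k := by
      rw [← htr, Real.sqrt_sq (normDu_nonneg u x)]
      exact le_antisymm (sqrt_det_gram_mfderiv_le o u x)
        ((h x).symm.trans_le (volRatio_pullback_le_sqrt_det o hα u x))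
    have hG1 := eq_smul_one_of_sqrt_det_eq (NeZero.ne k) (Matrix.posSemidef_gram ℝ _) hdet
    rw [← htr] at hG1
    let B : LinearMap.BilinForm ℝ (TangentSpace (𝓡 k) x) :=
      LinearMap.BilinForm.comp (innerₗ (TangentSpace (𝓡 n) (u x)))
        (mfderiv (𝓡 k) (𝓡 n) u x).toLinearMap (mfderiv (𝓡 k) (𝓡 n) u x).toLinearMap
    let B' : LinearMap.BilinForm ℝ (TangentSpace (𝓡 k) x) :=
      (1 / (k : ℝ) * normDu (k := k) (n := n) u x ^ 2) • innerₗ (TangentSpace (𝓡 k) x)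
    have hBB' : B = B' := by
      refine LinearMap.BilinForm.ext_basis e.toBasis fun i j => ?_
      have h1 : B (e i) (e j) = G i j := rfl
      have h2 : B' (e i) (e j)
        = (1 / (k : ℝ) * normDu (k := k) (n := n) u x ^ 2) * inner ℝ (e i) (e j) := rfl
      rw [OrthonormalBasis.coe_toBasis, h2, orthonormal_iff_ite.1 e.orthonormal]
      refine (h1.trans (congrFun (congrFun hG1 i) j)).trans ?_
      rw [Matrix.smul_apply, smul_eq_mul, Matrix.one_apply]
    exact congrArg (fun B : LinearMap.BilinForm ℝ (TangentSpace (𝓡 k) x) => B v w) hBB'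

variable [MeasurableSpace L] [BorelSpace L]

variable (k n) in
lemma energy_natCast (u : L → M) : energy k n (k : ℝ) u
    = ∫ x, 1 / (√(k : ℝ)) ^ k * normDu (k := k) (n := n) u x ^ k ∂(riemannianVolume k L) := by
  rw [energy, Real.rpow_natCast, integral_const_mul]
  simp only [Real.rpow_natCast]

variable [T2Space L] [CompactSpace L]
  [IsContMDiffRiemannianBundle (𝓡 n) ∞ (EuclideanSpace ℝ (Fin n))
      (fun x : M => TangentSpace (𝓡 n) x)]

/-- The pointwise inequality is integrated. Equal integrals give equality almost everywhere, hence
everywhere by continuity and positivity of the volume on open sets. -/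
lemma formIntegral_pullback_le_energy (hαs : IsSmoothForm α) (hα : IsCalibration α)
    (u : C^∞⟮𝓡 k, L; 𝓡 n, M⟯) :
    formIntegral o (pullback u α) ≤ energy k n (k : ℝ) u ∧
      (energy k n (k : ℝ) u = formIntegral o (pullback u α) ↔ IsSmithImmersion o α u) := by
  have hr := continuous_volRatio o (IsSmoothForm.pullback u.contMDiff hαs)
  have he : Continuous fun x => 1 / (√(k : ℝ)) ^ k * normDu (k := k) (n := n) u x ^ k :=
    continuous_const.mul ((continuous_normDu u.contMDiff).pow k)
  have hri := integrable_volRatio o (IsSmoothForm.pullback u.contMDiff hαs)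
  have hei := he.integrable_of_hasCompactSupport (μ := riemannianVolume k L)
    (HasCompactSupport.of_compactSpace _)
  have hle := volRatio_pullback_le o hα u
  rw [energy_natCast, formIntegral]
  refine ⟨integral_mono hri hei hle, ?_⟩
  rw [isSmithImmersion_iff o hα, eq_comm,
    integral_eq_iff_of_ae_le hri hei (Filter.Eventually.of_forall hle), hr.ae_eq_iff_eq _ he,
    funext_iff]

/-- The energy of a smooth family of maps is differentiable. -/
lemma exists_hasDerivAt_energy (hk : 2 ≤ k) {U : ℝ → L → M}
    (hU : ContMDiff (𝓘(ℝ, ℝ).prod (𝓡 k)) (𝓡 n) ∞ (fun q : ℝ × L => U q.1 q.2)) :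
    ∃ D, HasDerivAt (fun s => energy k n (k : ℝ) (U s)) D 0 := by
  -- `|du|` need not be differentiable where `du = 0`, but `|du|ᵏ = (|du|²)^(k/2)`, and `t ↦
  -- t^(k/2)` is differentiable at `0` when the exponent is at least `1`.
  have hk2 : (1 : ℝ) ≤ (k : ℝ) / 2 := by
    rw [le_div_iff₀ two_pos]; exact_mod_cast (by omega : 1 * 2 ≤ k)
  set Q : ℝ → L → ℝ := fun s x => normDu (k := k) (n := n) (U s) x ^ 2 with hQ
  have hQc : Continuous fun q : ℝ × L => Q q.1 q.2 := continuous_sq_normDu_family hU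
  have hQd : ∀ s x, HasDerivAt (fun s => Q s x) (deriv (fun s => Q s x) s) s := fun s x =>
    (differentiable_sq_normDu_family hU x s).hasDerivAt
  have hQdc : Continuous fun q : ℝ × L => deriv (fun s => Q s q.2) q.1 :=
    continuous_deriv_sq_normDu_family hU
  have hpow : ∀ s x, normDu (k := k) (n := n) (U s) x ^ (k : ℝ) = Q s x ^ ((k : ℝ) / 2) := by
    intro s x
    simp only [hQ]
    rw [← Real.rpow_natCast, ← Real.rpow_mul (normDu_nonneg _ _)]
    congr 1
    push_cast
    ring
  simp only [energy, hpow]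
  let F' : ℝ → L → ℝ := fun s x =>
    deriv (fun s => Q s x) s * ((k : ℝ) / 2) * Q s x ^ ((k : ℝ) / 2 - 1)
  have hF'c : Continuous fun q : ℝ × L => F' q.1 q.2 :=
    (hQdc.mul continuous_const).mul (hQc.rpow_const fun _ => Or.inr (by linarith))
  have hFc : ∀ s, Continuous fun x => Q s x ^ ((k : ℝ) / 2) := fun s =>
    (hQc.comp (Continuous.prodMk_right s)).rpow_const fun _ => Or.inr (by linarith)
  -- Compactness of `[-1, 1] × L` bounds the derivative uniformly, giving a dominating constant.
  obtain ⟨C, hC⟩ := ((isCompact_Icc (a := (-1 : ℝ)) (b := 1)).prod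
    (isCompact_univ (X := L))).exists_bound_of_continuousOn hF'c.continuousOn
  have hint : ∀ {f : L → ℝ}, Continuous f → Integrable f (riemannianVolume k L) := fun hf =>
    hf.integrable_of_hasCompactSupport (HasCompactSupport.of_compactSpace _)
  have h := hasDerivAt_integral_of_dominated_loc_of_deriv_le (μ := riemannianVolume k L)
    (F := fun s x => Q s x ^ ((k : ℝ) / 2)) (F' := F') (bound := fun _ => C)
    (Icc_mem_nhds (by norm_num : (-1 : ℝ) < 0) one_pos)
    (Filter.Eventually.of_forall fun s => (hint (hFc s)).aestronglyMeasurable) (hint (hFc 0))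
    (hint (hF'c.comp (Continuous.prodMk_right 0))).aestronglyMeasurable
    (Filter.Eventually.of_forall fun x s hs => hC (s, x) ⟨hs, trivial⟩)
    (hint continuous_const)
    (Filter.Eventually.of_forall fun x s _ => (hQd s x).rpow_const (Or.inr hk2))
  exact ⟨_, h.2.const_mul _⟩

end Calibration

/-- The maps in a continuous family are homotopic. -/
lemma homotopic_family {L M : Type*} [TopologicalSpace L] [TopologicalSpace M]
    {U : ℝ → L → M} (hU : Continuous fun q : ℝ × L => U q.1 q.2) {u v : C(L, M)} {s : ℝ}
    (hu : U 0 = u) (hv : U s = v) : u.Homotopic v :=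
  ⟨{ toFun := fun q => U (s * q.1) q.2
     continuous_toFun := hU.comp
      ((continuous_const.mul (continuous_subtype_val.comp continuous_fst)).prodMk continuous_snd)
     map_zero_left := fun x => by simp [hu]
     map_one_left := fun x => by simp [hv] }⟩

end SmithMaps

end

/-! ### The main theorem. -/

theorem mainTheorem4 {k n : ℕ} (hk : 2 ≤ k)
    {L : Type*} [TopologicalSpace L] [ChartedSpace (EuclideanSpace ℝ (Fin k)) L]
    [IsManifold (𝓡 k) ∞ L] [T2Space L] [CompactSpace L] [MeasurableSpace L] [BorelSpace L]
    [RiemannianBundle (fun x : L => TangentSpace (𝓡 k) x)]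
    [IsContMDiffRiemannianBundle (𝓡 k) ∞ (EuclideanSpace ℝ (Fin k))
      (fun x : L => TangentSpace (𝓡 k) x)]
    (o : ManifoldOrientation k L)
    {M : Type*} [TopologicalSpace M] [ChartedSpace (EuclideanSpace ℝ (Fin n)) M]
    [IsManifold (𝓡 n) ∞ M] [T2Space M] [SecondCountableTopology M]
    [RiemannianBundle (fun x : M => TangentSpace (𝓡 n) x)]
    [IsContMDiffRiemannianBundle (𝓡 n) ∞ (EuclideanSpace ℝ (Fin n))
      (fun x : M => TangentSpace (𝓡 n) x)]
    (α : closedForms n M k) (hα : IsCalibration α.1) :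
    ∃ F : Module.Dual ℝ (DeRham k L k), IsFundamentalClass o F ∧
      (∀ u v : C^∞⟮𝓡 k, L; 𝓡 n, M⟯, (u : C(L, M)).Homotopic (v : C(L, M)) →
        homologyPushforward u F = homologyPushforward v F) ∧
      (∀ u : C^∞⟮𝓡 k, L; 𝓡 n, M⟯,
        homologyPushforward u F (deRhamClass α) ≤ energy k n (k : ℝ) u ∧
        (energy k n (k : ℝ) u = homologyPushforward u F (deRhamClass α) ↔
          IsSmithImmersion o α.1 u)) ∧
      (∀ u : C^∞⟮𝓡 k, L; 𝓡 n, M⟯, IsSmithImmersion o α.1 u →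
        (∀ v : C^∞⟮𝓡 k, L; 𝓡 n, M⟯, (u : C(L, M)).Homotopic (v : C(L, M)) →
          energy k n (k : ℝ) u ≤ energy k n (k : ℝ) v) ∧
        IsPHarmonic (k : ℝ) u) := by
  obtain ⟨p, rfl⟩ : ∃ p, k = p + 1 := ⟨k - 1, by omega⟩
  obtain ⟨F, hF⟩ := exists_isFundamentalClass o
  have hpush : ∀ (u : C^∞⟮𝓡 (p + 1), L; 𝓡 n, M⟯) (β : closedForms n M (p + 1)),
      homologyPushforward u F (deRhamClass β) = formIntegral o (pullback u β.1) := fun u β =>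
    hF (pullbackClosed (p + 1) u β)
  have hhom : ∀ u v : C^∞⟮𝓡 (p + 1), L; 𝓡 n, M⟯, (u : C(L, M)).Homotopic (v : C(L, M)) →
      ∀ β : closedForms n M (p + 1),
      formIntegral o (pullback u β.1) = formIntegral o (pullback v β.1) := fun u v huv β =>
    formIntegral_pullback_eq_of_homotopic o β.2 u.contMDiff v.contMDiff huv
  have hcal := formIntegral_pullback_le_energy o α.2.1 hα
  have hmin : ∀ u : C^∞⟮𝓡 (p + 1), L; 𝓡 n, M⟯, IsSmithImmersion o α.1 u →
      ∀ v : C^∞⟮𝓡 (p + 1), L; 𝓡 n, M⟯, (u : C(L, M)).Homotopic (v : C(L, M)) →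
      energy (p + 1) n ((p + 1 : ℕ) : ℝ) u ≤ energy (p + 1) n ((p + 1 : ℕ) : ℝ) v := by
    intro u hu v huv
    rw [(hcal u).2.2 hu, hhom u v huv]
    exact (hcal v).1
  refine ⟨F, hF, fun u v huv => ?_, fun u => by rw [hpush]; exact hcal u,
    fun u hu => ⟨hmin u hu, fun U hU hU0 => ?_⟩⟩
  · refine LinearMap.ext fun c => ?_
    obtain ⟨β, rfl⟩ := Submodule.Quotient.mk_surjective _ c
    exact (hpush u β).trans ((hhom u v huv β).trans (hpush v β).symm)
  · obtain ⟨D, hD⟩ := exists_hasDerivAt_energy hk hU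
    -- Each `U s` is homotopic to `u` through the family, so `0` is a global minimum of the energy
    -- along it.
    have hlm : IsLocalMin (fun s => energy (p + 1) n ((p + 1 : ℕ) : ℝ) (U s)) 0 := by
      refine Filter.Eventually.of_forall fun s => ?_
      have hUs : ContMDiff (𝓡 (p + 1)) (𝓡 n) ∞ (U s) :=
        hU.comp (contMDiff_const.prodMk contMDiff_id :
          ContMDiff (𝓡 (p + 1)) (𝓘(ℝ, ℝ).prod (𝓡 (p + 1))) ∞ fun x : L => (s, x))
      simp only [hU0]
      exact hmin u hu ⟨U s, hUs⟩ (homotopic_family hU.continuous hU0 rfl)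
    rwa [hlm.hasDerivAt_eq_zero hD] at hD
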